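/- Let $m,n\ge 1$, and let $A_{11}\in\mathbb R^{m\times m}$, $A_{12}\in\mathbb R^{m\times n}$, $A_{21}\in\mathbb R^{n\times m}$, $A_{22}\in\mathbb R^{n\times n}$, $b_1\in\mathbb R^m$, $b_2\in\mathbb R^n$ be such that $-A_{22}$ and $-\Delta$ are Hurwitz, where $\Delta:=A_{11}-A_{12}A_{22}^{-1}A_{21}$. Let $(\theta^\star,w^\star)$ be the solution of $A_{11}\theta^\star+A_{12}w^\star=b_1$, $A_{21}\theta^\star+A_{22}w^\star=b_2$. Vectors carry the Euclidean norm and matrices the operator norm. Then there are (necessarily unique) symmetric positive definite matrices $Q_{22},Q_\Delta$ with $A_{22}^\top Q_{22}+Q_{22}A_{22}=I$ and $\Delta^\top Q_\Delta+Q_\Delta\Delta=I$; put $a_{22}:=1/(4\|Q_{22}\|)$ and $a_\Delta:=1/(4\|Q_\Delta\|)$. Moreover, there is $r>0$, depending only on the $A_{ij}$ and $b_i$, with the following property. Let $1/2<a<b<1$, $c_{0,\beta},c_{0,\gamma}>0$ with $c_{0,\beta}/c_{0,\gamma}\le r$, $C_A,C_b>0$, an integer $t_{\mathrm{mix}}\ge1$,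 and $\theta_0\in\mathbb R^m$, $w_0\in\mathbb R^n$ be given. Then there are constants $C_{\mathrm{step}},C>0$, depending only on these data and on $A_{ij},b_i$ (in particular not on $p$, $k_0$ and $k$), such that the following holds for all real $p\ge2$ and $k_0\ge C_{\mathrm{step}}\,p^{4/b}$. Let $\beta_k=c_{0,\beta}(k+k_0)^{-b}$, $\gamma_k=c_{0,\gamma}(k+k_0)^{-a}$ for $k\ge0$. Let $L_0=0$, $U_k=\Delta-A_{12}L_k$, $$L_{k+1}=\bigl(L_k-\gamma_kA_{22}L_k+\beta_kA_{22}^{-1}A_{21}U_k\bigr)(I-\beta_kU_k)^{-1},\qquad D_k=L_{k+1}+A_{22}^{-1}A_{21};$$ the matrices $I-\beta_kU_k$ are all invertible. Let $\mathsf X$ be a Polish space and $\mathrm P$ a Markov kernel on $\mathsf X$ with unique invariant distribution $\pi$ which is uniformly geometrically ergodic: for all $k\ge0$, $$\sup_{x,x'\in\mathsf X}\mathsf d_{\mathrm{tv}}\bigl(\mathrm P^k(x,\cdot),\mathrm P^k(x',\cdot)\bigr)\le(1/4)^{\lfloor k/t_{\mathrm{mix}}\rfloor},\qquad \mathsf d_{\mathrm{tv}}(\mu,\nu)=\sup_B|\mu(B)-\nu(B)|.$$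 Let $\mathbf A_{ij}(\cdot)$, $\mathbf b_i(\cdot)$ be measurable functions on $\mathsf X$ with $\|\mathbf A_{ij}(x)\|\vee\|\mathbf A_{ij}(x)-A_{ij}\|\le C_A$ and $\|\mathbf b_i(x)\|\vee\|\mathbf b_i(x)-b_i\|\le C_b$ for all $x$, and $\pi(\mathbf A_{ij})=A_{ij}$, $\pi(\mathbf b_i)=b_i$ for $i,j\in\{1,2\}$. Let $(X_k)_{k\ge1}$ be a Markov chain with kernel $\mathrm P$ and arbitrary initial distribution, and let, for $k\ge0$, $$\theta_{k+1}=\theta_k+\beta_k\{\mathbf b_1(X_{k+1})-\mathbf A_{11}(X_{k+1})\theta_k-\mathbf A_{12}(X_{k+1})w_k\},$$ $$w_{k+1}=w_k+\gamma_k\{\mathbf b_2(X_{k+1})-\mathbf A_{21}(X_{k+1})\theta_k-\mathbf A_{22}(X_{k+1})w_k\}.$$ Put $\tilde\theta_{k+1}=\theta_{k+1}-\theta^\star$ and $\tilde w_{k+1}=w_{k+1}-w^\star+D_k\tilde\theta_{k+1}$. Then, for every $k\ge0$, $$\mathbb E^{1/p}\bigl[\|\tilde\theta_{k+1}\|^p\bigr]\le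 C\Bigl(\prod_{j=0}^k\bigl(1-\tfrac{a_\Delta\beta_j}{8}\bigr)+p^2\sqrt{\beta_k}\Bigr),\qquad \mathbb E^{1/p}\bigl[\|\tilde w_{k+1}\|^p\bigr]\le C\Bigl(\prod_{j=0}^k\bigl(1-\tfrac{a_{22}\gamma_j}{8}\bigr)+p^3\sqrt{\gamma_k}\Bigr).$$ -/

import Mathlib

open MeasureTheory ProbabilityTheory
open scoped ENNReal Matrix.Norms.L2Operator

namespace TTSA

/-- Euclidean space `ℝ^d`. -/
abbrev Vec (d : ℕ) : Type := EuclideanSpace ℝ (Fin d)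

/-- The coefficients `A₁₁, A₁₂, A₂₁, A₂₂, b₁, b₂` of a pair of coupled linear equations in
`(θ, w) ∈ ℝ^m × ℝ^n`. It is used both for the mean coefficients and, pointwise in the state `x`,
for the random coefficients `𝐀ᵢⱼ(x), 𝐛ᵢ(x)`. Matrices carry the Euclidean operator norm. -/
structure Coeffs (m n : ℕ) where
  A11 : Matrix (Fin m) (Fin m) ℝ
  A12 : Matrix (Fin m) (Fin n) ℝ
  A21 : Matrix (Fin n) (Fin m) ℝ
  A22 : Matrix (Fin n) (Fin n) ℝ
  b1 : Vec m
  b2 : Vec n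

/-- The action of a matrix on a Euclidean vector. -/
noncomputable def act {m n : ℕ} (A : Matrix (Fin m) (Fin n) ℝ) (x : Vec n) : Vec m :=
  Matrix.toEuclideanLin A x

/-- `Δ = A₁₁ - A₁₂ A₂₂⁻¹ A₂₁`. -/
noncomputable def Coeffs.schur {m n : ℕ} (M : Coeffs m n) : Matrix (Fin m) (Fin m) ℝ :=
  M.A11 - M.A12 * M.A22⁻¹ * M.A21

/-- `(θ, w)` solves `A₁₁ θ + A₁₂ w = b₁`, `A₂₁ θ + A₂₂ w = b₂`. -/
def Coeffs.IsSolution {m n : ℕ} (M : Coeffs m n) (θ : Vec m) (w : Vec n) : Prop :=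
  act M.A11 θ + act M.A12 w = M.b1 ∧ act M.A21 θ + act M.A22 w = M.b2

/-- A real square matrix is Hurwitz if all its complex eigenvalues have negative real part. -/
def IsHurwitz {d : ℕ} (A : Matrix (Fin d) (Fin d) ℝ) : Prop :=
  ∀ z ∈ spectrum ℂ (A.map (algebraMap ℝ ℂ)), z.re < 0

/-- `Q = Qᵀ ≻ 0` solves the Lyapunov equation `Aᵀ Q + Q A = I`. (If `-A` is Hurwitz, there is
exactly one such `Q`.) -/
def IsLyapunov {d : ℕ} (A Q : Matrix (Fin d) (Fin d) ℝ) : Prop :=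
  Q.PosDef ∧ A.transpose * Q + Q * A = 1

/-- The contraction rate `1 / (4 ‖Q‖)` attached to a Lyapunov matrix `Q`. -/
noncomputable def rate {d : ℕ} (Q : Matrix (Fin d) (Fin d) ℝ) : ℝ :=
  1 / (4 * ‖Q‖)

/-- Polynomially decaying step sizes `c (k + k₀)^(-e)`. -/
noncomputable def stepSize (c k₀ e : ℝ) (k : ℕ) : ℝ :=
  c * ((k : ℝ) + k₀) ^ (-e)

section Iterates

variable {m n : ℕ}

/-- The iterates `(θ_k, w_k)` of linear two-timescale stochastic approximation driven by the
sequence `x` (step `k → k + 1` uses the coefficients at `x (k + 1)`):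
`θ_{k+1} = θ_k + β_k (𝐛₁(x_{k+1}) - 𝐀₁₁(x_{k+1}) θ_k - 𝐀₁₂(x_{k+1}) w_k)`,
`w_{k+1} = w_k + γ_k (𝐛₂(x_{k+1}) - 𝐀₂₁(x_{k+1}) θ_k - 𝐀₂₂(x_{k+1}) w_k)`. -/
noncomputable def iter {S : Type*} (F : S → Coeffs m n) (β γ : ℕ → ℝ) (θ₀ : Vec m) (w₀ : Vec n)
    (x : ℕ → S) : ℕ → Vec m × Vec n
  | 0 => (θ₀, w₀)
  | k + 1 =>
    let θ := (iter F β γ θ₀ w₀ x k).1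
    let w := (iter F β γ θ₀ w₀ x k).2
    let G := F (x (k + 1))
    (θ + β k • (G.b1 - act G.A11 θ - act G.A12 w),
      w + γ k • (G.b2 - act G.A21 θ - act G.A22 w))

/-- `U = Δ - A₁₂ L`. -/
noncomputable def Coeffs.U (M : Coeffs m n) (L : Matrix (Fin n) (Fin m) ℝ) :
    Matrix (Fin m) (Fin m) ℝ :=
  M.schur - M.A12 * L

/-- The decoupling matrices: `L_0 = 0` and
`L_{k+1} = (L_k - γ_k A₂₂ L_k + β_k A₂₂⁻¹ A₂₁ U_k) (I - β_k U_k)⁻¹`, `U_k = Δ - A₁₂ L_k`. -/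
noncomputable def Coeffs.L (M : Coeffs m n) (β γ : ℕ → ℝ) : ℕ → Matrix (Fin n) (Fin m) ℝ
  | 0 => 0
  | k + 1 =>
    (M.L β γ k - γ k • (M.A22 * M.L β γ k) + β k • (M.A22⁻¹ * M.A21 * M.U (M.L β γ k))) *
      (1 - β k • M.U (M.L β γ k))⁻¹

/-- `D_k = L_{k+1} + A₂₂⁻¹ A₂₁`. -/
noncomputable def Coeffs.D (M : Coeffs m n) (β γ : ℕ → ℝ) (k : ℕ) : Matrix (Fin n) (Fin m) ℝ :=
  M.L β γ (k + 1) + M.A22⁻¹ * M.A21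

end Iterates

section Chain

variable {S : Type*} [MeasurableSpace S]

/-- Total variation distance `sup_B |μ(B) - ν(B)|` of two probability measures. -/
noncomputable def tvDist (μ ν : Measure S) : ℝ :=
  ⨆ B : {B : Set S // MeasurableSet B}, |μ.real B - ν.real B|

/-- `P` has `π` as its unique invariant distribution and is uniformly geometrically ergodic with
mixing time `tmix`: `sup_{x,x'} d_tv(P^k(x,·), P^k(x',·)) ≤ (1/4)^⌊k / tmix⌋` for all `k`
(`k / tmix` is integer division, that is, the floor; `P ^ k` is the `k`-step kernel). -/
structure IsUGE (P : Kernel S S) (π : Measure S) (tmix : ℕ) : Prop where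
  invariant : Kernel.Invariant P π
  unique : ∀ ν : Measure S, IsProbabilityMeasure ν → Kernel.Invariant P ν → ν = π
  mixing : ∀ (k : ℕ) (x x' : S), tvDist ((P ^ k) x) ((P ^ k) x') ≤ (1 / 4 : ℝ) ^ (k / tmix)

/-- `σ(X_1, …, X_k)`. -/
abbrev pastSigma {Ω : Type*} (X : ℕ → Ω → S) (k : ℕ) : MeasurableSpace Ω :=
  ⨆ j ∈ Finset.Icc 1 k, MeasurableSpace.comap (X j) inferInstance

/-- `X_1, X_2, …` is a Markov chain with kernel `P` under `μ`, with an arbitrary initial law: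
`μ(X_{k+1} ∈ B | σ(X_1, …, X_k)) = P(X_k, B)` a.s. for all `k ≥ 1` and measurable `B`. -/
structure IsMarkovChain {Ω : Type*} [MeasurableSpace Ω] (μ : Measure Ω) (P : Kernel S S)
    (X : ℕ → Ω → S) : Prop where
  measurable : ∀ k, Measurable (X k)
  markov : ∀ k, 1 ≤ k → ∀ B : Set S, MeasurableSet B →
    μ[(X (k + 1) ⁻¹' B).indicator (fun _ => (1 : ℝ)) | pastSigma X k]
      =ᵐ[μ] fun ω => (P (X k ω)).real B

variable {m n : ℕ}

/-- The random coefficients `F` are measurable functions of the state, are bounded by `CA`, `Cb`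
together with their deviations from the mean coefficients `M`, and have mean `M` under `π`. -/
structure IsBoundedNoise (M : Coeffs m n) (F : S → Coeffs m n) (π : Measure S)
    (CA Cb : ℝ) : Prop where
  meas_A11 : ∀ i j, Measurable fun x => (F x).A11 i j
  meas_A12 : ∀ i j, Measurable fun x => (F x).A12 i j
  meas_A21 : ∀ i j, Measurable fun x => (F x).A21 i j
  meas_A22 : ∀ i j, Measurable fun x => (F x).A22 i j
  meas_b1 : Measurable fun x => (F x).b1
  meas_b2 : Measurable fun x => (F x).b2
  bound_A11 : ∀ x, ‖(F x).A11‖ ≤ CA ∧ ‖(F x).A11 - M.A11‖ ≤ CA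
  bound_A12 : ∀ x, ‖(F x).A12‖ ≤ CA ∧ ‖(F x).A12 - M.A12‖ ≤ CA
  bound_A21 : ∀ x, ‖(F x).A21‖ ≤ CA ∧ ‖(F x).A21 - M.A21‖ ≤ CA
  bound_A22 : ∀ x, ‖(F x).A22‖ ≤ CA ∧ ‖(F x).A22 - M.A22‖ ≤ CA
  bound_b1 : ∀ x, ‖(F x).b1‖ ≤ Cb ∧ ‖(F x).b1 - M.b1‖ ≤ Cb
  bound_b2 : ∀ x, ‖(F x).b2‖ ≤ Cb ∧ ‖(F x).b2 - M.b2‖ ≤ Cb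
  mean_A11 : ∀ i j, ∫ x, (F x).A11 i j ∂π = M.A11 i j
  mean_A12 : ∀ i j, ∫ x, (F x).A12 i j ∂π = M.A12 i j
  mean_A21 : ∀ i j, ∫ x, (F x).A21 i j ∂π = M.A21 i j
  mean_A22 : ∀ i j, ∫ x, (F x).A22 i j ∂π = M.A22 i j
  mean_b1 : ∀ i, ∫ x, (F x).b1 i ∂π = M.b1 i
  mean_b2 : ∀ i, ∫ x, (F x).b2 i ∂π = M.b2 i

end Chain

/-- `E^{1/p}[‖Y‖^p]`, with values in `[0, ∞]`. -/
noncomputable def pMoment {Ω E : Type*} [MeasurableSpace Ω] [NormedAddCommGroup E]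
    (μ : Measure Ω) (p : ℝ) (Y : Ω → E) : ℝ≥0∞ :=
  (∫⁻ ω, ‖Y ω‖ₑ ^ p ∂μ) ^ (1 / p)

section Tilde

variable {m n : ℕ} {S Ω : Type*}

/-- `θ̃_k = θ_k - θ⋆`. -/
noncomputable def tildeTheta (F : S → Coeffs m n) (β γ : ℕ → ℝ) (θ₀ : Vec m) (w₀ : Vec n)
    (θs : Vec m) (X : ℕ → Ω → S) (k : ℕ) (ω : Ω) : Vec m :=
  (iter F β γ θ₀ w₀ (fun j => X j ω) k).1 - θs

/-- `w̃_{k+1} = w_{k+1} - w⋆ + D_k θ̃_{k+1}` (as a function of `k`). -/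
noncomputable def tildeWSucc (M : Coeffs m n) (F : S → Coeffs m n) (β γ : ℕ → ℝ) (θ₀ : Vec m)
    (w₀ : Vec n) (θs : Vec m) (ws : Vec n) (X : ℕ → Ω → S) (k : ℕ) (ω : Ω) : Vec n :=
  (iter F β γ θ₀ w₀ (fun j => X j ω) (k + 1)).2 - ws
    + act (M.D β γ k) (tildeTheta F β γ θ₀ w₀ θs X (k + 1) ω)

end Tilde

end TTSA

/-! The two coupled recursions are turned into two nearly autonomous ones, the Markov dependence of
the noise is removed, and a pair of scalar inequalities for squared `L^p` norms is closed.

Decoupling. The recursion for L_k is the condition under which w̃_k = w_k − w⋆ + (L_k +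
A₂₂⁻¹A₂₁)θ̃_k evolves without any drift in θ̃_k (`w_step`). On the slow side the drift −β_k A₁₂ w̃_k
remains. As a mere perturbation it would spoil the order √β_k, so it is cancelled by passing to z_k
= θ̃_k − (β_k/γ_k) A₁₂A₂₂⁻¹ w̃_k (`z_step`). What is left has order β_k(β_k/γ_k)‖w̃_k‖, and the
noise of z_k still has size β_k.

Noise. Every scalar deviation f of a coefficient is centred under π, so uniform ergodicity gives f =
f̂ − Pf̂ with bounded f̂. Along the chain, f(X_{k+1}) is the martingale increment f̂(X_{k+1}) −
Pf̂(X_k) plus the difference Pf̂(X_k) − Pf̂(X_{k+1}). The latter is absorbed by adding a small noise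
term built on Pf̂(X_k) to the iterates (`corrW`, `corrZ`, `corrected_step`). The price is a
remainder of order γ_k² on the fast side and β_kγ_k on the slow side, times the size of the state.

Moments. A conditionally centred increment D raises a squared `L^p` norm by at most 27p²‖D‖²
(`lpNorm_add_sq_le`), and I − γ_kA₂₂, I − β_kΔ contract in the norms given by the Lyapunov matrices
(`IsLyapunov.exists_contraction`). Hence the squared `L^p` norms A_k (fast) and B_k (slow) of the
corrected errors satisfy A_{k+1} ≤ (1 − a₂₂γ_k/2)A_k + K p²γ_k²(1 + A_k + B_k), B_{k+1} ≤ (1 −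
a_Δβ_k/2)B_k + Kβ_k(β_k/γ_k)²A_k + K p²β_k²(1 + A_k + B_k). When p²γ_k and β_k/γ_k are small these
keep A and B bounded, and then give transient plus p²γ_k, respectively p²β_k
(`exists_two_timescale_bound`). Square roots yield p√γ_k and p√β_k, below the claimed p³√γ_k and
p²√β_k. The smallness conditions follow from k₀ ≥ C p^{4/b} (`exists_stepCond`). -/

namespace TTSA

/-! ### Lyapunov equation through the Cayley transform and the Stein equation -/

/-- If `-A` is Hurwitz, the Cayley transform `(1 - A) (1 + A)⁻¹` has spectral radius `< 1`. -/
lemma norm_lt_one_of_mem_spectrum_cayley {d : ℕ} {A R : Matrix (Fin d) (Fin d) ℂ}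
    (hA : ∀ z ∈ spectrum ℂ (-A), z.re < 0) (hR : R * (1 + A) = 1) {μ : ℂ}
    (hμ : μ ∈ spectrum ℂ ((1 - A) * R)) : ‖μ‖ < 1 := by
  have hR' : (1 + A) * R = 1 := mul_eq_one_comm.mp hR
  have hu : IsUnit (1 + A) := ⟨⟨1 + A, R, hR', hR⟩, rfl⟩
  rw [spectrum.mem_iff] at hμ
  have key : (algebraMap ℂ (Matrix (Fin d) (Fin d) ℂ) μ - (1 - A) * R) * (1 + A)
      = algebraMap ℂ _ (μ - 1) + (μ + 1) • A := by
    rw [sub_mul, mul_assoc, hR, Algebra.algebraMap_eq_smul_one, Algebra.algebraMap_eq_smul_one,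
      smul_mul_assoc, one_mul, smul_add, mul_one, sub_smul, add_smul, one_smul, one_smul]
    abel
  have hnu : ¬ IsUnit (algebraMap ℂ (Matrix (Fin d) (Fin d) ℂ) (μ - 1) + (μ + 1) • A) := by
    rw [← key]
    intro h
    apply hμ
    have := h.mul hu.unit⁻¹.isUnit
    rwa [mul_assoc, IsUnit.mul_val_inv, mul_one] at this
  -- At μ = −1 the pencil in `key` reduces to the unit −2, so −1 is not an eigenvalue of the Cayley
  -- transform.
  have hne : μ + 1 ≠ 0 := by
    intro h0
    apply hnu
    rw [h0, zero_smul, add_zero]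
    have : μ - 1 = -2 := by linear_combination h0
    rw [this]
    exact (IsUnit.mk0 (-2 : ℂ) (by norm_num)).map (algebraMap ℂ (Matrix (Fin d) (Fin d) ℂ))
  -- The inverse Möbius map sends μ to an eigenvalue of −A, and its real part is (|μ|² − 1)/|μ +
  -- 1|².
  have hz : (μ - 1) / (μ + 1) ∈ spectrum ℂ (-A) := by
    rw [spectrum.mem_iff]
    intro h
    apply hnu
    have := ((IsUnit.mk0 _ hne).map (algebraMap ℂ (Matrix (Fin d) (Fin d) ℂ))).mul h
    rw [mul_sub, ← map_mul, mul_div_cancel₀ _ hne, mul_neg, sub_neg_eq_add,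
      ← Algebra.smul_def] at this
    exact this
  have hre := hA _ hz
  have h2 : 0 < Complex.normSq (μ + 1) := Complex.normSq_pos.mpr hne
  rw [Complex.div_re, ← add_div, div_lt_iff₀ h2, zero_mul] at hre
  simp only [Complex.sub_re, Complex.add_re, Complex.one_re, Complex.sub_im, Complex.add_im,
    Complex.one_im] at hre
  have h3 : ‖μ‖ ^ 2 < 1 := by
    rw [← Complex.normSq_eq_norm_sq, Complex.normSq_apply]
    nlinarith
  exact (sq_lt_one_iff₀ (norm_nonneg _)).mp h3

/-- A real matrix whose complex eigenvalues lie in the open unit disc has geometrically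
decaying powers. -/
lemma exists_norm_pow_le {d : ℕ} [NeZero d] (B : Matrix (Fin d) (Fin d) ℝ)
    (hB : ∀ z ∈ spectrum ℂ (B.map (algebraMap ℝ ℂ)), ‖z‖ < 1) :
    ∃ K r : ℝ, 0 ≤ r ∧ r < 1 ∧ ∀ᶠ k : ℕ in Filter.atTop, ‖B ^ k‖ ≤ K * r ^ k := by
  set Bc := B.map (algebraMap ℝ ℂ) with hBc
  have hρ : spectralRadius ℂ Bc < ((1 : NNReal) : ℝ≥0∞) :=
    spectrum.spectralRadius_lt_of_forall_lt Bc (fun z hz => by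
      rw [← NNReal.coe_lt_coe]; simpa using hB z hz)
  obtain ⟨r, hr1, hr2⟩ := exists_between hρ
  have hrtop : r ≠ ⊤ := (hr2.trans ENNReal.coe_lt_top).ne
  have htend := spectrum.pow_nnnorm_pow_one_div_tendsto_nhds_spectralRadius Bc
  -- Gelfand's formula bounds the powers of the complexification. The entrywise real part,
  -- continuous in finite dimension, carries the bound back to the powers of B, with its operator
  -- norm as K.
  let T : Matrix (Fin d) (Fin d) ℂ →ₗ[ℝ] Matrix (Fin d) (Fin d) ℝ := Complex.reLm.mapMatrix
  let T' := LinearMap.toContinuousLinearMap T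
  have hT : ∀ k : ℕ, T' (Bc ^ k) = B ^ k := by
    intro k
    have h1 : Bc ^ k = (B ^ k).map (algebraMap ℝ ℂ) := by
      have := map_pow ((algebraMap ℝ ℂ).mapMatrix (m := Fin d)) B k
      simpa [hBc, RingHom.mapMatrix_apply] using this.symm
    ext i j
    rw [h1]
    simp [T', T]
  refine ⟨‖T'‖, r.toReal, ENNReal.toReal_nonneg, ?_, ?_⟩
  · have := (ENNReal.toReal_lt_toReal hrtop ENNReal.coe_ne_top).mpr hr2
    simpa using this
  · filter_upwards [htend.eventually_lt_const hr1, Filter.eventually_ge_atTop 1] with k hk hk1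
    have hk0 : (k : ℝ) ≠ 0 := by positivity
    have h1 : ((‖Bc ^ k‖₊ : ℝ≥0∞)) ≤ r ^ k := by
      have := ENNReal.rpow_le_rpow hk.le (Nat.cast_nonneg (α := ℝ) k)
      rwa [← ENNReal.rpow_mul, one_div, inv_mul_cancel₀ hk0, ENNReal.rpow_one,
        ENNReal.rpow_natCast] at this
    have h2 : ‖Bc ^ k‖ ≤ r.toReal ^ k := by
      have := ENNReal.toReal_mono (ENNReal.pow_ne_top hrtop) h1
      simpa using this
    rw [← hT k]
    exact (T'.le_opNorm _).trans (mul_le_mul_of_nonneg_left h2 (norm_nonneg _))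

/-- Solution of the Stein equation `Q = C + Bᵀ Q B`. -/
lemma exists_stein_solution {d : ℕ} [NeZero d] (B C : Matrix (Fin d) (Fin d) ℝ)
    (hB : ∀ z ∈ spectrum ℂ (B.map (algebraMap ℝ ℂ)), ‖z‖ < 1) (hC : C.PosDef) :
    ∃ Q : Matrix (Fin d) (Fin d) ℝ, Q.PosDef ∧ Q = C + B.transpose * Q * B := by
  obtain ⟨K, r, hr0, hr1, hK⟩ := exists_norm_pow_le B hB
  let f : ℕ → Matrix (Fin d) (Fin d) ℝ := fun k => (B.transpose) ^ k * C * B ^ k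
  have htr : ∀ M : Matrix (Fin d) (Fin d) ℝ, ‖M.transpose‖ = ‖M‖ := fun M => by
    rw [← Matrix.conjTranspose_eq_transpose_of_trivial, Matrix.l2_opNorm_conjTranspose]
  have hsum : Summable f := by
    have hg : Summable fun k : ℕ => K ^ 2 * ‖C‖ * (r ^ 2) ^ k :=
      (summable_geometric_of_lt_one (sq_nonneg r) (by nlinarith)).mul_left _
    refine Summable.of_norm_bounded_eventually_nat hg ?_
    filter_upwards [hK] with k hk
    have h1 : ‖f k‖ ≤ ‖B ^ k‖ * ‖C‖ * ‖B ^ k‖ := by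
      refine (norm_mul_le _ _).trans (mul_le_mul_of_nonneg_right ?_ (norm_nonneg _))
      refine (norm_mul_le _ _).trans (mul_le_mul_of_nonneg_right ?_ (norm_nonneg _))
      rw [← Matrix.transpose_pow, htr]
    calc ‖f k‖ ≤ ‖B ^ k‖ * ‖C‖ * ‖B ^ k‖ := h1
      _ = ‖B ^ k‖ ^ 2 * ‖C‖ := by ring
      _ ≤ (K * r ^ k) ^ 2 * ‖C‖ := by gcongr
      _ = _ := by ring
  have hsucc : ∀ k, f (k + 1) = B.transpose * f k * B := fun k => by
    simp only [f, pow_succ', ← mul_assoc]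
    rw [mul_assoc _ (B ^ k) B, ← pow_succ, pow_succ']
    simp only [mul_assoc]
  have hQ : (∑' k, f k) = C + B.transpose * (∑' k, f k) * B := by
    conv_lhs => rw [hsum.tsum_eq_zero_add]
    congr 1
    · simp [f]
    · simp_rw [hsucc]
      rw [Summable.tsum_mul_right _ (hsum.mul_left _), hsum.tsum_mul_left]
  have hherm : (∑' k, f k).IsHermitian := by
    rw [Matrix.IsHermitian, Matrix.conjTranspose_tsum]
    refine tsum_congr fun k => ?_
    have hCh : C.transpose = C := by
      have := hC.isHermitian
      rwa [Matrix.IsHermitian, Matrix.conjTranspose_eq_transpose_of_trivial] at this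
    simp only [f, Matrix.conjTranspose_eq_transpose_of_trivial, Matrix.transpose_mul,
      Matrix.transpose_pow, Matrix.transpose_transpose, hCh, mul_assoc]
  have hpsd : (∑' k, f k).PosSemidef := by
    refine .of_dotProduct_mulVec_nonneg hherm fun x => ?_
    let q : Matrix (Fin d) (Fin d) ℝ →ₗ[ℝ] ℝ :=
      { toFun := fun M => star x ⬝ᵥ M.mulVec x
        map_add' := fun M N => by rw [Matrix.add_mulVec, dotProduct_add]
        map_smul' := fun c M => by
          rw [Matrix.smul_mulVec, dotProduct_smul]; rfl }
    have h := (LinearMap.toContinuousLinearMap q).map_tsum hsum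
    change star x ⬝ᵥ (∑' k, f k).mulVec x = ∑' k, star x ⬝ᵥ (f k).mulVec x at h
    rw [h]
    refine tsum_nonneg fun k => ?_
    have := (hC.posSemidef.conjTranspose_mul_mul_same (B ^ k)).dotProduct_mulVec_nonneg x
    simpa [f, Matrix.conjTranspose_eq_transpose_of_trivial, Matrix.transpose_pow] using this
  refine ⟨∑' k, f k, ?_, hQ⟩
  rw [hQ]
  refine hC.add_posSemidef ?_
  have := hpsd.conjTranspose_mul_mul_same B
  rwa [Matrix.conjTranspose_eq_transpose_of_trivial] at this

/-- A real t ≥ 0 cannot be an eigenvalue of −A. The case t = 1 makes the Cayley transform well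
defined, and t = 0 gives the invertibility of A₂₂. -/
lemma isUnit_one_add_of_isHurwitz {d : ℕ} {A : Matrix (Fin d) (Fin d) ℝ} (hA : IsHurwitz (-A))
    (t : ℝ) (ht : 0 ≤ t) : IsUnit (algebraMap ℝ (Matrix (Fin d) (Fin d) ℝ) t + A) := by
  have hc : IsUnit (algebraMap ℂ (Matrix (Fin d) (Fin d) ℂ) t + A.map (algebraMap ℝ ℂ)) := by
    by_contra hcon
    have : (t : ℂ) ∈ spectrum ℂ ((-A).map (algebraMap ℝ ℂ)) := by
      rw [spectrum.mem_iff, Matrix.map_neg _ (fun a => by simp), sub_neg_eq_add]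
      exact hcon
    have := hA _ this
    simp at this
    linarith
  rw [Matrix.isUnit_iff_isUnit_det, isUnit_iff_ne_zero] at hc ⊢
  intro h0
  apply hc
  have := RingHom.map_det (algebraMap ℝ ℂ) (algebraMap ℝ (Matrix (Fin d) (Fin d) ℝ) t + A)
  rw [h0, map_zero] at this
  rw [this]
  congr 1
  ext i j
  simp only [RingHom.mapMatrix_apply, Matrix.map_apply, Matrix.add_apply, map_add,
    Matrix.algebraMap_matrix_apply]
  split_ifs <;> simp

/-- Lyapunov's theorem: if `-A` is Hurwitz, then `Aᵀ Q + Q A = 1` has a positive definite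
solution. -/
theorem exists_isLyapunov {d : ℕ} [NeZero d] {A : Matrix (Fin d) (Fin d) ℝ}
    (hA : IsHurwitz (-A)) : ∃ Q, IsLyapunov A Q := by
  have hu : IsUnit (1 + A) := by simpa using isUnit_one_add_of_isHurwitz hA 1 zero_le_one
  obtain ⟨u, hu⟩ := hu
  set R : Matrix (Fin d) (Fin d) ℝ := ↑u⁻¹ with hRdef
  have hR : R * (1 + A) = 1 := by rw [← hu]; exact u.inv_mul
  have hR' : (1 + A) * R = 1 := mul_eq_one_comm.mp hR
  have hspec : ∀ z ∈ spectrum ℂ (((1 - A) * R).map (algebraMap ℝ ℂ)), ‖z‖ < 1 := by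
    intro z hz
    have hmap : ∀ M N : Matrix (Fin d) (Fin d) ℝ, (M * N).map (algebraMap ℝ ℂ)
        = M.map (algebraMap ℝ ℂ) * N.map (algebraMap ℝ ℂ) := fun M N => Matrix.map_mul
    have hone : (1 : Matrix (Fin d) (Fin d) ℝ).map (algebraMap ℝ ℂ) = 1 :=
      Matrix.map_one _ (map_zero _) (map_one _)
    rw [hmap, Matrix.map_sub _ (map_sub _), hone] at hz
    refine norm_lt_one_of_mem_spectrum_cayley ?_ ?_ hz
    · rw [← Matrix.map_neg _ (map_neg _)]
      exact hA
    · have := congrArg (fun M => M.map (algebraMap ℝ ℂ)) hR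
      simp only [hmap, Matrix.map_add _ (map_add _), hone] at this
      exact this
  have hinj : Function.Injective R.mulVec := by
    intro x y hxy
    have := congrArg ((1 + A).mulVec) hxy
    simpa [Matrix.mulVec_mulVec, hR'] using this
  -- With C = 2RᵀR, conjugating Q = C + BᵀQB by 1 + A gives (1+A)ᵀQ(1+A) = 2 + (1−A)ᵀQ(1−A), which
  -- expands to twice the Lyapunov equation.
  have hC : ((2 : ℝ) • (R.transpose * R)).PosDef := by
    have := Matrix.PosDef.conjTranspose_mul_self R hinj
    rw [Matrix.conjTranspose_eq_transpose_of_trivial] at this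
    exact this.smul (by norm_num)
  obtain ⟨Q, hQ, hQe⟩ := exists_stein_solution _ _ hspec hC
  refine ⟨Q, hQ, ?_⟩
  have hRt : (1 + A).transpose * R.transpose = 1 := by
    rw [← Matrix.transpose_mul, hR, Matrix.transpose_one]
  have h1 : (1 + A).transpose * Q * (1 + A)
      = (2 : ℝ) • 1 + (1 - A).transpose * Q * (1 - A) := by
    conv_lhs => rw [hQe]
    rw [mul_add (1 + A).transpose, add_mul _ _ (1 + A)]
    congr 1
    · rw [mul_smul_comm, smul_mul_assoc, ← mul_assoc, hRt, one_mul, hR]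
    · rw [Matrix.transpose_mul]
      calc (1 + A).transpose * (R.transpose * (1 - A).transpose * Q * ((1 - A) * R)) * (1 + A)
          = ((1 + A).transpose * R.transpose) * (1 - A).transpose * Q * (1 - A)
              * (R * (1 + A)) := by simp only [mul_assoc]
        _ = _ := by rw [hRt, hR]; simp only [one_mul, mul_one]
  simp only [Matrix.transpose_add, Matrix.transpose_sub, Matrix.transpose_one, add_mul, mul_add,
    sub_mul, mul_sub, one_mul, mul_one] at h1
  have h2 : (2 : ℝ) • (A.transpose * Q + Q * A) = (2 : ℝ) • (1 : Matrix (Fin d) (Fin d) ℝ) := by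
    rw [two_smul]
    rw [← sub_eq_zero] at h1 ⊢
    rw [← h1]
    abel
  exact smul_right_injective _ (two_ne_zero (α := ℝ)) h2

/-! ### Poisson equation for a uniformly ergodic kernel -/

section Ergodic

variable {S : Type*} [MeasurableSpace S]

lemma integrable_of_abs_le {ν : Measure S} [IsFiniteMeasure ν] {f : S → ℝ} (hf : Measurable f)
    {c : ℝ} (hc : ∀ x, |f x| ≤ c) : Integrable f ν :=
  Integrable.of_bound hf.aestronglyMeasurable c (Filter.Eventually.of_forall hc)

lemma abs_measureReal_sub_le_tvDist (μ ν : Measure S) [IsProbabilityMeasure μ]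
    [IsProbabilityMeasure ν] {B : Set S} (hB : MeasurableSet B) :
    |μ.real B - ν.real B| ≤ tvDist μ ν := by
  refine le_ciSup (f := fun B : {B : Set S // MeasurableSet B} => |μ.real B - ν.real B|)
    ⟨1, ?_⟩ ⟨B, hB⟩
  rintro _ ⟨C, rfl⟩
  have h1 := measureReal_le_one (μ := μ) (s := C.1)
  have h2 := measureReal_le_one (μ := ν) (s := C.1)
  have h3 := measureReal_nonneg (μ := μ) (s := C.1)
  have h4 := measureReal_nonneg (μ := ν) (s := C.1)
  exact abs_le.mpr ⟨by linarith, by linarith⟩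

/-- Layer cake: a [0,1]-valued f integrates to the average over t in (0,1] of the mass of {f ≥ t},
and on each level set the two measures differ by at most the supremum over sets. -/
lemma abs_integral_sub_le_tvDist_of_unit (μ ν : Measure S) [IsProbabilityMeasure μ]
    [IsProbabilityMeasure ν] {f : S → ℝ} (hf : Measurable f) (h0 : ∀ x, 0 ≤ f x)
    (h1 : ∀ x, f x ≤ 1) : |∫ x, f x ∂μ - ∫ x, f x ∂ν| ≤ tvDist μ ν := by
  have hb : ∀ x, |f x| ≤ 1 := fun x => by rw [abs_of_nonneg (h0 x)]; exact h1 x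
  have key : ∀ ρ : Measure S, IsProbabilityMeasure ρ →
      ∫ x, f x ∂ρ = ∫ t in Set.Ioc (0 : ℝ) 1, ρ.real {a | t ≤ f a} ∧
      IntegrableOn (fun t : ℝ => ρ.real {a | t ≤ f a}) (Set.Ioc 0 1) := by
    intro ρ _
    refine ⟨(integrable_of_abs_le hf hb).integral_eq_integral_Ioc_meas_le
      (Filter.Eventually.of_forall h0) (Filter.Eventually.of_forall h1), ?_⟩
    have hanti : Antitone fun t : ℝ => ρ.real {a | t ≤ f a} := fun s t hst =>
      measureReal_mono fun a (ha : t ≤ f a) => hst.trans ha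
    refine Integrable.of_bound hanti.measurable.aestronglyMeasurable 1
      (Filter.Eventually.of_forall fun t => ?_)
    rw [Real.norm_of_nonneg measureReal_nonneg]
    exact measureReal_le_one
  rw [(key μ inferInstance).1, (key ν inferInstance).1,
    ← integral_sub (key μ inferInstance).2 (key ν inferInstance).2]
  have := norm_setIntegral_le_of_norm_le_const (μ := volume) (s := Set.Ioc (0 : ℝ) 1)
    (f := fun t => μ.real {a | t ≤ f a} - ν.real {a | t ≤ f a}) (C := tvDist μ ν) (by simp)
    (fun t _ => abs_measureReal_sub_le_tvDist μ ν (measurableSet_le measurable_const hf))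
  simpa using this

lemma abs_integral_sub_le_tvDist (μ ν : Measure S) [IsProbabilityMeasure μ]
    [IsProbabilityMeasure ν] {f : S → ℝ} (hf : Measurable f) {c : ℝ} (hc0 : 0 < c)
    (hc : ∀ x, |f x| ≤ c) :
    |∫ x, f x ∂μ - ∫ x, f x ∂ν| ≤ 2 * c * tvDist μ ν := by
  have h := abs_integral_sub_le_tvDist_of_unit μ ν (f := fun x => (f x + c) / (2 * c))
    ((hf.add_const c).div_const _)
    (fun x => div_nonneg (by linarith [(abs_le.mp (hc x)).1]) (by linarith))
    (fun x => by rw [div_le_one (by linarith)]; linarith [(abs_le.mp (hc x)).2])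
  simp only [integral_div] at h
  rw [integral_add (integrable_of_abs_le hf hc) (integrable_const c),
    integral_add (integrable_of_abs_le hf hc) (integrable_const c)] at h
  simp only [integral_const, probReal_univ, one_smul] at h
  rw [← sub_div, add_sub_add_right_eq_sub, abs_div, abs_of_pos (by linarith : 0 < 2 * c),
    div_le_iff₀ (by linarith)] at h
  linarith

lemma integral_comp_measure {ν : Measure S} (P : Kernel S S) [IsMarkovKernel P]
    [IsFiniteMeasure ν] {f : S → ℝ} (hf : Measurable f) {c : ℝ} (hc : ∀ x, |f x| ≤ c) :
    ∫ x, f x ∂(P ∘ₘ ν) = ∫ x, ∫ y, f y ∂(P x) ∂ν := by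
  have h := Kernel.integral_comp (κ := Kernel.const Unit ν) (η := P) (a := ()) (f := f)
    (integrable_of_abs_le hf hc)
  rwa [Kernel.comp_apply, Kernel.const_apply] at h

lemma isMarkovKernel_pow (P : Kernel S S) [IsMarkovKernel P] (k : ℕ) : IsMarkovKernel (P ^ k) := by
  induction k with
  | zero => exact (inferInstance : IsMarkovKernel (Kernel.id : Kernel S S))
  | succ k ih => rw [pow_succ]; exact (inferInstance : IsMarkovKernel ((P ^ k) ∘ₖ P))

lemma invariant_pow {P : Kernel S S} {π : Measure S} (h : Kernel.Invariant P π) (k : ℕ) :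
    Kernel.Invariant (P ^ k) π := by
  induction k with
  | zero => exact (Measure.id_comp : (Kernel.id : Kernel S S) ∘ₘ π = π)
  | succ k ih => rw [pow_succ]; exact Kernel.Invariant.comp ih h

/-- The constant `2 ∑ₖ (1/4)^⌊k / t⌋` in the bound of the solution of the Poisson equation. -/
noncomputable def mixConst (t : ℕ) : ℝ := 2 * ∑' k : ℕ, (1 / 4 : ℝ) ^ (k / t)

lemma summable_mix {t : ℕ} (ht : 1 ≤ t) : Summable fun k : ℕ => (1 / 4 : ℝ) ^ (k / t) := by
  have ht0 : (t : ℝ) ≠ 0 := by positivity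
  set r : ℝ := (1 / 4 : ℝ) ^ ((1 : ℝ) / t) with hr
  have hr0 : 0 < r := by positivity
  have hr1 : r < 1 := Real.rpow_lt_one (by norm_num) (by norm_num) (by positivity)
  have hrt : r ^ t = 1 / 4 := by
    rw [hr, ← Real.rpow_natCast, ← Real.rpow_mul (by norm_num), one_div_mul_cancel ht0,
      Real.rpow_one]
  refine Summable.of_nonneg_of_le (fun k => by positivity) (fun k => ?_)
    ((summable_geometric_of_lt_one hr0.le hr1).mul_left 4)
  -- Rounding k/t down loses at most one block of length t, that is a factor r^t = 1/4; this is the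
  -- 4 in front of the geometric majorant.
  have h1 : k ≤ t * (k / t) + t := by
    have := Nat.div_add_mod k t
    have := Nat.mod_lt k (by omega : t > 0)
    omega
  have h2 := pow_le_pow_of_le_one hr0.le hr1.le h1
  rw [pow_add, pow_mul, hrt] at h2
  linarith

/-- The solution `∑ₖ Pᵏ f` of the Poisson equation. -/
noncomputable def poisson (P : Kernel S S) (f : S → ℝ) (x : S) : ℝ :=
  ∑' k : ℕ, ∫ y, f y ∂((P ^ k) x)

section Poisson

variable {P : Kernel S S} [IsMarkovKernel P] {π : Measure S} [IsProbabilityMeasure π] {t : ℕ}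
  {f : S → ℝ} {c : ℝ}

/-- Since π is invariant and π(f) = 0, Pᵏf(x) is the π-average over x' of Pᵏf(x) − Pᵏf(x'), which
the mixing bound controls uniformly. -/
lemma abs_integral_pow_le (hP : IsUGE P π t) (hf : Measurable f) (hc0 : 0 < c)
    (hc : ∀ x, |f x| ≤ c) (hπ : ∫ x, f x ∂π = 0) (k : ℕ) (x : S) :
    |∫ y, f y ∂((P ^ k) x)| ≤ 2 * c * (1 / 4 : ℝ) ^ (k / t) := by
  have := isMarkovKernel_pow P k
  have hmeas : Measurable fun x => ∫ y, f y ∂((P ^ k) x) :=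
    (hf.stronglyMeasurable.integral_kernel).measurable
  have hbd : ∀ x, |∫ y, f y ∂((P ^ k) x)| ≤ c := fun x => by
    have := norm_integral_le_of_norm_le_const (μ := (P ^ k) x) (f := f) (C := c)
      (Filter.Eventually.of_forall hc)
    simpa using this
  have h0 : ∫ x', ∫ y, f y ∂((P ^ k) x') ∂π = 0 := by
    rw [← integral_comp_measure (P ^ k) hf hc, invariant_pow hP.invariant k, hπ]
  have h1 : ∫ y, f y ∂((P ^ k) x)
      = ∫ x', (∫ y, f y ∂((P ^ k) x) - ∫ y, f y ∂((P ^ k) x')) ∂π := by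
    rw [integral_sub (integrable_const _) (integrable_of_abs_le hmeas hbd), h0]
    simp
  rw [h1]
  have := norm_integral_le_of_norm_le_const (μ := π) (C := 2 * c * (1 / 4 : ℝ) ^ (k / t))
    (f := fun x' => ∫ y, f y ∂((P ^ k) x) - ∫ y, f y ∂((P ^ k) x'))
    (Filter.Eventually.of_forall fun x' =>
      (abs_integral_sub_le_tvDist _ _ hf hc0 hc).trans
        (mul_le_mul_of_nonneg_left (hP.mixing k x x') (by linarith)))
  simpa using this

lemma summable_integral_pow (ht : 1 ≤ t) (hP : IsUGE P π t) (hf : Measurable f) (hc0 : 0 < c)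
    (hc : ∀ x, |f x| ≤ c) (hπ : ∫ x, f x ∂π = 0) (x : S) :
    Summable fun k : ℕ => ∫ y, f y ∂((P ^ k) x) :=
  Summable.of_norm_bounded ((summable_mix ht).mul_left (2 * c))
    (fun k => abs_integral_pow_le hP hf hc0 hc hπ k x)

lemma abs_poisson_le (ht : 1 ≤ t) (hP : IsUGE P π t) (hf : Measurable f) (hc0 : 0 < c)
    (hc : ∀ x, |f x| ≤ c) (hπ : ∫ x, f x ∂π = 0) (x : S) :
    |poisson P f x| ≤ mixConst t * c := by
  have := tsum_of_norm_bounded (f := fun k : ℕ => ∫ y, f y ∂((P ^ k) x))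
    ((summable_mix ht).mul_left (2 * c)).hasSum
    (fun k => abs_integral_pow_le hP hf hc0 hc hπ k x)
  rw [tsum_mul_left] at this
  rw [mixConst]
  calc |poisson P f x| ≤ _ := this
    _ = _ := by ring

lemma measurable_poisson (ht : 1 ≤ t) (hP : IsUGE P π t) (hf : Measurable f) (hc0 : 0 < c)
    (hc : ∀ x, |f x| ≤ c) (hπ : ∫ x, f x ∂π = 0) : Measurable (poisson P f) := by
  have hm : ∀ k : ℕ, Measurable fun x => ∫ y, f y ∂((P ^ k) x) := fun k =>
    (hf.stronglyMeasurable.integral_kernel).measurable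
  refine measurable_of_tendsto_metrizable
    (f := fun n x => ∑ k ∈ Finset.range n, ∫ y, f y ∂((P ^ k) x))
    (fun n => Finset.measurable_sum _ fun k _ => hm k) ?_
  rw [tendsto_pi_nhds]
  exact fun x => (summable_integral_pow ht hP hf hc0 hc hπ x).hasSum.tendsto_sum_nat

/-- The Poisson equation `f = f̂ - P f̂`. -/
lemma poisson_sub_integral_poisson (ht : 1 ≤ t) (hP : IsUGE P π t) (hf : Measurable f)
    (hc0 : 0 < c) (hc : ∀ x, |f x| ≤ c) (hπ : ∫ x, f x ∂π = 0) (x : S) :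
    f x = poisson P f x - ∫ y, poisson P f y ∂(P x) := by
  have hm : ∀ k : ℕ, Measurable fun x => ∫ y, f y ∂((P ^ k) x) := fun k =>
    (hf.stronglyMeasurable.integral_kernel).measurable
  have hsucc : ∀ k : ℕ, ∫ y, f y ∂((P ^ (k + 1)) x) = ∫ z, ∫ y, f y ∂((P ^ k) z) ∂(P x) := by
    intro k
    have := isMarkovKernel_pow P k
    have e : (P ^ (k + 1)) x = ((P ^ k) ∘ₖ P) x := by rw [pow_succ]; rfl
    rw [e, Kernel.integral_comp]
    exact integrable_of_abs_le hf hc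
  -- Dominated convergence moves P inside the series, so Pf̂ is the series without its first term,
  -- and f̂ − Pf̂ is that term, P⁰f = f.
  have hsum := hasSum_integral_of_dominated_convergence (μ := P x)
    (F := fun (k : ℕ) z => ∫ y, f y ∂((P ^ k) z)) (f := poisson P f)
    (fun k _ => 2 * c * (1 / 4 : ℝ) ^ (k / t)) (fun k => (hm k).aestronglyMeasurable)
    (fun k => Filter.Eventually.of_forall fun z => abs_integral_pow_le hP hf hc0 hc hπ k z)
    (Filter.Eventually.of_forall fun z => (summable_mix ht).mul_left (2 * c))
    (integrable_const _)
    (Filter.Eventually.of_forall fun z => (summable_integral_pow ht hP hf hc0 hc hπ z).hasSum)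
  simp_rw [← hsucc] at hsum
  have h0 := (summable_integral_pow ht hP hf hc0 hc hπ x).tsum_eq_zero_add
  rw [hsum.tsum_eq] at h0
  have h1 : ∫ y, f y ∂((P ^ 0) x) = f x := by
    rw [pow_zero]
    change ∫ y, f y ∂((Kernel.id : Kernel S S) x) = f x
    rw [Kernel.id_apply, integral_dirac' _ _ hf.stronglyMeasurable]
  rw [h1] at h0
  rw [poisson, h0]
  ring

lemma abs_integral_kernel_le (hc : ∀ x, |f x| ≤ c) (x : S) : |∫ y, f y ∂(P x)| ≤ c := by
  have := norm_integral_le_of_norm_le_const (μ := P x) (f := f) (C := c)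
    (Filter.Eventually.of_forall hc)
  simpa using this

end Poisson

/-! ### Markov property and orthogonality of martingale increments -/

section Markov

lemma measurable_pastSigma {Ω : Type*} {X : ℕ → Ω → S} {j k : ℕ} (h1 : 1 ≤ j) (h2 : j ≤ k) :
    Measurable[pastSigma X k] (X j) := by
  refine Measurable.mono (comap_measurable (X j)) ?_ le_rfl
  exact le_iSup₂_of_le j (Finset.mem_Icc.mpr ⟨h1, h2⟩) le_rfl

lemma pastSigma_mono {Ω : Type*} {X : ℕ → Ω → S} {j k : ℕ} (h : j ≤ k) :
    pastSigma X j ≤ pastSigma X k :=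
  iSup₂_le fun i hi => le_iSup₂_of_le i
    (Finset.mem_Icc.mpr ⟨(Finset.mem_Icc.mp hi).1, (Finset.mem_Icc.mp hi).2.trans h⟩) le_rfl

variable {Ω : Type*} [mΩ : MeasurableSpace Ω] {μ : Measure Ω} [IsProbabilityMeasure μ]
  {P : Kernel S S} [IsMarkovKernel P] {X : ℕ → Ω → S}

lemma pastSigma_le (hX : ∀ k, Measurable (X k)) (k : ℕ) : pastSigma X k ≤ mΩ :=
  iSup₂_le fun j _ => (hX j).comap_le

/-- The Markov property on sets, integrated over a past event, becomes an identity between measures.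
The version for bounded functions then follows by integrating against both sides, with no
approximation by simple functions. -/
lemma IsMarkovChain.map_restrict (hX : IsMarkovChain μ P X) {k : ℕ} (hk : 1 ≤ k) {s : Set Ω}
    (hs : MeasurableSet[pastSigma X k] s) :
    (μ.restrict s).map (X (k + 1)) = P ∘ₘ ((μ.restrict s).map (X k)) := by
  have hle := pastSigma_le hX.measurable k
  ext B hB
  rw [Measure.map_apply (hX.measurable _) hB, Measure.bind_apply hB P.aemeasurable,
    lintegral_map (P.measurable_coe hB) (hX.measurable k)]
  have hint : Integrable ((X (k + 1) ⁻¹' B).indicator fun _ => (1 : ℝ)) μ :=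
    (integrable_const 1).indicator (hX.measurable _ hB)
  have h1 := setIntegral_condExp hle hint hs
  rw [setIntegral_congr_ae (hle _ hs) ((hX.markov k hk B hB).mono fun ω h _ => h)] at h1
  rw [integral_indicator (hX.measurable _ hB)] at h1
  simp only [integral_const, measureReal_restrict_apply MeasurableSet.univ, Set.univ_inter,
    smul_eq_mul, mul_one] at h1
  rw [measureReal_def] at h1
  have h2 : ∫ ω in s, (P (X k ω)).real B ∂μ = (∫⁻ ω in s, P (X k ω) B ∂μ).toReal := by
    refine integral_toReal (((P.measurable_coe hB).comp (hX.measurable k)).aemeasurable) ?_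
    exact Filter.Eventually.of_forall fun ω => measure_lt_top _ _
  rw [h2] at h1
  refine ((ENNReal.toReal_eq_toReal_iff' ?_ ?_).mp h1).symm
  · refine (IsFiniteMeasure.lintegral_lt_top_of_bounded_to_ennreal _ ⟨1, fun ω => ?_⟩).ne
    exact_mod_cast prob_le_one
  · exact measure_ne_top _ _

lemma IsMarkovChain.condExp (hX : IsMarkovChain μ P X) {k : ℕ} (hk : 1 ≤ k) {f : S → ℝ}
    (hf : Measurable f) {c : ℝ} (hc : ∀ x, |f x| ≤ c) :
    (fun ω => ∫ y, f y ∂(P (X k ω))) =ᵐ[μ] μ[fun ω => f (X (k + 1) ω) | pastSigma X k] := by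
  have hle := pastSigma_le hX.measurable k
  have hPf : Measurable fun x => ∫ y, f y ∂(P x) :=
    (hf.stronglyMeasurable.integral_kernel).measurable
  refine ae_eq_condExp_of_forall_setIntegral_eq hle
    (integrable_of_abs_le (hf.comp (hX.measurable _)) fun ω => hc _)
    (fun s _ _ => (integrable_of_abs_le (hPf.comp (hX.measurable k))
      fun ω => abs_integral_kernel_le hc _).integrableOn) (fun s hs _ => ?_)
    ((hPf.comp (measurable_pastSigma hk le_rfl)).stronglyMeasurable.aestronglyMeasurable)
  have h1 : ∫ ω in s, f (X (k + 1) ω) ∂μ = ∫ x, f x ∂((μ.restrict s).map (X (k + 1))) :=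
    (integral_map (hX.measurable _).aemeasurable hf.aestronglyMeasurable).symm
  have h2 : ∫ ω in s, ∫ y, f y ∂(P (X k ω)) ∂μ
      = ∫ x, ∫ y, f y ∂(P x) ∂((μ.restrict s).map (X k)) :=
    (integral_map (hX.measurable _).aemeasurable hPf.aestronglyMeasurable).symm
  rw [h1, h2, hX.map_restrict hk hs, integral_comp_measure P hf hc]

/-- Martingale increments `f(X_{k+1}) - P f(X_k)` are orthogonal to bounded functions of the
past. -/
lemma IsMarkovChain.integral_mul_sub_eq_zero (hX : IsMarkovChain μ P X) {k : ℕ} (hk : 1 ≤ k)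
    {f : S → ℝ} (hf : Measurable f) {c : ℝ} (hc : ∀ x, |f x| ≤ c) {ψ : Ω → ℝ}
    (hψ : Measurable[pastSigma X k] ψ) {c' : ℝ} (hc' : ∀ ω, |ψ ω| ≤ c') :
    ∫ ω, ψ ω * (f (X (k + 1) ω) - ∫ y, f y ∂(P (X k ω))) ∂μ = 0 := by
  have hle := pastSigma_le hX.measurable k
  have hPf : Measurable fun x => ∫ y, f y ∂(P x) :=
    (hf.stronglyMeasurable.integral_kernel).measurable
  have hi1 : Integrable (fun ω => ψ ω * f (X (k + 1) ω)) μ :=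
    integrable_of_abs_le ((hψ.mono hle le_rfl).mul (hf.comp (hX.measurable _)))
      (c := c' * c) fun ω => by
      rw [abs_mul]
      exact mul_le_mul (hc' ω) (hc _) (abs_nonneg _) ((abs_nonneg _).trans (hc' ω))
  have hi2 : Integrable (fun ω => ψ ω * ∫ y, f y ∂(P (X k ω))) μ :=
    integrable_of_abs_le ((hψ.mono hle le_rfl).mul (hPf.comp (hX.measurable _)))
      (c := c' * c) fun ω => by
      rw [abs_mul]
      exact mul_le_mul (hc' ω) (abs_integral_kernel_le hc _) (abs_nonneg _)
        ((abs_nonneg _).trans (hc' ω))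
  simp_rw [mul_sub]
  rw [integral_sub hi1 hi2, sub_eq_zero, ← integral_condExp hle]
  refine integral_congr_ae ?_
  have h1 := condExp_mul_of_stronglyMeasurable_left (μ := μ) (f := ψ)
    (g := fun ω => f (X (k + 1) ω)) hψ.stronglyMeasurable hi1
    (integrable_of_abs_le (hf.comp (hX.measurable _)) fun ω => hc _)
  filter_upwards [h1, hX.condExp hk hf hc] with ω h2 h3
  simp only [Pi.mul_apply] at h2
  change μ[fun ω => ψ ω * f (X (k + 1) ω)|pastSigma X k] ω = _ at h2
  rw [h2, h3]

end Markov

end Ergodic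

/-! ### Smoothness of the `L^p` norm for p ≥ 2 -/

section Smoothness

/-- Bernoulli's inequality, rescaled. It is used with q = p/2 to fold a first-order term back into a
single power. -/
lemma rpow_add_mul_rpow_le {t s q : ℝ} (ht : 0 ≤ t) (hs : 0 ≤ s) (hq : 1 ≤ q) :
    t ^ q + q * t ^ (q - 1) * s ≤ (t + s) ^ q := by
  rcases ht.eq_or_lt with rfl | ht
  · rcases hq.eq_or_lt with rfl | hq
    · simp
    · rw [Real.zero_rpow (by linarith), Real.zero_rpow (by linarith)]
      simpa using Real.rpow_nonneg hs q
  · have h := one_add_mul_self_le_rpow_one_add (s := s / t) (by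
      have : 0 ≤ s / t := by positivity
      linarith) hq
    have e : t + s = t * (1 + s / t) := by field_simp
    rw [e, Real.mul_rpow ht.le (by positivity), Real.rpow_sub_one ht.ne']
    calc t ^ q + q * (t ^ q / t) * s = t ^ q * (1 + q * (s / t)) := by ring
      _ ≤ _ := by gcongr

variable {E : Type*} [NormedAddCommGroup E] [InnerProductSpace ℝ E]

/-- A dimension-free second-order expansion with two regimes. If 2p‖d‖ ≤ ‖y‖, then ‖y+d‖^p = ‖y‖^p
(1+v)^{p/2} ≤ ‖y‖^p exp w with |w| ≤ 1, and exp w ≤ 1 + w + w². Otherwise ‖y‖ is of order p‖d‖, and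
both the left side and a negative first-order term fit into (5p‖d‖)^p. -/
lemma norm_add_rpow_le {p : ℝ} (hp : 2 ≤ p) (y d : E) :
    ‖y + d‖ ^ p ≤ ‖y‖ ^ p + p * (‖y‖ ^ (p - 2) * inner ℝ y d)
      + 2 * p ^ 2 * (‖y‖ ^ (p - 2) * ‖d‖ ^ 2) + (5 * p * ‖d‖) ^ p := by
  have hp0 : 0 < p := by linarith
  have hcs : |inner ℝ y d| ≤ ‖y‖ * ‖d‖ := abs_real_inner_le_norm y d
  obtain ⟨hcs1, hcs2⟩ := abs_le.mp hcs
  set a := ‖y‖ with ha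
  set δ := ‖d‖ with hδ
  have ha0 : 0 ≤ a := norm_nonneg _
  have hδ0 : 0 ≤ δ := norm_nonneg _
  have hpow0 : 0 ≤ a ^ (p - 2) := Real.rpow_nonneg ha0 _
  by_cases hcase : 2 * p * δ ≤ a ∧ 0 < a
  · obtain ⟨h1, hapos⟩ := hcase
    set i := inner ℝ y d with hi
    have hsq : ‖y + d‖ ^ 2 = a ^ 2 + (2 * i + δ ^ 2) := by
      rw [norm_add_sq_real]; ring
    set v := (2 * i + δ ^ 2) / a ^ 2 with hv
    have hsq' : ‖y + d‖ ^ 2 = a ^ 2 * (1 + v) := by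
      rw [hsq, hv]; field_simp
    have hv1 : 0 ≤ 1 + v := by
      have : 0 ≤ a ^ 2 * (1 + v) := hsq' ▸ sq_nonneg _
      exact nonneg_of_mul_nonneg_right this (by positivity)
    have hδa : δ ≤ a / 4 := by nlinarith
    have habs : |2 * i + δ ^ 2| ≤ 9 / 4 * (a * δ) := by
      rw [abs_le]; constructor <;> nlinarith
    set w := v * (p / 2) with hw
    have hwabs : |w| ≤ 9 / 8 * p * (δ / a) := by
      rw [hw, hv, abs_mul, abs_div, abs_of_pos (by positivity : 0 < a ^ 2),
        abs_of_pos (by positivity : 0 < p / 2)]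
      calc |2 * i + δ ^ 2| / a ^ 2 * (p / 2) ≤ 9 / 4 * (a * δ) / a ^ 2 * (p / 2) := by gcongr
        _ = _ := by field_simp; ring
    have hpδ : p * (δ / a) ≤ 1 / 2 := by
      rw [mul_div_assoc', div_le_iff₀ hapos]; linarith
    have hw1 : |w| ≤ 1 := by linarith
    have hwsq : w ^ 2 ≤ (9 / 8 * p * (δ / a)) ^ 2 := by
      rw [← sq_abs w]; gcongr
    have hexp : (1 + v) ^ (p / 2) ≤ 1 + w + w ^ 2 := by
      calc (1 + v) ^ (p / 2) ≤ (Real.exp v) ^ (p / 2) :=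
            Real.rpow_le_rpow hv1 (by linarith [Real.add_one_le_exp v]) (by positivity)
        _ = Real.exp w := by rw [← Real.exp_mul]
        _ ≤ _ := by
            have := (abs_le.mp (Real.abs_exp_sub_one_sub_id_le hw1)).2
            linarith
    have hap : a ^ p = a ^ (p - 2) * a ^ 2 := by
      rw [← Real.rpow_natCast a 2, ← Real.rpow_add hapos]; norm_num
    have hlhs : ‖y + d‖ ^ p = a ^ p * (1 + v) ^ (p / 2) := by
      have e1 : ‖y + d‖ ^ p = (‖y + d‖ ^ 2) ^ (p / 2) := by
        rw [← Real.rpow_natCast, ← Real.rpow_mul (norm_nonneg _)]; congr 1; push_cast; ring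
      have e2 : a ^ p = (a ^ 2) ^ (p / 2) := by
        rw [← Real.rpow_natCast, ← Real.rpow_mul ha0]; congr 1; push_cast; ring
      rw [e1, hsq', Real.mul_rpow (by positivity) hv1, e2]
    rw [hlhs]
    have h5 : 0 ≤ (5 * p * δ) ^ p := Real.rpow_nonneg (by positivity) _
    have hbound : a ^ 2 * (1 + w + w ^ 2) ≤ a ^ 2 + p * i + 2 * p ^ 2 * δ ^ 2 := by
      have e1 : a ^ 2 * w = p * i + p / 2 * δ ^ 2 := by
        rw [hw, hv]; field_simp
      have e2 : a ^ 2 * w ^ 2 ≤ 81 / 64 * p ^ 2 * δ ^ 2 := by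
        calc a ^ 2 * w ^ 2 ≤ a ^ 2 * (9 / 8 * p * (δ / a)) ^ 2 := by gcongr
          _ = _ := by field_simp; ring
      have e3 : p / 2 * δ ^ 2 ≤ 1 / 4 * p ^ 2 * δ ^ 2 := by
        have : p / 2 ≤ 1 / 4 * p ^ 2 := by nlinarith
        gcongr
      have e4 : 0 ≤ p ^ 2 * δ ^ 2 := by positivity
      nlinarith
    calc a ^ p * (1 + v) ^ (p / 2) ≤ a ^ p * (1 + w + w ^ 2) := by gcongr
      _ = a ^ (p - 2) * (a ^ 2 * (1 + w + w ^ 2)) := by rw [hap]; ring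
      _ ≤ a ^ (p - 2) * (a ^ 2 + p * i + 2 * p ^ 2 * δ ^ 2) := by gcongr
      _ = a ^ p + p * (a ^ (p - 2) * i) + 2 * p ^ 2 * (a ^ (p - 2) * δ ^ 2) := by
          rw [hap]; ring
      _ ≤ _ := by linarith
  · have h1 : a ≤ 2 * p * δ := by
      by_contra hcon
      push Not at hcon
      exact hcase ⟨hcon.le, lt_of_le_of_lt (by positivity) hcon⟩
    have hmain : ‖y + d‖ ^ p ≤ ((2 * p + 1) * δ) ^ p := by
      refine Real.rpow_le_rpow (norm_nonneg _) ((norm_add_le y d).trans ?_) hp0.le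
      rw [← ha, ← hδ]; linarith
    have hap : a ^ (p - 2) * a ≤ (2 * p * δ) ^ (p - 1) := by
      rcases ha0.eq_or_lt with h0 | h0
      · rw [← h0, mul_zero]; exact Real.rpow_nonneg (by positivity) _
      · calc a ^ (p - 2) * a = a ^ (p - 1) := by
              rw [← Real.rpow_add_one h0.ne']; congr 1; ring
          _ ≤ _ := Real.rpow_le_rpow ha0 h1 (by linarith)
    have hcross : -(p * (a ^ (p - 2) * inner ℝ y d)) ≤ (2 * p * δ) ^ p := by
      calc -(p * (a ^ (p - 2) * inner ℝ y d)) = p * (a ^ (p - 2) * (-inner ℝ y d)) := by ring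
        _ ≤ p * (a ^ (p - 2) * (a * δ)) := by gcongr; linarith
        _ = p * δ * (a ^ (p - 2) * a) := by ring
        _ ≤ p * δ * (2 * p * δ) ^ (p - 1) := by gcongr
        _ ≤ (2 * p * δ) ^ (p - 1) * (2 * p * δ) := by
            have : 0 ≤ (2 * p * δ) ^ (p - 1) * (p * δ) :=
              mul_nonneg (Real.rpow_nonneg (by positivity) _) (by positivity)
            nlinarith
        _ = (2 * p * δ) ^ p := by
            rcases hδ0.eq_or_lt with h0 | h0
            · rw [← h0, mul_zero, mul_zero, Real.zero_rpow hp0.ne']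
            · rw [← Real.rpow_add_one (by positivity)]; congr 1; ring
    -- Superadditivity of the p-th power gives ((4p+1)δ)^p, and 4p + 1 ≤ 5p.
    have hsum : ((2 * p + 1) * δ) ^ p + (2 * p * δ) ^ p ≤ (5 * p * δ) ^ p := by
      refine (Real.add_rpow_le_rpow_add (by positivity) (by positivity) (by linarith)).trans ?_
      refine Real.rpow_le_rpow (by positivity) ?_ hp0.le
      nlinarith
    have h2 : 0 ≤ a ^ p := Real.rpow_nonneg ha0 _
    have h3 : 0 ≤ 2 * p ^ 2 * (a ^ (p - 2) * δ ^ 2) := by positivity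
    linarith

variable {Ω : Type*} [MeasurableSpace Ω] {μ : Measure Ω}

lemma lpNorm_rpow_eq {F : Type*} [NormedAddCommGroup F] {p : ℝ} (hp : 0 < p) {f : Ω → F}
    (hf : AEStronglyMeasurable f μ) :
    lpNorm f (ENNReal.ofReal p) μ ^ p = ∫ ω, ‖f ω‖ ^ p ∂μ := by
  rw [lpNorm_eq_integral_norm_rpow_toReal (by simpa using hp) ENNReal.ofReal_ne_top hf,
    ENNReal.toReal_ofReal hp.le, Real.rpow_inv_rpow ?_ hp.ne']
  exact integral_nonneg fun ω => Real.rpow_nonneg (norm_nonneg _) _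

/-- Hölder with weights (p−2)/p and 2/p. The weighted form also covers p = 2, where the first weight
vanishes. -/
lemma integral_rpow_mul_sq_le [IsProbabilityMeasure μ] {p : ℝ} (hp : 2 ≤ p) {a d : Ω → ℝ}
    (ha : Measurable a) (hd : Measurable d) (ha0 : ∀ ω, 0 ≤ a ω) (hd0 : ∀ ω, 0 ≤ d ω)
    (hia : Integrable (fun ω => a ω ^ p) μ) (hid : Integrable (fun ω => d ω ^ p) μ) :
    ∫ ω, a ω ^ (p - 2) * d ω ^ 2 ∂μ
      ≤ (∫ ω, a ω ^ p ∂μ) ^ ((p - 2) / p) * (∫ ω, d ω ^ p ∂μ) ^ (2 / p) := by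
  have hp0 : 0 < p := by linarith
  have hpa : ∀ ω, 0 ≤ a ω ^ p := fun ω => Real.rpow_nonneg (ha0 ω) _
  have hpd : ∀ ω, 0 ≤ d ω ^ p := fun ω => Real.rpow_nonneg (hd0 ω) _
  have h := ENNReal.lintegral_mul_norm_pow_le (μ := μ) (f := fun ω => ENNReal.ofReal (a ω ^ p))
    (g := fun ω => ENNReal.ofReal (d ω ^ p))
    (ENNReal.measurable_ofReal.comp (ha.pow_const p)).aemeasurable
    (ENNReal.measurable_ofReal.comp (hd.pow_const p)).aemeasurable
    (p := (p - 2) / p) (q := 2 / p) (div_nonneg (by linarith) hp0.le) (by positivity)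
    (by field_simp; ring)
  rw [← ofReal_integral_eq_lintegral_ofReal hia (Filter.Eventually.of_forall hpa),
    ← ofReal_integral_eq_lintegral_ofReal hid (Filter.Eventually.of_forall hpd),
    ENNReal.ofReal_rpow_of_nonneg (integral_nonneg hpa) (div_nonneg (by linarith) hp0.le),
    ENNReal.ofReal_rpow_of_nonneg (integral_nonneg hpd) (by positivity),
    ← ENNReal.ofReal_mul (Real.rpow_nonneg (integral_nonneg hpa) _)] at h
  rw [integral_eq_lintegral_of_nonneg_ae
    (Filter.Eventually.of_forall fun ω =>
      mul_nonneg (Real.rpow_nonneg (ha0 ω) _) (sq_nonneg _))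
    ((ha.pow_const _).mul (hd.pow_const _)).aestronglyMeasurable]
  refine ENNReal.toReal_le_of_le_ofReal (mul_nonneg (Real.rpow_nonneg (integral_nonneg hpa) _)
    (Real.rpow_nonneg (integral_nonneg hpd) _)) (le_trans (le_of_eq ?_) h)
  refine lintegral_congr fun ω => ?_
  rw [ENNReal.ofReal_rpow_of_nonneg (hpa ω) (div_nonneg (by linarith) hp0.le),
    ENNReal.ofReal_rpow_of_nonneg (hpd ω) (by positivity),
    ← ENNReal.ofReal_mul (Real.rpow_nonneg (hpa ω) _), ← Real.rpow_mul (ha0 ω),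
    ← Real.rpow_mul (hd0 ω), mul_div_cancel₀ _ hp0.ne', mul_div_cancel₀ _ hp0.ne',
    Real.rpow_two]

/-- Martingale-type inequality in `L^p`, `p ≥ 2`: adding a conditionally centred increment `D` to
`Y` increases the squared `L^p` norm by at most `27 p² ‖D‖²`. -/
theorem lpNorm_add_sq_le [IsProbabilityMeasure μ] {p : ℝ} (hp : 2 ≤ p) {Y D : Ω → E}
    (hY : StronglyMeasurable Y) (hD : StronglyMeasurable D) {cY cD : ℝ} (hcY : ∀ ω, ‖Y ω‖ ≤ cY)
    (hcD : ∀ ω, ‖D ω‖ ≤ cD) (h0 : ∫ ω, ‖Y ω‖ ^ (p - 2) * inner ℝ (Y ω) (D ω) ∂μ = 0) :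
    lpNorm (fun ω => Y ω + D ω) (ENNReal.ofReal p) μ ^ 2
      ≤ lpNorm Y (ENNReal.ofReal p) μ ^ 2 + 27 * p ^ 2 * lpNorm D (ENNReal.ofReal p) μ ^ 2 := by
  have hp0 : 0 < p := by linarith
  have hint : ∀ {f : Ω → ℝ}, StronglyMeasurable f → (c : ℝ) → (∀ ω, |f ω| ≤ c) →
    Integrable f μ := fun hf c hc =>
      Integrable.of_bound hf.aestronglyMeasurable c (Filter.Eventually.of_forall hc)
  have hrpow : ∀ {Z : Ω → E} {c : ℝ}, StronglyMeasurable Z → (∀ ω, ‖Z ω‖ ≤ c) → ∀ q : ℝ, 0 ≤ q →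
      StronglyMeasurable (fun ω => ‖Z ω‖ ^ q) ∧ ∀ ω, |‖Z ω‖ ^ q| ≤ c ^ q := by
    intro Z c hZ hc q hq
    refine ⟨(hZ.norm.measurable.pow_const q).stronglyMeasurable, fun ω => ?_⟩
    rw [abs_of_nonneg (Real.rpow_nonneg (norm_nonneg _) _)]
    exact Real.rpow_le_rpow (norm_nonneg _) (hc ω) hq
  have hYp := hrpow hY hcY p hp0.le
  have hY2 := hrpow hY hcY (p - 2) (by linarith)
  have hDp := hrpow hD hcD p hp0.le
  have hYD := hrpow (hY.add hD) (c := cY + cD)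
    (fun ω => (norm_add_le _ _).trans (add_le_add (hcY ω) (hcD ω))) p hp0.le
  have hiYp := hint hYp.1 _ hYp.2
  have hiDp := hint hDp.1 _ hDp.2
  have hiYD := hint hYD.1 _ hYD.2
  have hiin : Integrable (fun ω => ‖Y ω‖ ^ (p - 2) * inner ℝ (Y ω) (D ω)) μ := by
    refine hint (hY2.1.mul (hY.inner hD)) (cY ^ (p - 2) * (cY * cD)) fun ω => ?_
    rw [abs_mul]
    refine mul_le_mul (hY2.2 ω) ((abs_real_inner_le_norm _ _).trans ?_) (abs_nonneg _)
      ((abs_nonneg _).trans (hY2.2 ω))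
    exact mul_le_mul (hcY ω) (hcD ω) (norm_nonneg _) ((norm_nonneg _).trans (hcY ω))
  have hisq : Integrable (fun ω => ‖Y ω‖ ^ (p - 2) * ‖D ω‖ ^ 2) μ := by
    refine hint (hY2.1.mul (hD.norm.pow 2)) (cY ^ (p - 2) * cD ^ 2) fun ω => ?_
    rw [abs_mul]
    refine mul_le_mul (hY2.2 ω) ?_ (abs_nonneg _) ((abs_nonneg _).trans (hY2.2 ω))
    rw [abs_of_nonneg (by positivity)]
    have := hcD ω
    gcongr
  have hmain : ∫ ω, ‖Y ω + D ω‖ ^ p ∂μ ≤ ∫ ω, ‖Y ω‖ ^ p ∂μ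
      + 2 * p ^ 2 * ∫ ω, ‖Y ω‖ ^ (p - 2) * ‖D ω‖ ^ 2 ∂μ
      + (5 * p) ^ p * ∫ ω, ‖D ω‖ ^ p ∂μ := by
    calc ∫ ω, ‖Y ω + D ω‖ ^ p ∂μ ≤ ∫ ω, (‖Y ω‖ ^ p + p * (‖Y ω‖ ^ (p - 2) * inner ℝ (Y ω) (D ω))
          + 2 * p ^ 2 * (‖Y ω‖ ^ (p - 2) * ‖D ω‖ ^ 2) + (5 * p) ^ p * ‖D ω‖ ^ p) ∂μ := by
          refine integral_mono hiYD (((hiYp.add (hiin.const_mul p)).add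
            (hisq.const_mul _)).add (hiDp.const_mul _)) fun ω => ?_
          have := norm_add_rpow_le hp (Y ω) (D ω)
          rwa [Real.mul_rpow (by positivity) (norm_nonneg _)] at this
      _ = _ := by
          have i1 : Integrable (fun ω => p * (‖Y ω‖ ^ (p - 2) * inner ℝ (Y ω) (D ω))) μ :=
            hiin.const_mul p
          have i2 : Integrable (fun ω => 2 * p ^ 2 * (‖Y ω‖ ^ (p - 2) * ‖D ω‖ ^ 2)) μ :=
            hisq.const_mul _
          have i3 : Integrable (fun ω => ‖Y ω‖ ^ p
              + p * (‖Y ω‖ ^ (p - 2) * inner ℝ (Y ω) (D ω))) μ := hiYp.add i1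
          have i4 : Integrable (fun ω => ‖Y ω‖ ^ p
              + p * (‖Y ω‖ ^ (p - 2) * inner ℝ (Y ω) (D ω))
              + 2 * p ^ 2 * (‖Y ω‖ ^ (p - 2) * ‖D ω‖ ^ 2)) μ := i3.add i2
          rw [integral_add i4 (hiDp.const_mul _), integral_add i3 i2, integral_add hiYp i1,
            integral_const_mul, integral_const_mul, integral_const_mul, h0, mul_zero, add_zero]
  have hhold := integral_rpow_mul_sq_le (μ := μ) hp hY.norm.measurable hD.norm.measurable
    (fun ω => norm_nonneg _) (fun ω => norm_nonneg _) hiYp hiDp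
  set A := lpNorm Y (ENNReal.ofReal p) μ with hA
  set B := lpNorm D (ENNReal.ofReal p) μ with hB
  have hA0 : 0 ≤ A := lpNorm_nonneg
  have hB0 : 0 ≤ B := lpNorm_nonneg
  have eA := lpNorm_rpow_eq (μ := μ) hp0 hY.aestronglyMeasurable
  have eB := lpNorm_rpow_eq (μ := μ) hp0 hD.aestronglyMeasurable
  have eAB := lpNorm_rpow_eq (μ := μ) hp0 (hY.add hD).aestronglyMeasurable
  rw [← hA] at eA
  rw [← hB] at eB
  rw [← eA, ← eB, ← Real.rpow_mul hA0, ← Real.rpow_mul hB0, mul_div_cancel₀ _ hp0.ne',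
    mul_div_cancel₀ _ hp0.ne', Real.rpow_two] at hhold
  simp only [Pi.add_apply] at eAB
  rw [← eAB, ← eA, ← eB] at hmain
  set T := lpNorm (Y + D) (ENNReal.ofReal p) μ with hT
  have hT0 : 0 ≤ T := lpNorm_nonneg
  change T ^ 2 ≤ _
  have hsq : ∀ {x : ℝ}, 0 ≤ x → x ^ p = (x ^ 2) ^ (p / 2) := fun {x} hx => by
    rw [← Real.rpow_natCast, ← Real.rpow_mul hx]; congr 1; push_cast; ring
  -- The quadratic term 2p²B² enters through Bernoulli for the exponent p/2 ≥ 1, the remainder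
  -- (5pB)^p = (25p²B²)^{p/2} through superadditivity; 27 = 2 + 25.
  have h1 : T ^ p ≤ (A ^ 2 + 27 * p ^ 2 * B ^ 2) ^ (p / 2) := by
    have hq : 1 ≤ p / 2 := by linarith
    have hb := rpow_add_mul_rpow_le (t := A ^ 2) (s := 2 * p ^ 2 * B ^ 2) (sq_nonneg A)
      (by positivity) hq
    have e1 : (A ^ 2) ^ (p / 2 - 1) = A ^ (p - 2) := by
      rw [← Real.rpow_natCast, ← Real.rpow_mul hA0]; congr 1; push_cast; ring
    rw [e1, ← hsq hA0] at hb
    have e2 : (5 * p) ^ p * B ^ p = (25 * p ^ 2 * B ^ 2) ^ (p / 2) := by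
      rw [← Real.mul_rpow (by positivity) hB0, hsq (by positivity)]; congr 1; ring
    have hsup := Real.add_rpow_le_rpow_add (a := A ^ 2 + 2 * p ^ 2 * B ^ 2)
      (b := 25 * p ^ 2 * B ^ 2) (by positivity) (by positivity) hq
    rw [← e2] at hsup
    have e3 : A ^ 2 + 2 * p ^ 2 * B ^ 2 + 25 * p ^ 2 * B ^ 2 = A ^ 2 + 27 * p ^ 2 * B ^ 2 := by
      ring
    rw [e3] at hsup
    have hApow : 0 ≤ A ^ (p - 2) := Real.rpow_nonneg hA0 _
    have h3 : 2 * p ^ 2 * ∫ ω, ‖Y ω‖ ^ (p - 2) * ‖D ω‖ ^ 2 ∂μ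
        ≤ p / 2 * A ^ (p - 2) * (2 * p ^ 2 * B ^ 2) := by
      calc 2 * p ^ 2 * ∫ ω, ‖Y ω‖ ^ (p - 2) * ‖D ω‖ ^ 2 ∂μ
          ≤ 2 * p ^ 2 * (A ^ (p - 2) * B ^ 2) := by gcongr
        _ = 1 * (A ^ (p - 2) * (2 * p ^ 2 * B ^ 2)) := by ring
        _ ≤ p / 2 * (A ^ (p - 2) * (2 * p ^ 2 * B ^ 2)) := by gcongr
        _ = _ := by ring
    linarith
  rw [hsq hT0] at h1
  exact (Real.rpow_le_rpow_iff (by positivity) (by positivity) (by linarith)).mp h1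

end Smoothness

/-! ### Matrices acting on Euclidean vectors -/

section Act

variable {l m n : ℕ}

lemma act_add_left (A B : Matrix (Fin m) (Fin n) ℝ) (x : Vec n) :
    act (A + B) x = act A x + act B x := by simp [act]

lemma act_sub_left (A B : Matrix (Fin m) (Fin n) ℝ) (x : Vec n) :
    act (A - B) x = act A x - act B x := by simp [act]

lemma act_smul_left (c : ℝ) (A : Matrix (Fin m) (Fin n) ℝ) (x : Vec n) :
    act (c • A) x = c • act A x := by simp [act]

lemma act_add (A : Matrix (Fin m) (Fin n) ℝ) (x y : Vec n) :
    act A (x + y) = act A x + act A y := map_add _ _ _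

lemma act_sub (A : Matrix (Fin m) (Fin n) ℝ) (x y : Vec n) :
    act A (x - y) = act A x - act A y := map_sub _ _ _

lemma act_smul (A : Matrix (Fin m) (Fin n) ℝ) (c : ℝ) (x : Vec n) :
    act A (c • x) = c • act A x := map_smul _ _ _

lemma act_sum {ι : Type*} (s : Finset ι) (A : Matrix (Fin m) (Fin n) ℝ) (x : ι → Vec n) :
    act A (∑ i ∈ s, x i) = ∑ i ∈ s, act A (x i) := map_sum _ _ _

lemma act_one (x : Vec n) : act (1 : Matrix (Fin n) (Fin n) ℝ) x = x := by
  simp [act]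

lemma act_mul (A : Matrix (Fin l) (Fin m) ℝ) (B : Matrix (Fin m) (Fin n) ℝ) (x : Vec n) :
    act (A * B) x = act A (act B x) := by
  simp [act, Matrix.toLpLin_apply, Matrix.mulVec_mulVec]

lemma norm_act_le (A : Matrix (Fin m) (Fin n) ℝ) (x : Vec n) : ‖act A x‖ ≤ ‖A‖ * ‖x‖ := by
  rw [Matrix.l2_opNorm_def]
  exact ((Matrix.toEuclideanLin ≪≫ₗ LinearMap.toContinuousLinearMap) A).le_opNorm x

lemma norm_act_le_of_le {A : Matrix (Fin m) (Fin n) ℝ} {x : Vec n} {a b : ℝ} (ha : ‖A‖ ≤ a)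
    (hb : ‖x‖ ≤ b) : ‖act A x‖ ≤ a * b :=
  (norm_act_le A x).trans (mul_le_mul ha hb (norm_nonneg _) ((norm_nonneg _).trans ha))

lemma matrix_norm_le {A : Matrix (Fin m) (Fin n) ℝ} {c : ℝ} (hc : 0 ≤ c)
    (h : ∀ x, ‖act A x‖ ≤ c * ‖x‖) : ‖A‖ ≤ c := by
  rw [Matrix.l2_opNorm_def]
  exact ContinuousLinearMap.opNorm_le_bound _ hc h

lemma inner_act (A : Matrix (Fin m) (Fin n) ℝ) (x : Vec n) (y : Vec m) :
    inner ℝ (act A x) y = inner ℝ x (act A.transpose y) := by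
  have h := Matrix.toEuclideanLin_conjTranspose_eq_adjoint A
  rw [Matrix.conjTranspose_eq_transpose_of_trivial] at h
  rw [act, act, h, LinearMap.adjoint_inner_right]

end Act

/-! ### Contraction in the Lyapunov norm -/

section Lyapunov

lemma IsLyapunov.norm_pos {d : ℕ} [NeZero d] {A Q : Matrix (Fin d) (Fin d) ℝ}
    (h : IsLyapunov A Q) : 0 < ‖Q‖ := by
  rw [norm_pos_iff]
  rintro rfl
  exact (zero_ne_one (α := Matrix (Fin d) (Fin d) ℝ)) (by simpa using h.2)

lemma IsLyapunov.rate_pos {d : ℕ} [NeZero d] {A Q : Matrix (Fin d) (Fin d) ℝ}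
    (h : IsLyapunov A Q) : 0 < rate Q := by
  have := h.norm_pos
  rw [rate]
  positivity

/-- In the norm `‖J x‖ = (xᵀ Q x)^{1/2}` the map `1 - t A` is a contraction for small `t ≥ 0`. -/
lemma IsLyapunov.exists_contraction {d : ℕ} [NeZero d] {A Q : Matrix (Fin d) (Fin d) ℝ}
    (h : IsLyapunov A Q) :
    ∃ J Ji : Matrix (Fin d) (Fin d) ℝ, Ji * J = 1 ∧ ∃ t₀ : ℝ, 0 < t₀ ∧
      ∀ t : ℝ, 0 ≤ t → t ≤ t₀ → rate Q * t ≤ 1 / 2 ∧ ∀ x : Vec d,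
        ‖act J (x - t • act A x)‖ ≤ (1 - rate Q * t) * ‖act J x‖ := by
  have hρ := h.rate_pos
  have hQpos := h.norm_pos
  obtain ⟨hQ, hL⟩ := h
  obtain ⟨J, hJ⟩ : ∃ J : Matrix (Fin d) (Fin d) ℝ, Q = J.transpose * J := by
    open MatrixOrder in
    obtain ⟨J, hJ⟩ := CStarAlgebra.nonneg_iff_eq_star_mul_self.mp hQ.posSemidef.nonneg
    exact ⟨J, by rw [hJ, Matrix.star_eq_conjTranspose,
      Matrix.conjTranspose_eq_transpose_of_trivial]⟩
  have hJu : IsUnit J := by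
    have := hQ.isUnit
    rw [Matrix.isUnit_iff_isUnit_det, hJ, Matrix.det_mul] at this
    rw [Matrix.isUnit_iff_isUnit_det]
    exact isUnit_of_mul_isUnit_right this
  obtain ⟨u, hu⟩ := hJu
  set Ji : Matrix (Fin d) (Fin d) ℝ := ↑u⁻¹ with hJi
  have hinv : Ji * J = 1 := by rw [← hu]; exact u.inv_mul
  set c := ‖J * A * Ji‖ with hc
  have hin : ∀ x y : Vec d, inner ℝ (act J x) (act J y) = inner ℝ x (act Q y) := fun x y => by
    rw [inner_act, ← act_mul, ← hJ]
  -- The first bound on t puts the quadratic term t²‖JAx‖² below ρt‖Jx‖², where ρ = `rate Q`; the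
  -- second gives ρt ≤ 1/2.
  refine ⟨J, Ji, hinv, min (rate Q / (c ^ 2 + 1)) (1 / (2 * rate Q)), by positivity, ?_⟩
  intro t ht ht'
  have ht1 : t * (c ^ 2 + 1) ≤ rate Q := by
    have := ht'.trans (min_le_left _ _)
    rwa [le_div_iff₀ (by positivity)] at this
  have ht2 : t * (2 * rate Q) ≤ 1 := by
    have := ht'.trans (min_le_right _ _)
    rwa [le_div_iff₀ (by positivity)] at this
  refine ⟨by linarith, fun x => ?_⟩
  have hJA : ‖act J (act A x)‖ ≤ c * ‖act J x‖ := by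
    have e : act J (act A x) = act (J * A * Ji) (act J x) := by
      rw [← act_mul, ← act_mul, mul_assoc (J * A), hinv, mul_one]
    rw [e]; exact norm_act_le _ _
  have hinner : 2 * inner ℝ (act J x) (act J (act A x)) = ‖x‖ ^ 2 := by
    have e1 : inner ℝ (act J x) (act J (act A x)) = inner ℝ x (act (Q * A) x) := by
      rw [hin, ← act_mul]
    have e2 : inner ℝ (act J x) (act J (act A x)) = inner ℝ x (act (A.transpose * Q) x) := by
      rw [real_inner_comm, hin, inner_act, ← act_mul]
    have e3 : inner ℝ x (act (A.transpose * Q + Q * A) x) = ‖x‖ ^ 2 := by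
      rw [hL, act_one, real_inner_self_eq_norm_sq]
    rw [act_add_left, inner_add_right, ← e1, ← e2] at e3
    linarith
  have hJx : ‖act J x‖ ^ 2 ≤ ‖Q‖ * ‖x‖ ^ 2 := by
    rw [← real_inner_self_eq_norm_sq, hin]
    calc inner ℝ x (act Q x) ≤ ‖x‖ * ‖act Q x‖ := real_inner_le_norm _ _
      _ ≤ ‖x‖ * (‖Q‖ * ‖x‖) := by gcongr; exact norm_act_le _ _
      _ = _ := by ring
  have hx : 4 * rate Q * ‖act J x‖ ^ 2 ≤ ‖x‖ ^ 2 := by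
    have : 4 * rate Q = 1 / ‖Q‖ := by rw [rate]; field_simp
    rw [this, one_div, inv_mul_le_iff₀ hQpos]
    exact hJx
  -- The Lyapunov equation gives 2⟨Jx, JAx⟩ = ‖x‖² ≥ 4ρ‖Jx‖², so the square is at most (1 − 4ρt +
  -- ρt)‖Jx‖², below (1 − ρt)²‖Jx‖².
  have hsq : ‖act J (x - t • act A x)‖ ^ 2 ≤ ((1 - rate Q * t) * ‖act J x‖) ^ 2 := by
    rw [act_sub, act_smul, norm_sub_sq_real, inner_smul_right, norm_smul, mul_pow,
      Real.norm_of_nonneg ht]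
    have h1 : ‖act J (act A x)‖ ^ 2 ≤ c ^ 2 * ‖act J x‖ ^ 2 := by
      rw [← mul_pow]; gcongr
    have h2 : t ^ 2 * ‖act J (act A x)‖ ^ 2 ≤ t ^ 2 * (c ^ 2 * ‖act J x‖ ^ 2) := by gcongr
    have h3 : t * (t * c ^ 2) * ‖act J x‖ ^ 2 ≤ t * rate Q * ‖act J x‖ ^ 2 := by
      gcongr; nlinarith
    have h4 : t * (4 * rate Q * ‖act J x‖ ^ 2) ≤ t * ‖x‖ ^ 2 := by gcongr
    have h5 : 0 ≤ rate Q * t * ‖act J x‖ ^ 2 := by positivity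
    have h6 : 0 ≤ (rate Q * t) ^ 2 * ‖act J x‖ ^ 2 := by positivity
    nlinarith
  refine (pow_le_pow_iff_left₀ (norm_nonneg _) ?_ two_ne_zero).mp hsq
  refine mul_nonneg ?_ (norm_nonneg _)
  nlinarith

end Lyapunov

/-! ### Step-size conditions -/

/-- Smallness conditions on the step sizes, `κ = β / γ` being the ratio of the time scales. -/
structure StepCond (δ p : ℝ) (β γ : ℕ → ℝ) : Prop where
  β_pos : ∀ k, 0 < β k
  γ_pos : ∀ k, 0 < γ k
  β_le : ∀ k, β k ≤ δ * γ k
  γ_le : ∀ k, p ^ 2 * γ k ≤ δ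
  γ_sq_le : ∀ k, γ k ^ 2 ≤ δ * β k
  β_anti : ∀ k, β (k + 1) ≤ β k
  γ_anti : ∀ k, γ (k + 1) ≤ γ k
  κ_anti : ∀ k, β (k + 1) / γ (k + 1) ≤ β k / γ k
  β_diff : ∀ k, β k - β (k + 1) ≤ δ * β k ^ 2
  γ_diff : ∀ k, γ k - γ (k + 1) ≤ δ * γ k ^ 2
  κ_diff : ∀ k, β k / γ k - β (k + 1) / γ (k + 1) ≤ δ * (β k / γ k * β k)

namespace StepCond

variable {δ p : ℝ} {β γ : ℕ → ℝ}

lemma mono (h : StepCond δ p β γ) {δ' : ℝ} (hδ : δ ≤ δ') : StepCond δ' p β γ where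
  β_pos := h.β_pos
  γ_pos := h.γ_pos
  β_le k := (h.β_le k).trans (mul_le_mul_of_nonneg_right hδ (h.γ_pos k).le)
  γ_le k := (h.γ_le k).trans hδ
  γ_sq_le k := (h.γ_sq_le k).trans (mul_le_mul_of_nonneg_right hδ (h.β_pos k).le)
  β_anti := h.β_anti
  γ_anti := h.γ_anti
  κ_anti := h.κ_anti
  β_diff k := (h.β_diff k).trans (mul_le_mul_of_nonneg_right hδ (sq_nonneg _))
  γ_diff k := (h.γ_diff k).trans (mul_le_mul_of_nonneg_right hδ (sq_nonneg _))
  κ_diff k := (h.κ_diff k).trans (mul_le_mul_of_nonneg_right hδ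
    (mul_nonneg (div_nonneg (h.β_pos k).le (h.γ_pos k).le) (h.β_pos k).le))

lemma γ_le' (h : StepCond δ p β γ) (hp : 2 ≤ p) (k : ℕ) : γ k ≤ δ := by
  have h1 : 1 ≤ p ^ 2 := by nlinarith
  have h2 := h.γ_le k
  nlinarith [h.γ_pos k]

end StepCond

/-! ### Smallness of the decoupling matrices -/

section Decoupling

variable {m n : ℕ} [NeZero n]

/-- The decoupling matrices stay small, and `1 - β U` stays invertible. -/
lemma exists_norm_L_le (M : Coeffs m n) {Q : Matrix (Fin n) (Fin n) ℝ} (hQ : IsLyapunov M.A22 Q)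
    {ε : ℝ} (hε : 0 < ε) :
    ∃ δ : ℝ, 0 < δ ∧ δ ≤ 1 ∧ ∀ (p : ℝ) (β γ : ℕ → ℝ), 2 ≤ p → StepCond δ p β γ → ∀ k,
      ‖M.L β γ k‖ ≤ ε ∧ β k * ‖M.U (M.L β γ k)‖ ≤ 1 / 2 := by
  obtain ⟨J, Ji, hJ, t₀, ht₀, hcon⟩ := hQ.exists_contraction
  have hρ := hQ.rate_pos
  set ρ := rate Q
  set ℓ := ε / (‖Ji‖ + 1) with hℓ
  have hℓ0 : 0 < ℓ := by positivity
  set u := ‖M.schur‖ + ‖M.A12‖ * ε with hu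
  have hu0 : 0 ≤ u := by positivity
  set c := ‖J * (M.A22⁻¹ * M.A21)‖ * u with hc
  have hc0 : 0 ≤ c := by positivity
  -- The ball of radius ℓ in the norm ‖J·‖ is invariant once the forcing β(c + ℓu) is at most the
  -- contraction gain ργℓ. As β ≤ δγ, the last entry ensures this; the third keeps βu ≤ 1/2.
  set δ := min (min 1 t₀) (min (1 / (2 * u + 1)) (ρ * ℓ / (c + ℓ * u + 1))) with hδ
  have hδ0 : 0 < δ := by positivity
  have hδ1 : δ ≤ 1 := (min_le_left _ _).trans (min_le_left _ _)
  have hδt : δ ≤ t₀ := (min_le_left _ _).trans (min_le_right _ _)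
  have hδu : δ * (2 * u + 1) ≤ 1 := by
    rw [← le_div_iff₀ (by positivity)]; exact (min_le_right _ _).trans (min_le_left _ _)
  have hδρ : δ * (c + ℓ * u + 1) ≤ ρ * ℓ := by
    rw [← le_div_iff₀ (by positivity)]; exact (min_le_right _ _).trans (min_le_right _ _)
  refine ⟨δ, hδ0, hδ1, fun p β γ hp hs => ?_⟩
  have hγδ := hs.γ_le' hp
  have hLε : ∀ L : Matrix (Fin n) (Fin m) ℝ, ‖J * L‖ ≤ ℓ → ‖L‖ ≤ ε := by
    intro L hL
    calc ‖L‖ = ‖Ji * (J * L)‖ := by rw [← Matrix.mul_assoc, hJ, Matrix.one_mul]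
      _ ≤ ‖Ji‖ * ‖J * L‖ := Matrix.l2_opNorm_mul _ _
      _ ≤ (‖Ji‖ + 1) * ℓ := by gcongr; linarith
      _ = ε := by rw [hℓ]; field_simp
  have hUle : ∀ L : Matrix (Fin n) (Fin m) ℝ, ‖L‖ ≤ ε → ‖M.U L‖ ≤ u := by
    intro L hL
    calc ‖M.U L‖ ≤ ‖M.schur‖ + ‖M.A12 * L‖ := norm_sub_le _ _
      _ ≤ ‖M.schur‖ + ‖M.A12‖ * ‖L‖ := by gcongr; exact Matrix.l2_opNorm_mul _ _
      _ ≤ u := by rw [hu]; gcongr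
  have hβu : ∀ k, β k * u ≤ 1 / 2 := by
    intro k
    have h1 : β k ≤ δ := (hs.β_le k).trans (by nlinarith [hγδ k])
    nlinarith
  suffices h : ∀ k, ‖J * M.L β γ k‖ ≤ ℓ by
    intro k
    refine ⟨hLε _ (h k), ?_⟩
    exact (mul_le_mul_of_nonneg_left (hUle _ (hLε _ (h k))) (hs.β_pos k).le).trans (hβu k)
  intro k
  induction k with
  | zero => simpa [Coeffs.L] using hℓ0.le
  | succ k ih =>
    have hU := hUle _ (hLε _ ih)
    have hβ0 := (hs.β_pos k).le
    have hγ0 := (hs.γ_pos k).le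
    have hunit : IsUnit (1 - β k • M.U (M.L β γ k)) := by
      refine isUnit_one_sub_of_norm_lt_one ?_
      rw [norm_smul, Real.norm_of_nonneg hβ0]
      nlinarith [hβu k]
    set Lk := M.L β γ k with hLk
    set L' := M.L β γ (k + 1) with hL'
    set N := Lk - γ k • (M.A22 * Lk) + β k • (M.A22⁻¹ * M.A21 * M.U Lk) with hN
    have hrec : L' * (1 - β k • M.U Lk) = N := by
      rw [hL', Coeffs.L, Matrix.mul_assoc, Matrix.nonsing_inv_mul _
        ((Matrix.isUnit_iff_isUnit_det _).mp hunit), Matrix.mul_one]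
    -- The inverse of 1 − βU is not estimated: L' is kept on both sides, and the factor 1 − βu > 0
    -- is divided out at the end.
    have e1 : J * L' = J * N + β k • (J * L' * M.U Lk) := by
      rw [← hrec, Matrix.mul_sub, Matrix.mul_one, Matrix.mul_sub, Matrix.mul_smul, Matrix.mul_smul,
        Matrix.mul_assoc]
      abel
    have h1 : ‖J * L'‖ ≤ ‖J * N‖ + β k * (‖J * L'‖ * u) := by
      calc ‖J * L'‖ ≤ ‖J * N‖ + ‖β k • (J * L' * M.U Lk)‖ := by
            conv_lhs => rw [e1]
            exact norm_add_le _ _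
        _ ≤ _ := by
          rw [norm_smul, Real.norm_of_nonneg hβ0]
          gcongr
          exact (Matrix.l2_opNorm_mul _ _).trans (mul_le_mul_of_nonneg_left hU (norm_nonneg _))
    obtain ⟨hργ, hcon'⟩ := hcon (γ k) hγ0 ((hγδ k).trans hδt)
    have hpos : 0 ≤ 1 - ρ * γ k := by linarith
    have h2 : ‖J * (Lk - γ k • (M.A22 * Lk))‖ ≤ (1 - ρ * γ k) * ‖J * Lk‖ := by
      refine matrix_norm_le (mul_nonneg hpos (norm_nonneg _)) fun x => ?_
      have e2 : act (J * (Lk - γ k • (M.A22 * Lk))) x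
          = act J (act Lk x - γ k • act M.A22 (act Lk x)) := by
        rw [act_mul, act_sub_left, act_smul_left, act_mul]
      rw [e2, mul_assoc]
      refine (hcon' _).trans ?_
      rw [← act_mul]
      exact mul_le_mul_of_nonneg_left (norm_act_le _ _) hpos
    have h3 : ‖J * N‖ ≤ (1 - ρ * γ k) * ‖J * Lk‖ + β k * c := by
      rw [hN, Matrix.mul_add]
      refine (norm_add_le _ _).trans (add_le_add h2 ?_)
      rw [Matrix.mul_smul, norm_smul, Real.norm_of_nonneg hβ0, ← Matrix.mul_assoc, hc]
      exact mul_le_mul_of_nonneg_left ((Matrix.l2_opNorm_mul _ _).trans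
        (mul_le_mul_of_nonneg_left hU (norm_nonneg _))) hβ0
    have h4 := mul_le_mul_of_nonneg_left ih hpos
    have h5 : β k * c ≤ δ * γ k * c := by gcongr; exact hs.β_le k
    have h6 : β k * (ℓ * u) ≤ δ * γ k * (ℓ * u) := by gcongr; exact hs.β_le k
    have h7 : γ k * (δ * (c + ℓ * u + 1)) ≤ γ k * (ρ * ℓ) := by gcongr
    have h8 : ‖J * L'‖ * (1 - β k * u) ≤ ℓ * (1 - β k * u) := by
      have h10 : 0 ≤ γ k * δ := by positivity
      linarith
    have h9 : 0 < 1 - β k * u := by linarith [hβu k]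
    exact le_of_mul_le_mul_right h8 h9

end Decoupling

/-! ### Scalar recursions on two time scales -/

section Sequences

/-- The sequence (2D/c)b_k is a supersolution: the contraction gains 2Db_k² on it, of which Db_k²
pays for the forcing and Db_k² for the decrease from b_k to b_{k+1}, since b varies slowly. -/
lemma le_prod_add_of_recursion {c D δ : ℝ} {s b : ℕ → ℝ} (hc : 0 < c) (hD : 0 ≤ D)
    (hδ : δ ≤ c / 2) (hcb : ∀ k, c * b k ≤ 1) (hdiff : ∀ k, b k - b (k + 1) ≤ δ * b k ^ 2)
    (hb : ∀ k, 0 ≤ b k) (hs : ∀ k, s (k + 1) ≤ (1 - c * b k) * s k + D * b k ^ 2) (k : ℕ) :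
    s k ≤ s 0 * ∏ j ∈ Finset.range k, (1 - c * b j) + 2 * D / c * b k := by
  induction k with
  | zero =>
    have := hb 0
    simp only [Finset.range_zero, Finset.prod_empty, mul_one]
    have : 0 ≤ 2 * D / c * b 0 := by positivity
    linarith
  | succ k ih =>
    rw [Finset.prod_range_succ]
    set P := ∏ j ∈ Finset.range k, (1 - c * b j)
    have h1 : 0 ≤ 1 - c * b k := by linarith [hcb k]
    have h2 := mul_le_mul_of_nonneg_left ih h1
    have h3 : 0 ≤ 2 * D / c := by positivity
    have h4 : 2 * D / c * (b k - b (k + 1)) ≤ 2 * D / c * (c / 2 * b k ^ 2) := by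
      refine mul_le_mul_of_nonneg_left ((hdiff k).trans ?_) h3
      exact mul_le_mul_of_nonneg_right hδ (sq_nonneg _)
    have h5 : 2 * D / c * (c / 2 * b k ^ 2) = D * b k ^ 2 := by field_simp
    have h6 : 2 * D / c * (c * b k * b k) = 2 * D * b k ^ 2 := by field_simp
    linarith [hs k]

/-- Coupled recursions for the squared norms on the two time scales. -/
lemma exists_two_timescale_bound {a₁ a₂ K : ℝ} (ha₁ : 0 < a₁) (ha₂ : 0 < a₂) (hK : 0 < K) :
    ∃ δ : ℝ, 0 < δ ∧ ∀ S : ℝ, 1 ≤ S → ∃ C : ℝ, 0 < C ∧ ∀ (p : ℝ) (β γ A B : ℕ → ℝ), 2 ≤ p →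
      StepCond δ p β γ → (∀ k, 0 ≤ A k) → (∀ k, 0 ≤ B k) → A 0 ≤ S → B 0 ≤ S →
      (∀ k, A (k + 1) ≤ (1 - a₁ * γ k) * A k + K * (p ^ 2 * γ k ^ 2) * (1 + A k + B k)) →
      (∀ k, B (k + 1) ≤ (1 - a₂ * β k) * B k + K * (β k * (β k / γ k) ^ 2) * A k
        + K * (p ^ 2 * β k ^ 2) * (1 + A k + B k)) →
      ∀ k, (A k ≤ S ∧ B k ≤ S) ∧
        A k ≤ C * (∏ j ∈ Finset.range k, (1 - a₁ * γ j) + p ^ 2 * γ k) ∧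
        B k ≤ C * (∏ j ∈ Finset.range k, (1 - a₂ * β j) + p ^ 2 * β k) := by
  obtain ⟨δ, hδ0, hδ1, hδ3, hδ4, hδ6⟩ : ∃ δ : ℝ, 0 < δ ∧ δ ≤ 1 ∧ δ * (2 * a₂) ≤ min a₁ 1
      ∧ δ * (6 * K) ≤ min a₁ a₂ ∧ δ * 2 ≤ min (1 / a₁) (min a₁ a₂) := by
    refine ⟨min 1 (min (min a₁ 1 / (2 * a₂)) (min (min a₁ a₂ / (6 * K))
      (min (1 / a₁) (min a₁ a₂) / 2))), by positivity, min_le_left _ _, ?_, ?_, ?_⟩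
    · rw [← le_div_iff₀ (by positivity)]
      exact (min_le_right _ _).trans (min_le_left _ _)
    · rw [← le_div_iff₀ (by positivity)]
      exact (min_le_right _ _).trans ((min_le_right _ _).trans (min_le_left _ _))
    · rw [← le_div_iff₀ (by positivity)]
      exact (min_le_right _ _).trans ((min_le_right _ _).trans (min_le_right _ _))
  have hδa : δ * (2 * a₂) ≤ a₁ := hδ3.trans (min_le_left _ _)
  have hδa' : δ * (2 * a₂) ≤ 1 := hδ3.trans (min_le_right _ _)
  have hδK1 : δ * (6 * K) ≤ a₁ := hδ4.trans (min_le_left _ _)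
  have hδK2 : δ * (6 * K) ≤ a₂ := hδ4.trans (min_le_right _ _)
  have hδ1' : δ * 2 ≤ 1 / a₁ := hδ6.trans (min_le_left _ _)
  have hδ2' : δ ≤ a₁ / 2 := by
    have := hδ6.trans ((min_le_right _ _).trans (min_le_left _ _)); linarith
  have hδ3' : δ ≤ a₂ / 2 := by
    have := hδ6.trans ((min_le_right _ _).trans (min_le_right _ _)); linarith
  -- The threshold δ does not depend on the bound S for the initial data: for S ≥ 1 one has 1 + A +
  -- B ≤ 3S, so the invariance argument is homogeneous in S.
  refine ⟨δ, hδ0, fun S hS => ?_⟩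
  set D₁ := K * (1 + 2 * S) with hD₁
  have hD₁0 : 0 ≤ D₁ := by positivity
  set K₂ := 2 * D₁ / a₁ with hK₂
  have hK₂0 : 0 ≤ K₂ := by positivity
  set D₂ := K * K₂ + K * (1 + 2 * S) with hD₂
  have hD₂0 : 0 ≤ D₂ := by positivity
  set K₃ := 2 * D₂ / a₂ with hK₃
  have hK₃0 : 0 ≤ K₃ := by positivity
  refine ⟨2 * S + K₂ + K₃, by positivity, ?_⟩
  intro p β γ A B hp hs hA hB hA0 hB0 hAr hBr
  have hγδ := hs.γ_le' hp
  have hβ0 := fun k => (hs.β_pos k).le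
  have hγ0 := fun k => (hs.γ_pos k).le
  have hβγ : ∀ k, β k ≤ γ k := fun k => (hs.β_le k).trans (by nlinarith [hs.γ_pos k])
  have hp2β : ∀ k, p ^ 2 * β k ≤ δ := fun k =>
    (mul_le_mul_of_nonneg_left (hβγ k) (sq_nonneg p)).trans (hs.γ_le k)
  have hκδ : ∀ k, β k / γ k ≤ δ := fun k => by
    rw [div_le_iff₀ (hs.γ_pos k)]; exact hs.β_le k
  have hκ0 : ∀ k, 0 ≤ β k / γ k := fun k => div_nonneg (hβ0 k) (hγ0 k)
  have hκsq : ∀ k, (β k / γ k) ^ 2 ≤ δ := fun k => by nlinarith [hκδ k, hκ0 k]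
  have ha1γ : ∀ k, a₁ * γ k ≤ 1 / 2 := fun k => by
    have h1 : γ k * 2 ≤ 1 / a₁ := by linarith [hγδ k]
    rw [le_div_iff₀ ha₁] at h1
    linarith
  have ha2β : ∀ k, a₂ * β k ≤ 1 / 2 := fun k => by
    have h1 : a₂ * β k ≤ a₂ * δ := by
      gcongr; exact (hβγ k).trans (hγδ k)
    linarith
  -- A priori bound: by p²γ ≤ δ the multiplicative noise is dominated by the contraction. Afterwards
  -- 1 + A + B is replaced by a constant and the recursions become linear.
  have hbd : ∀ k, A k ≤ S ∧ B k ≤ S := by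
    intro k
    induction k with
    | zero => exact ⟨hA0, hB0⟩
    | succ k ih =>
      obtain ⟨ihA, ihB⟩ := ih
      have hγk := hγ0 k
      have hβk := hβ0 k
      have hAk := hA k
      have hsum : 1 + A k + B k ≤ 3 * S := by linarith
      have hsum0 : 0 ≤ 1 + A k + B k := by linarith [hA k, hB k]
      constructor
      · have h1 : K * (p ^ 2 * γ k ^ 2) * (1 + A k + B k) ≤ K * (δ * γ k) * (3 * S) := by
          have : p ^ 2 * γ k ^ 2 ≤ δ * γ k := by
            have := mul_le_mul_of_nonneg_right (hs.γ_le k) (hγ0 k)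
            linarith
          gcongr
        have h2 : (1 - a₁ * γ k) * A k ≤ (1 - a₁ * γ k) * S :=
          mul_le_mul_of_nonneg_left ihA (by linarith [ha1γ k])
        have h3 : γ k * S * (δ * (6 * K)) ≤ γ k * S * a₁ :=
          mul_le_mul_of_nonneg_left hδK1 (mul_nonneg (hγ0 k) (by linarith))
        have h4 : 0 ≤ γ k * S * a₁ := mul_nonneg (mul_nonneg (hγ0 k) (by linarith)) ha₁.le
        linarith [hAr k]
      · have h1 : K * (p ^ 2 * β k ^ 2) * (1 + A k + B k) ≤ K * (δ * β k) * (3 * S) := by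
          have : p ^ 2 * β k ^ 2 ≤ δ * β k := by
            have := mul_le_mul_of_nonneg_right (hp2β k) (hβ0 k)
            linarith
          gcongr
        have h1' : K * (β k * (β k / γ k) ^ 2) * A k ≤ K * (β k * δ) * S := by
          have := hβ0 k
          have := hκsq k
          gcongr
        have h2 : (1 - a₂ * β k) * B k ≤ (1 - a₂ * β k) * S :=
          mul_le_mul_of_nonneg_left ihB (by linarith [ha2β k])
        have h3 : β k * S * (δ * (6 * K)) ≤ β k * S * a₂ :=
          mul_le_mul_of_nonneg_left hδK2 (mul_nonneg (hβ0 k) (by linarith))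
        have h4 : 0 ≤ K * (β k * δ) * S := by have := hβ0 k; positivity
        linarith [hBr k]
  have hF0 : ∀ k, 0 ≤ ∏ j ∈ Finset.range k, (1 - a₁ * γ j) := fun k =>
    Finset.prod_nonneg fun j _ => by linarith [ha1γ j]
  have hF2 : ∀ k, 0 ≤ ∏ j ∈ Finset.range k, (1 - a₂ * β j) := fun k =>
    Finset.prod_nonneg fun j _ => by linarith [ha2β j]
  have hsumle : ∀ k, 1 + A k + B k ≤ 1 + 2 * S := fun k => by linarith [(hbd k).1, (hbd k).2]
  have hAmain : ∀ k, A k ≤ S * ∏ j ∈ Finset.range k, (1 - a₁ * γ j) + K₂ * (p ^ 2 * γ k) := by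
    intro k
    have h := le_prod_add_of_recursion (s := A) (b := γ) (D := D₁ * p ^ 2) ha₁ (by positivity)
      hδ2' (fun k => by linarith [ha1γ k]) hs.γ_diff hγ0 (fun k => by
        refine (hAr k).trans (add_le_add le_rfl ?_)
        calc K * (p ^ 2 * γ k ^ 2) * (1 + A k + B k) ≤ K * (p ^ 2 * γ k ^ 2) * (1 + 2 * S) :=
              mul_le_mul_of_nonneg_left (hsumle k) (by positivity)
          _ = _ := by rw [hD₁]; ring) k
    have h2 : A 0 * ∏ j ∈ Finset.range k, (1 - a₁ * γ j)
        ≤ S * ∏ j ∈ Finset.range k, (1 - a₁ * γ j) := mul_le_mul_of_nonneg_right hA0 (hF0 k)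
    have h3 : 2 * (D₁ * p ^ 2) / a₁ * γ k = K₂ * (p ^ 2 * γ k) := by rw [hK₂]; ring
    linarith
  -- The transient of A forces B. Adding S times the fast product to B compensates it: that product
  -- decays at rate a₁γ, faster than a₂β, and the surplus a₁γ − a₂β exceeds Kβ(β/γ)² (`h4`).
  have hBmain : ∀ k, B k + S * ∏ j ∈ Finset.range k, (1 - a₁ * γ j)
      ≤ 2 * S * ∏ j ∈ Finset.range k, (1 - a₂ * β j) + K₃ * (p ^ 2 * β k) := by
    intro k
    have h := le_prod_add_of_recursion
      (s := fun k => B k + S * ∏ j ∈ Finset.range k, (1 - a₁ * γ j)) (b := β)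
      (D := D₂ * p ^ 2) ha₂ (by positivity) hδ3' (fun k => by linarith [ha2β k]) hs.β_diff hβ0
      (fun k => by
        simp only [Finset.prod_range_succ]
        set F := ∏ j ∈ Finset.range k, (1 - a₁ * γ j)
        have hFk : 0 ≤ F := hF0 k
        have hβk := hβ0 k
        have hγk := hs.γ_pos k
        have h1 : K * (p ^ 2 * β k ^ 2) * (1 + A k + B k) ≤ K * (p ^ 2 * β k ^ 2) * (1 + 2 * S) :=
          mul_le_mul_of_nonneg_left (hsumle k) (by positivity)
        have h2 : K * (β k * (β k / γ k) ^ 2) * A k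
            ≤ K * (β k * (β k / γ k) ^ 2) * (S * F + K₂ * (p ^ 2 * γ k)) :=
          mul_le_mul_of_nonneg_left (hAmain k) (by positivity)
        -- The stationary level p²γ of A contributes β(β/γ)²·p²γ = p²β²·(β/γ), no more than the slow
        -- scale's own noise. Here the square of the ratio is essential.
        have h3 : K * (β k * (β k / γ k) ^ 2) * (K₂ * (p ^ 2 * γ k))
            ≤ K * K₂ * (p ^ 2 * β k ^ 2) := by
          have e : K * (β k * (β k / γ k) ^ 2) * (K₂ * (p ^ 2 * γ k))
              = K * K₂ * (p ^ 2 * β k ^ 2) * (β k / γ k) := by field_simp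
          rw [e]
          exact mul_le_of_le_one_right (by positivity) ((hκδ k).trans hδ1)
        have h4 : K * (β k * (β k / γ k) ^ 2) * (S * F) ≤ S * F * (a₁ * γ k - a₂ * β k) := by
          have e1 : K * (β k * (β k / γ k) ^ 2) ≤ K * (δ * γ k * 1) := by
            have := hs.β_le k
            have := (hκsq k).trans hδ1
            gcongr
          have e2 : a₂ * β k ≤ a₂ * (δ * γ k) := mul_le_mul_of_nonneg_left (hs.β_le k) ha₂.le
          have e3 : γ k * (δ * (2 * a₂)) ≤ γ k * a₁ := mul_le_mul_of_nonneg_left hδa hγk.le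
          have e4 : γ k * (δ * (6 * K)) ≤ γ k * a₁ := mul_le_mul_of_nonneg_left hδK1 hγk.le
          have e5 : 0 ≤ K * (δ * γ k) := by positivity
          have e6 : K * (β k * (β k / γ k) ^ 2) ≤ a₁ * γ k - a₂ * β k := by linarith
          have e7 : 0 ≤ S * F := by positivity
          calc _ ≤ (a₁ * γ k - a₂ * β k) * (S * F) := mul_le_mul_of_nonneg_right e6 e7
            _ = _ := by ring
        have h5 : D₂ * p ^ 2 * β k ^ 2 = K * K₂ * (p ^ 2 * β k ^ 2)
            + K * (p ^ 2 * β k ^ 2) * (1 + 2 * S) := by rw [hD₂]; ring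
        linarith [hBr k]) k
    simp only [Finset.range_zero, Finset.prod_empty, mul_one] at h
    have h2 : (B 0 + S) * ∏ j ∈ Finset.range k, (1 - a₂ * β j)
        ≤ 2 * S * ∏ j ∈ Finset.range k, (1 - a₂ * β j) :=
      mul_le_mul_of_nonneg_right (by linarith) (hF2 k)
    have h3 : 2 * (D₂ * p ^ 2) / a₂ * β k = K₃ * (p ^ 2 * β k) := by rw [hK₃]; ring
    linarith
  intro k
  have hγk := hγ0 k
  have hβk := hβ0 k
  have hS0 : 0 ≤ S := by linarith
  refine ⟨hbd k, (hAmain k).trans ?_, ?_⟩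
  · have h1 := hF0 k
    have h2 : 0 ≤ p ^ 2 * γ k := by positivity
    have h3 : S * ∏ j ∈ Finset.range k, (1 - a₁ * γ j)
        ≤ (2 * S + K₂ + K₃) * ∏ j ∈ Finset.range k, (1 - a₁ * γ j) :=
      mul_le_mul_of_nonneg_right (by linarith) h1
    have h4 : K₂ * (p ^ 2 * γ k) ≤ (2 * S + K₂ + K₃) * (p ^ 2 * γ k) :=
      mul_le_mul_of_nonneg_right (by linarith) h2
    linarith
  · have h1 := hF2 k
    have h2 : 0 ≤ p ^ 2 * β k := by positivity
    have h3 : 2 * S * ∏ j ∈ Finset.range k, (1 - a₂ * β j)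
        ≤ (2 * S + K₂ + K₃) * ∏ j ∈ Finset.range k, (1 - a₂ * β j) :=
      mul_le_mul_of_nonneg_right (by linarith) h1
    have h4 : K₃ * (p ^ 2 * β k) ≤ (2 * S + K₂ + K₃) * (p ^ 2 * β k) :=
      mul_le_mul_of_nonneg_right (by linarith) h2
    have h5 : 0 ≤ S * ∏ j ∈ Finset.range k, (1 - a₁ * γ j) := mul_nonneg hS0 (hF0 k)
    linarith [hBmain k]

end Sequences

/-! ### Bounded measurable random vectors -/

/-- Bounded random vectors which are measurable with respect to a `σ`-algebra. -/
structure IsBddMeas {Ω E : Type*} [NormedAddCommGroup E] (ℱ : MeasurableSpace Ω) (f : Ω → E) :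
    Prop where
  meas : StronglyMeasurable[ℱ] f
  bdd : ∃ c : ℝ, ∀ ω, ‖f ω‖ ≤ c

namespace IsBddMeas

variable {Ω E : Type*} [NormedAddCommGroup E] {ℱ : MeasurableSpace Ω} {f g : Ω → E}

lemma const (c : E) : IsBddMeas ℱ fun _ : Ω => c := ⟨stronglyMeasurable_const, ‖c‖, fun _ => le_rfl⟩

lemma mono {ℱ' : MeasurableSpace Ω} (hf : IsBddMeas ℱ f) (h : ℱ ≤ ℱ') : IsBddMeas ℱ' f :=
  ⟨hf.meas.mono h, hf.bdd⟩

lemma add (hf : IsBddMeas ℱ f) (hg : IsBddMeas ℱ g) : IsBddMeas ℱ fun ω => f ω + g ω := by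
  obtain ⟨c, hc⟩ := hf.bdd
  obtain ⟨c', hc'⟩ := hg.bdd
  exact ⟨hf.meas.add hg.meas, c + c', fun ω => norm_add_le_of_le (hc ω) (hc' ω)⟩

lemma sub (hf : IsBddMeas ℱ f) (hg : IsBddMeas ℱ g) : IsBddMeas ℱ fun ω => f ω - g ω := by
  obtain ⟨c, hc⟩ := hf.bdd
  obtain ⟨c', hc'⟩ := hg.bdd
  exact ⟨hf.meas.sub hg.meas, c + c', fun ω => norm_sub_le_of_le (hc ω) (hc' ω)⟩

lemma norm (hf : IsBddMeas ℱ f) : IsBddMeas ℱ fun ω => ‖f ω‖ := by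
  obtain ⟨c, hc⟩ := hf.bdd
  exact ⟨hf.meas.norm, c, fun ω => by rw [norm_norm]; exact hc ω⟩

lemma smul [NormedSpace ℝ E] {a : Ω → ℝ} (ha : IsBddMeas ℱ a) (hf : IsBddMeas ℱ f) :
    IsBddMeas ℱ fun ω => a ω • f ω := by
  obtain ⟨c, hc⟩ := hf.bdd
  obtain ⟨c', hc'⟩ := ha.bdd
  refine ⟨ha.meas.smul hf.meas, c' * c, fun ω => ?_⟩
  rw [norm_smul]
  exact mul_le_mul (hc' ω) (hc ω) (norm_nonneg _) ((norm_nonneg _).trans (hc' ω))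

lemma const_smul [NormedSpace ℝ E] (c : ℝ) (hf : IsBddMeas ℱ f) :
    IsBddMeas ℱ fun ω => c • f ω := smul (const c) hf

lemma sum {ι : Type*} (s : Finset ι) {f : ι → Ω → E} (hf : ∀ i, IsBddMeas ℱ (f i)) :
    IsBddMeas ℱ fun ω => ∑ i ∈ s, f i ω := by
  classical
  induction s using Finset.induction_on with
  | empty => simpa using const (0 : E)
  | insert a s ha ih =>
    simp_rw [Finset.sum_insert ha]
    exact (hf a).add ih

lemma clm {F : Type*} [NormedAddCommGroup F] [NormedSpace ℝ E] [NormedSpace ℝ F] (T : E →L[ℝ] F)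
    (hf : IsBddMeas ℱ f) : IsBddMeas ℱ fun ω => T (f ω) := by
  obtain ⟨c, hc⟩ := hf.bdd
  exact ⟨T.continuous.comp_stronglyMeasurable hf.meas, ‖T‖ * c, fun ω =>
    (T.le_opNorm _).trans (mul_le_mul_of_nonneg_left (hc ω) (norm_nonneg _))⟩

lemma act {m n : ℕ} (A : Matrix (Fin m) (Fin n) ℝ) {f : Ω → Vec n} (hf : IsBddMeas ℱ f) :
    IsBddMeas ℱ fun ω => act A (f ω) :=
  hf.clm (LinearMap.toContinuousLinearMap (Matrix.toEuclideanLin A))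

lemma mul {f g : Ω → ℝ} (hf : IsBddMeas ℱ f) (hg : IsBddMeas ℱ g) :
    IsBddMeas ℱ fun ω => f ω * g ω := hf.smul hg

lemma inner {E : Type*} [NormedAddCommGroup E] [InnerProductSpace ℝ E] {f g : Ω → E}
    (hf : IsBddMeas ℱ f) (hg : IsBddMeas ℱ g) : IsBddMeas ℱ fun ω => inner ℝ (f ω) (g ω) := by
  obtain ⟨c, hc⟩ := hf.bdd
  obtain ⟨c', hc'⟩ := hg.bdd
  refine ⟨hf.meas.inner hg.meas, c * c', fun ω => ?_⟩
  exact (abs_real_inner_le_norm _ _).trans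
    (mul_le_mul (hc ω) (hc' ω) (norm_nonneg _) ((norm_nonneg _).trans (hc ω)))

lemma norm_rpow (hf : IsBddMeas ℱ f) {q : ℝ} (hq : 0 ≤ q) :
    IsBddMeas ℱ fun ω => ‖f ω‖ ^ q := by
  obtain ⟨c, hc⟩ := hf.bdd
  refine ⟨(hf.meas.norm.measurable.pow_const q).stronglyMeasurable, c ^ q, fun ω => ?_⟩
  rw [Real.norm_of_nonneg (Real.rpow_nonneg (norm_nonneg _) _)]
  exact Real.rpow_le_rpow (norm_nonneg _) (hc ω) hq

lemma memLp [mΩ : MeasurableSpace Ω] {μ : Measure Ω} [IsFiniteMeasure μ] {f : Ω → E}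
    (hf : IsBddMeas mΩ f) (p : ℝ≥0∞) : MemLp f p μ := by
  obtain ⟨c, hc⟩ := hf.bdd
  exact MemLp.of_bound hf.meas.aestronglyMeasurable c (Filter.Eventually.of_forall hc)

lemma integrable [mΩ : MeasurableSpace Ω] {μ : Measure Ω} [IsFiniteMeasure μ] {f : Ω → E}
    (hf : IsBddMeas mΩ f) : Integrable f μ := by
  obtain ⟨c, hc⟩ := hf.bdd
  exact Integrable.of_bound hf.meas.aestronglyMeasurable c (Filter.Eventually.of_forall hc)

end IsBddMeas

/-! ### One contracting step with centred noise in `L^p` -/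

section Step

lemma lpNorm_const_mul_norm {Ω E : Type*} [mΩ : MeasurableSpace Ω] {μ : Measure Ω}
    [NormedAddCommGroup E] {c : ℝ} (hc : 0 ≤ c) {f : Ω → E}
    (hf : IsBddMeas mΩ f) {p : ℝ≥0∞} :
    lpNorm (fun ω => c * ‖f ω‖) p μ = c * lpNorm f p μ := by
  have h := lpNorm_const_smul (p := p) c (fun ω => ‖f ω‖) μ
  rw [lpNorm_norm hf.meas.aestronglyMeasurable, coe_nnnorm, Real.norm_of_nonneg hc] at h
  exact h

variable {Ω : Type*} [mΩ : MeasurableSpace Ω] {μ : Measure Ω} [IsProbabilityMeasure μ]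

/-- Young's inequality with weights s/2 and 2/s. The product (1 + s/2)(1 − s)² leaves enough room
below 1 − s/2 for the term (5/64)s x² created by the error s x/8. The free error costs ε²/s, so one
power of the step is lost there. -/
lemma sq_add_le_of_contraction {s x y e c ε : ℝ} (hs0 : 0 < s) (hs : s ≤ 1 / 2)
    (he : 0 ≤ e) (hc : 0 ≤ c) (hyx : y ^ 2 ≤ ((1 - s) * x) ^ 2 + c)
    (hex : e ≤ s / 8 * x + ε) :
    (y + e) ^ 2 ≤ (1 - s / 2) * x ^ 2 + 2 * c + 5 / s * ε ^ 2 := by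
  have h1 : (y + e) ^ 2 ≤ (1 + s / 2) * y ^ 2 + (1 + 2 / s) * e ^ 2 := by
    have : 0 ≤ (s * y - 2 * e) ^ 2 / (2 * s) := by positivity
    have e1 : (s * y - 2 * e) ^ 2 / (2 * s) = s / 2 * y ^ 2 - 2 * y * e + 2 / s * e ^ 2 := by
      field_simp; ring
    nlinarith
  have h2 : e ^ 2 ≤ 2 * (s / 8 * x) ^ 2 + 2 * ε ^ 2 := by
    have : e ^ 2 ≤ (s / 8 * x + ε) ^ 2 := by gcongr
    nlinarith [sq_nonneg (s / 8 * x - ε)]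
  have h3 : 1 + 2 / s ≤ 5 / 2 / s := by
    rw [add_div' _ _ _ hs0.ne', div_le_div_iff_of_pos_right hs0]; linarith
  have h4 : (1 + 2 / s) * e ^ 2 ≤ 5 / 2 / s * (2 * (s / 8 * x) ^ 2 + 2 * ε ^ 2) := by
    gcongr
  have h5 : 5 / 2 / s * (2 * (s / 8 * x) ^ 2 + 2 * ε ^ 2) = 5 / 64 * s * x ^ 2 + 5 / s * ε ^ 2 := by
    field_simp; ring
  have h6 : (1 + s / 2) * y ^ 2 ≤ (1 + s / 2) * (((1 - s) * x) ^ 2 + c) := by gcongr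
  have h7 : 0 ≤ s * c := by positivity
  have h8 : s * x ^ 2 * s ≤ s * x ^ 2 * (1 / 2) := by gcongr
  have h9 : 0 ≤ s * x ^ 2 := by positivity
  have h10 : 0 ≤ s * x ^ 2 * s := by positivity
  have h11 : s * x ^ 2 * s * s ≤ s * x ^ 2 * s * (1 / 2) := by gcongr
  have h12 : s * c ≤ 1 / 2 * c := by gcongr
  nlinarith

lemma lpNorm_le_of_norm_le {E F₁ F₂ F₃ : Type*} [NormedAddCommGroup E] [NormedAddCommGroup F₁]
    [NormedAddCommGroup F₂] [NormedAddCommGroup F₃] {f : Ω → E} {g₁ : Ω → F₁} {g₂ : Ω → F₂}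
    {g₃ : Ω → F₃} {c₁ c₂ c₃ : ℝ} (h₁ : 0 ≤ c₁) (h₂ : 0 ≤ c₂) (h₃ : 0 ≤ c₃)
    (hg₁ : IsBddMeas mΩ g₁) (hg₂ : IsBddMeas mΩ g₂) (hg₃ : IsBddMeas mΩ g₃) {p : ℝ≥0∞}
    (hp : 1 ≤ p) (h : ∀ ω, ‖f ω‖ ≤ c₁ * ‖g₁ ω‖ + c₂ * ‖g₂ ω‖ + c₃ * ‖g₃ ω‖) :
    lpNorm f p μ ≤ c₁ * lpNorm g₁ p μ + c₂ * lpNorm g₂ p μ + c₃ * lpNorm g₃ p μ := by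
  have i₁ := hg₁.norm.const_smul c₁
  have i₂ := hg₂.norm.const_smul c₂
  have i₃ := hg₃.norm.const_smul c₃
  rw [← lpNorm_const_mul_norm h₁ hg₁, ← lpNorm_const_mul_norm h₂ hg₂,
    ← lpNorm_const_mul_norm h₃ hg₃]
  refine (lpNorm_mono_real (((i₁.add i₂).add i₃).memLp p) h).trans ?_
  exact (lpNorm_add_le ((i₁.add i₂).memLp p) hp).trans
    (add_le_add (lpNorm_add_le (i₁.memLp p) hp) le_rfl)

/-- One step of an approximately contracting recursion with centred increments, in `L^p`. -/
lemma lpNorm_step_sq_le {d : ℕ} {J A : Matrix (Fin d) (Fin d) ℝ} {s t : ℝ} (hs0 : 0 < s)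
    (hs : s ≤ 1 / 2)
    (hcon : ∀ x, ‖act J (x - t • act A x)‖ ≤ (1 - s) * ‖act J x‖) {p : ℝ} (hp : 2 ≤ p)
    {Y Y' D e : Ω → Vec d} (hY : IsBddMeas mΩ Y) (hD : IsBddMeas mΩ D)
    (hY' : ∀ ω, Y' ω = Y ω - t • act A (Y ω) + D ω + e ω)
    (h0 : ∫ ω, ‖act J (Y ω - t • act A (Y ω))‖ ^ (p - 2)
      * inner ℝ (act J (Y ω - t • act A (Y ω))) (act J (D ω)) ∂μ = 0) {ε : ℝ}
    (hε : lpNorm (fun ω => act J (e ω)) (ENNReal.ofReal p) μ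
      ≤ s / 8 * lpNorm (fun ω => act J (Y ω)) (ENNReal.ofReal p) μ + ε) :
    lpNorm (fun ω => act J (Y' ω)) (ENNReal.ofReal p) μ ^ 2
      ≤ (1 - s / 2) * lpNorm (fun ω => act J (Y ω)) (ENNReal.ofReal p) μ ^ 2
        + 2 * (27 * p ^ 2 * lpNorm (fun ω => act J (D ω)) (ENNReal.ofReal p) μ ^ 2)
        + 5 / s * ε ^ 2 := by
  have hp1 : 1 ≤ ENNReal.ofReal p := ENNReal.one_le_ofReal.mpr (by linarith)
  have hZ : IsBddMeas mΩ fun ω => act J (Y ω - t • act A (Y ω)) :=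
    (hY.sub ((hY.act A).const_smul t)).act J
  obtain ⟨cZ, hcZ⟩ := hZ.bdd
  obtain ⟨cD, hcD⟩ := (hD.act J).bdd
  have h1 := lpNorm_add_sq_le (μ := μ) hp hZ.meas (hD.act J).meas hcZ hcD h0
  have h2 : lpNorm (fun ω => act J (Y' ω)) (ENNReal.ofReal p) μ
      ≤ lpNorm (fun ω => act J (Y ω - t • act A (Y ω)) + act J (D ω)) (ENNReal.ofReal p) μ
        + lpNorm (fun ω => act J (e ω)) (ENNReal.ofReal p) μ := by
    have e1 : (fun ω => act J (Y' ω))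
        = (fun ω => act J (Y ω - t • act A (Y ω)) + act J (D ω)) + fun ω => act J (e ω) := by
      funext ω
      simp only [Pi.add_apply]
      rw [hY', act_add, act_add]
    rw [e1]
    exact lpNorm_add_le ((hZ.add (hD.act J)).memLp _) hp1
  have h3 : lpNorm (fun ω => act J (Y ω - t • act A (Y ω))) (ENNReal.ofReal p) μ
      ≤ (1 - s) * lpNorm (fun ω => act J (Y ω)) (ENNReal.ofReal p) μ := by
    refine (lpNorm_mono_real (((hY.act J).norm.const_smul _).memLp _) fun ω => hcon _).trans ?_
    exact (lpNorm_const_mul_norm (by linarith) (hY.act J)).le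
  have h4 := sq_add_le_of_contraction hs0 hs
    (lpNorm_nonneg (f := fun ω => act J (e ω)) (p := ENNReal.ofReal p) (μ := μ))
    (by positivity) (h1.trans (add_le_add (pow_le_pow_left₀ lpNorm_nonneg h3 2) le_rfl)) hε
  exact (pow_le_pow_left₀ lpNorm_nonneg h2 2).trans h4

variable {S : Type*} [MeasurableSpace S]

/-- Orthogonality of Poisson martingale increments to the past, in the form used for `L^p`
estimates. -/
lemma IsMarkovChain.integral_rpow_inner_eq_zero {P : Kernel S S} [IsMarkovKernel P]
    {X : ℕ → Ω → S} (hX : IsMarkovChain μ P X) {k : ℕ} (hk : 1 ≤ k) {d : ℕ} {ι : Type*} [Fintype ι]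
    {f : ι → S → ℝ} (hf : ∀ i, Measurable (f i)) {c : ℝ} (hc : ∀ i x, |f i x| ≤ c)
    {J : Matrix (Fin d) (Fin d) ℝ} {Z : Ω → Vec d} {V : ι → Ω → Vec d}
    (hZ : IsBddMeas (pastSigma X k) Z) (hV : ∀ i, IsBddMeas (pastSigma X k) (V i)) {q : ℝ}
    (hq : 0 ≤ q) :
    ∫ ω, ‖Z ω‖ ^ q * inner ℝ (Z ω)
      (act J (∑ i, (f i (X (k + 1) ω) - ∫ y, f i y ∂(P (X k ω))) • V i ω)) ∂μ = 0 := by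
  have hle := pastSigma_le hX.measurable k
  have hψ : ∀ i, IsBddMeas (pastSigma X k)
      fun ω => ‖Z ω‖ ^ q * inner ℝ (Z ω) (act J (V i ω)) := fun i =>
    (hZ.norm_rpow hq).mul (hZ.inner ((hV i).act J))
  have e1 : ∀ ω, ‖Z ω‖ ^ q * inner ℝ (Z ω)
      (act J (∑ i, (f i (X (k + 1) ω) - ∫ y, f i y ∂(P (X k ω))) • V i ω))
      = ∑ i, (‖Z ω‖ ^ q * inner ℝ (Z ω) (act J (V i ω)))
        * (f i (X (k + 1) ω) - ∫ y, f i y ∂(P (X k ω))) := by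
    intro ω
    rw [act_sum, inner_sum, Finset.mul_sum]
    refine Finset.sum_congr rfl fun i _ => ?_
    rw [act_smul, inner_smul_right]
    ring
  simp_rw [e1]
  rw [integral_finsetSum]
  · refine Finset.sum_eq_zero fun i _ => ?_
    obtain ⟨c', hc'⟩ := (hψ i).bdd
    exact hX.integral_mul_sub_eq_zero hk (hf i) (hc i) (hψ i).meas.measurable hc'
  · intro i _
    have hPf : Measurable fun x => ∫ y, f i y ∂(P x) :=
      ((hf i).stronglyMeasurable.integral_kernel).measurable
    refine IsBddMeas.integrable (((hψ i).mono hle).mul (IsBddMeas.sub ⟨?_, c, fun ω => hc i _⟩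
      ⟨?_, c, fun ω => abs_integral_kernel_le (hc i) _⟩))
    · exact ((hf i).comp (hX.measurable _)).stronglyMeasurable
    · exact (hPf.comp (hX.measurable _)).stronglyMeasurable

end Step

/-! ### Algebra of the decoupled recursions -/

section Recursion

variable {m n : ℕ}

/-- The slope of the affine change of variables `w ↦ w + A₂₂⁻¹ A₂₁ θ`. -/
noncomputable def Coeffs.G (M : Coeffs m n) : Matrix (Fin n) (Fin m) ℝ := M.A22⁻¹ * M.A21

/-- The matrix `A₁₂ A₂₂⁻¹`. -/
noncomputable def Coeffs.H (M : Coeffs m n) : Matrix (Fin m) (Fin n) ℝ := M.A12 * M.A22⁻¹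

lemma Coeffs.A22_mul_G {M : Coeffs m n} (h : IsUnit M.A22) : M.A22 * M.G = M.A21 := by
  rw [Coeffs.G, ← Matrix.mul_assoc,
    Matrix.mul_nonsing_inv _ ((Matrix.isUnit_iff_isUnit_det _).mp h), Matrix.one_mul]

lemma Coeffs.H_mul_A22 {M : Coeffs m n} (h : IsUnit M.A22) : M.H * M.A22 = M.A12 := by
  rw [Coeffs.H, Matrix.mul_assoc,
    Matrix.nonsing_inv_mul _ ((Matrix.isUnit_iff_isUnit_det _).mp h), Matrix.mul_one]

lemma Coeffs.U_eq (M : Coeffs m n) (L : Matrix (Fin n) (Fin m) ℝ) :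
    M.U L = M.A11 - M.A12 * (L + M.G) := by
  rw [Coeffs.U, Coeffs.schur, Coeffs.G, Matrix.mul_add, Matrix.mul_assoc]
  abel

/-- Subtract the equation of the fixed point and express w − w⋆ through the decoupled error: the
matrix acting on θ̃ becomes A₁₁ − A₁₂(L + A₂₂⁻¹A₂₁) = U. -/
lemma theta_step {M : Coeffs m n} {θs : Vec m} {ws : Vec n} (hsol : M.IsSolution θs ws)
    (L : Matrix (Fin n) (Fin m) ℝ) (β : ℝ) {θ θ' n₁ : Vec m} {w : Vec n}
    (hθ : θ' = θ + β • (M.b1 - act M.A11 θ - act M.A12 w + n₁)) :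
    θ' - θs = (θ - θs) - β • act (M.U L) (θ - θs)
      - β • act M.A12 (w - ws + act (L + M.G) (θ - θs)) + β • n₁ := by
  rw [hθ, ← hsol.1, M.U_eq, act_sub_left, act_mul, act_add M.A12 (w - ws)]
  simp only [act_sub]
  module

/-- The hypothesis `hL` is precisely the vanishing of the θ̃-coefficient in the new decoupled error,
so only w̃ and noise remain on the right. -/
lemma w_step {M : Coeffs m n} (hM : IsUnit M.A22) {θs : Vec m} {ws : Vec n}
    (hsol : M.IsSolution θs ws) {L L' : Matrix (Fin n) (Fin m) ℝ} {β γ : ℝ}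
    (hL : L' * (1 - β • M.U L) = L - γ • (M.A22 * L) + β • (M.G * M.U L))
    {θ θ' n₁ : Vec m} {w w' n₂ : Vec n}
    (hθ : θ' = θ + β • (M.b1 - act M.A11 θ - act M.A12 w + n₁))
    (hw : w' = w + γ • (M.b2 - act M.A21 θ - act M.A22 w + n₂)) :
    w' - ws + act (L' + M.G) (θ' - θs) = (w - ws + act (L + M.G) (θ - θs))
      - γ • act M.A22 (w - ws + act (L + M.G) (θ - θs))
      - β • act (L' + M.G) (act M.A12 (w - ws + act (L + M.G) (θ - θs)))
      + (γ • n₂ + β • act (L' + M.G) n₁) := by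
  rw [theta_step hsol L β hθ, hw, ← hsol.2]
  set Θ := θ - θs with hΘ
  set W := w - ws + act (L + M.G) Θ with hW
  have hL' := congrArg (fun A => act A Θ) hL
  simp only [Matrix.mul_sub, Matrix.mul_one, Matrix.mul_smul, act_sub_left, act_add_left,
    act_smul_left, act_mul] at hL'
  have hw0 : w = W + ws - act L Θ - act M.G Θ := by
    rw [hW, act_add_left]; abel
  have hθ0 : θ = Θ + θs := by rw [hΘ]; abel
  have hG : act M.A22 (act M.G Θ) = act M.A21 Θ := by rw [← act_mul, M.A22_mul_G hM]
  rw [hw0, hθ0]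
  simp only [act_add_left, act_add, act_sub, act_smul, hG]
  linear_combination (norm := module) hL'

/-- As κγ = β, the contribution κH·γA₂₂w̃ equals βA₁₂w̃ and cancels the slow coupling. Every
surviving w̃-term carries βκ, κ'β or the increment κ − κ'. -/
lemma z_step {M : Coeffs m n} (hM : IsUnit M.A22) {L L' : Matrix (Fin n) (Fin m) ℝ}
    {β γ κ κ' : ℝ} (hκ : κ * γ = β) {Θ Θ' n₁ : Vec m} {W W' n₂ : Vec n}
    (hΘ : Θ' = Θ - β • act (M.U L) Θ - β • act M.A12 W + β • n₁)
    (hW : W' = W - γ • act M.A22 W - β • act (L' + M.G) (act M.A12 W)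
      + (γ • n₂ + β • act (L' + M.G) n₁)) :
    Θ' - κ' • act M.H W' = (Θ - κ • act M.H W) - β • act M.schur (Θ - κ • act M.H W)
      + (β • act M.A12 (act L (Θ - κ • act M.H W))
        + ((κ - κ') • (act M.H W - γ • act M.A12 W) - (β * κ) • act (M.U L) (act M.H W)
          + (κ' * β) • act M.H (act (L' + M.G) (act M.A12 W))))
      + (β • n₁ - κ' • act M.H (γ • n₂ + β • act (L' + M.G) n₁)) := by
  subst hκ
  have hA : act M.H (act M.A22 W) = act M.A12 W := by rw [← act_mul, M.H_mul_A22 hM]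
  rw [hΘ, hW]
  simp only [Coeffs.U, act_add_left, act_sub_left, act_mul, act_add, act_sub, act_smul, hA]
  module

/-- The random coefficients as the entries of one matrix acting on `(1, θ, w)`. -/
def coef (A : Coeffs m n) : Fin m ⊕ Fin n → Option (Fin m ⊕ Fin n) → ℝ
  | .inl i, none => A.b1 i
  | .inl i, some (.inl j) => -A.A11 i j
  | .inl i, some (.inr j) => -A.A12 i j
  | .inr i, none => A.b2 i
  | .inr i, some (.inl j) => -A.A21 i j
  | .inr i, some (.inr j) => -A.A22 i j

/-- The vector `(1, θ, w)`. -/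
def extend (θ : Vec m) (w : Vec n) : Option (Fin m ⊕ Fin n) → ℝ
  | none => 1
  | some (.inl j) => θ j
  | some (.inr j) => w j

/-- The standard basis of the slow component. -/
noncomputable def basisTheta : Fin m ⊕ Fin n → Vec m
  | .inl i => EuclideanSpace.single i 1
  | .inr _ => 0

/-- The standard basis of the fast component. -/
noncomputable def basisW : Fin m ⊕ Fin n → Vec n
  | .inl _ => 0
  | .inr i => EuclideanSpace.single i 1

lemma norm_basisTheta_le (i : Fin m ⊕ Fin n) : ‖basisTheta i‖ ≤ 1 := by
  cases i <;> simp [basisTheta]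

lemma norm_basisW_le (i : Fin m ⊕ Fin n) : ‖basisW i‖ ≤ 1 := by
  cases i <;> simp [basisW]

lemma act_apply (A : Matrix (Fin m) (Fin n) ℝ) (x : Vec n) (i : Fin m) :
    act A x i = ∑ j, A i j * x j := by
  simp [act, Matrix.toLpLin_apply, Matrix.mulVec, dotProduct]

/-- The noise vector attached to a matrix `f` of noise coefficients and to the images `R` of the
basis vectors. -/
noncomputable def noise {d : ℕ} (f : (Fin m ⊕ Fin n) × Option (Fin m ⊕ Fin n) → ℝ)
    (s : Option (Fin m ⊕ Fin n) → ℝ) (R : Fin m ⊕ Fin n → Vec d) : Vec d :=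
  ∑ ij, f ij • (s ij.2 • R ij.1)

lemma noise_coef_basisTheta (A : Coeffs m n) (θ : Vec m) (w : Vec n) :
    noise (fun ij => coef A ij.1 ij.2) (extend θ w) basisTheta
      = A.b1 - act A.A11 θ - act A.A12 w := by
  ext i
  simp only [noise, Fintype.sum_prod_type, Fintype.sum_sum_type, Fintype.sum_option, coef, extend,
    basisTheta, smul_zero, Finset.sum_const_zero, add_zero, PiLp.sub_apply, act_apply]
  simp [Finset.sum_add_distrib, Pi.single_apply]
  ring

lemma noise_coef_basisW (A : Coeffs m n) (θ : Vec m) (w : Vec n) :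
    noise (fun ij => coef A ij.1 ij.2) (extend θ w) basisW
      = A.b2 - act A.A21 θ - act A.A22 w := by
  ext i
  simp only [noise, Fintype.sum_prod_type, Fintype.sum_sum_type, Fintype.sum_option, coef, extend,
    basisW, smul_zero, Finset.sum_const_zero, zero_add, PiLp.sub_apply, act_apply]
  simp [Finset.sum_add_distrib, Pi.single_apply]
  ring

/-- The deviation of the random coefficients from their mean. -/
def dev (M : Coeffs m n) {S : Type*} (F : S → Coeffs m n)
    (ij : (Fin m ⊕ Fin n) × Option (Fin m ⊕ Fin n)) (x : S) : ℝ :=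
  coef (F x) ij.1 ij.2 - coef M ij.1 ij.2

lemma noise_sub {d : ℕ} (f f' : (Fin m ⊕ Fin n) × Option (Fin m ⊕ Fin n) → ℝ)
    (s : Option (Fin m ⊕ Fin n) → ℝ) (R : Fin m ⊕ Fin n → Vec d) :
    noise (fun ij => f ij - f' ij) s R = noise f s R - noise f' s R := by
  simp only [noise, sub_smul, Finset.sum_sub_distrib]

/-- The noise vector is linear in its directions. Hence both decoupled recursions are driven by the
same scalar functions, and one Poisson equation per matrix or vector entry serves both time scales.
-/
lemma noise_add_smul_act {d d' : ℕ} (f : (Fin m ⊕ Fin n) × Option (Fin m ⊕ Fin n) → ℝ)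
    (s : Option (Fin m ⊕ Fin n) → ℝ) (R : Fin m ⊕ Fin n → Vec d) (R' : Fin m ⊕ Fin n → Vec d')
    (a b : ℝ) (T : Matrix (Fin d) (Fin d') ℝ) :
    noise f s (fun i => a • R i + b • act T (R' i))
      = a • noise f s R + b • act T (noise f s R') := by
  simp only [noise, act_sum, Finset.smul_sum, ← Finset.sum_add_distrib]
  refine Finset.sum_congr rfl fun ij _ => ?_
  simp only [act_smul]
  module

section Path

variable {S : Type*} (M : Coeffs m n) (F : S → Coeffs m n) (β γ : ℕ → ℝ) (θ₀ : Vec m) (w₀ : Vec n)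
  (θs : Vec m) (ws : Vec n) (x : ℕ → S)

/-- The error `θ_k - θ⋆`. -/
noncomputable def errTheta (k : ℕ) : Vec m := (iter F β γ θ₀ w₀ x k).1 - θs

/-- The decoupled error `w_k - w⋆ + (L_k + A₂₂⁻¹ A₂₁) (θ_k - θ⋆)`. -/
noncomputable def errW (k : ℕ) : Vec n :=
  (iter F β γ θ₀ w₀ x k).2 - ws + act (M.L β γ k + M.G) (errTheta F β γ θ₀ w₀ θs x k)

/-- The slow error corrected by the fast one, `θ̃_k - (β_k / γ_k) A₁₂ A₂₂⁻¹ w̃_k`. -/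
noncomputable def errZ (k : ℕ) : Vec m :=
  errTheta F β γ θ₀ w₀ θs x k - (β k / γ k) • act M.H (errW M F β γ θ₀ w₀ θs ws x k)

/-- The vector `(1, θ_k, w_k)`. -/
noncomputable def extState (k : ℕ) : Option (Fin m ⊕ Fin n) → ℝ :=
  extend (iter F β γ θ₀ w₀ x k).1 (iter F β γ θ₀ w₀ x k).2

/-- Noise directions in the recursion of `errW`. -/
noncomputable def dirW (k : ℕ) (i : Fin m ⊕ Fin n) : Vec n :=
  γ k • basisW i + β k • act (M.L β γ (k + 1) + M.G) (basisTheta i)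

/-- Noise directions in the recursion of `errZ`. -/
noncomputable def dirZ (k : ℕ) (i : Fin m ⊕ Fin n) : Vec m :=
  β k • basisTheta i + (-(β (k + 1) / γ (k + 1))) • act M.H (dirW M β γ k i)

lemma iter_succ_fst (k : ℕ) : (iter F β γ θ₀ w₀ x (k + 1)).1 = (iter F β γ θ₀ w₀ x k).1
    + β k • (M.b1 - act M.A11 (iter F β γ θ₀ w₀ x k).1 - act M.A12 (iter F β γ θ₀ w₀ x k).2
      + noise (fun ij => dev M F ij (x (k + 1))) (extState F β γ θ₀ w₀ x k) basisTheta) := by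
  simp only [dev, extState]
  rw [noise_sub, noise_coef_basisTheta, noise_coef_basisTheta, iter]
  simp only
  congr 2
  abel

lemma iter_succ_snd (k : ℕ) : (iter F β γ θ₀ w₀ x (k + 1)).2 = (iter F β γ θ₀ w₀ x k).2
    + γ k • (M.b2 - act M.A21 (iter F β γ θ₀ w₀ x k).1 - act M.A22 (iter F β γ θ₀ w₀ x k).2
      + noise (fun ij => dev M F ij (x (k + 1))) (extState F β γ θ₀ w₀ x k) basisW) := by
  simp only [dev, extState]
  rw [noise_sub, noise_coef_basisW, noise_coef_basisW, iter]
  simp only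
  congr 2
  abel

variable {M θs ws} {β γ}

lemma errW_succ (hM : IsUnit M.A22) (hsol : M.IsSolution θs ws) {k : ℕ}
    (hL : M.L β γ (k + 1) * (1 - β k • M.U (M.L β γ k)) = M.L β γ k - γ k • (M.A22 * M.L β γ k)
      + β k • (M.G * M.U (M.L β γ k))) :
    errW M F β γ θ₀ w₀ θs ws x (k + 1) = errW M F β γ θ₀ w₀ θs ws x k
      - γ k • act M.A22 (errW M F β γ θ₀ w₀ θs ws x k)
      - β k • act (M.L β γ (k + 1) + M.G) (act M.A12 (errW M F β γ θ₀ w₀ θs ws x k))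
      + noise (fun ij => dev M F ij (x (k + 1))) (extState F β γ θ₀ w₀ x k) (dirW M β γ k) := by
  have h := w_step hM hsol hL (iter_succ_fst M F β γ θ₀ w₀ x k) (iter_succ_snd M F β γ θ₀ w₀ x k)
  have e : noise (fun ij => dev M F ij (x (k + 1))) (extState F β γ θ₀ w₀ x k) (dirW M β γ k)
    = _ := noise_add_smul_act _ _ basisW basisTheta _ _ _
  rw [e]
  exact h

lemma errZ_succ (hM : IsUnit M.A22) (hsol : M.IsSolution θs ws) {k : ℕ} (hγ : γ k ≠ 0)
    (hL : M.L β γ (k + 1) * (1 - β k • M.U (M.L β γ k)) = M.L β γ k - γ k • (M.A22 * M.L β γ k)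
      + β k • (M.G * M.U (M.L β γ k))) :
    errZ M F β γ θ₀ w₀ θs ws x (k + 1) = errZ M F β γ θ₀ w₀ θs ws x k
      - β k • act M.schur (errZ M F β γ θ₀ w₀ θs ws x k)
      + (β k • act M.A12 (act (M.L β γ k) (errZ M F β γ θ₀ w₀ θs ws x k))
        + ((β k / γ k - β (k + 1) / γ (k + 1)) • (act M.H (errW M F β γ θ₀ w₀ θs ws x k)
            - γ k • act M.A12 (errW M F β γ θ₀ w₀ θs ws x k))
          - (β k * (β k / γ k)) • act (M.U (M.L β γ k))
            (act M.H (errW M F β γ θ₀ w₀ θs ws x k))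
          + (β (k + 1) / γ (k + 1) * β k) • act M.H (act (M.L β γ (k + 1) + M.G)
            (act M.A12 (errW M F β γ θ₀ w₀ θs ws x k)))))
      + noise (fun ij => dev M F ij (x (k + 1))) (extState F β γ θ₀ w₀ x k) (dirZ M β γ k) := by
  have h1 := theta_step hsol (M.L β γ k) (β k) (iter_succ_fst M F β γ θ₀ w₀ x k)
  have h2 := w_step hM hsol hL (iter_succ_fst M F β γ θ₀ w₀ x k) (iter_succ_snd M F β γ θ₀ w₀ x k)
  have h := z_step hM (κ := β k / γ k) (κ' := β (k + 1) / γ (k + 1)) (div_mul_cancel₀ _ hγ) h1 h2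
  have e : noise (fun ij => dev M F ij (x (k + 1))) (extState F β γ θ₀ w₀ x k) (dirZ M β γ k)
    = _ := noise_add_smul_act _ _ basisTheta (dirW M β γ k) _ _ _
  have e' : noise (fun ij => dev M F ij (x (k + 1))) (extState F β γ θ₀ w₀ x k) (dirW M β γ k)
    = _ := noise_add_smul_act _ _ basisW basisTheta _ _ _
  rw [e, e', neg_smul, ← sub_eq_add_neg]
  exact h

end Path

end Recursion

/-! ### Uniform bounds for the decoupling matrices -/

/-- Bounds on the decoupling matrices. -/
structure StepBounds {m n : ℕ} (M : Coeffs m n) (B ε : ℝ) (β γ : ℕ → ℝ) : Prop where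
  L_le : ∀ k, ‖M.L β γ k‖ ≤ ε
  LG_le : ∀ k, ‖M.L β γ k + M.G‖ ≤ B
  U_le : ∀ k, ‖M.U (M.L β γ k)‖ ≤ B
  L_diff : ∀ k, ‖M.L β γ (k + 1) - M.L β γ k‖ ≤ B * γ k
  L_rec : ∀ k, M.L β γ (k + 1) * (1 - β k • M.U (M.L β γ k)) = M.L β γ k
    - γ k • (M.A22 * M.L β γ k) + β k • (M.G * M.U (M.L β γ k))
  isUnit : ∀ k, IsUnit (1 - β k • M.U (M.L β γ k))

lemma StepBounds.mono {m n : ℕ} {M : Coeffs m n} {B B' ε : ℝ} {β γ : ℕ → ℝ}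
    (h : StepBounds M B ε β γ) (hB : B ≤ B') (hγ : ∀ k, 0 ≤ γ k) : StepBounds M B' ε β γ :=
  ⟨h.L_le, fun k => (h.LG_le k).trans hB, fun k => (h.U_le k).trans hB,
    fun k => (h.L_diff k).trans (mul_le_mul_of_nonneg_right hB (hγ k)), h.L_rec, h.isUnit⟩

/-- The constant B precedes ε, so that ε can later be taken small relative to powers of B. The
increment bound comes from L_{k+1} − L_k = β_k(G + L_{k+1})U_k − γ_kA₂₂L_k and β_k ≤ γ_k. -/
lemma exists_stepBounds {m n : ℕ} [NeZero n] (M : Coeffs m n) {Q : Matrix (Fin n) (Fin n) ℝ}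
    (hQ : IsLyapunov M.A22 Q) :
    ∃ B : ℝ, 1 ≤ B ∧ ∀ ε : ℝ, 0 < ε → ε ≤ 1 → ∃ δ : ℝ, 0 < δ ∧ δ ≤ 1 ∧
      ∀ (p : ℝ) (β γ : ℕ → ℝ), 2 ≤ p → StepCond δ p β γ → StepBounds M B ε β γ := by
  set u := ‖M.schur‖ + ‖M.A12‖ with hu
  have hu0 : 0 ≤ u := by positivity
  refine ⟨1 + ‖M.G‖ + u + (‖M.A22‖ + ‖M.G‖ * u + u), ?_, fun ε hε hε1 => ?_⟩
  · have : 0 ≤ ‖M.G‖ + u + (‖M.A22‖ + ‖M.G‖ * u + u) := by positivity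
    linarith
  obtain ⟨δ, hδ0, hδ1, hL⟩ := exists_norm_L_le M hQ hε
  refine ⟨δ, hδ0, hδ1, fun p β γ hp hs => ?_⟩
  have hLk := fun k => (hL p β γ hp hs k).1
  have hUk : ∀ k, ‖M.U (M.L β γ k)‖ ≤ u := fun k => by
    calc ‖M.U (M.L β γ k)‖ ≤ ‖M.schur‖ + ‖M.A12 * M.L β γ k‖ := norm_sub_le _ _
      _ ≤ ‖M.schur‖ + ‖M.A12‖ * 1 := by
        gcongr
        exact (Matrix.l2_opNorm_mul _ _).trans
          (mul_le_mul_of_nonneg_left ((hLk k).trans hε1) (norm_nonneg _))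
      _ = u := by rw [mul_one]
  have hunit : ∀ k, IsUnit (1 - β k • M.U (M.L β γ k)) := fun k => by
    refine isUnit_one_sub_of_norm_lt_one ?_
    rw [norm_smul, Real.norm_of_nonneg (hs.β_pos k).le]
    linarith [(hL p β γ hp hs k).2]
  have hrec : ∀ k, M.L β γ (k + 1) * (1 - β k • M.U (M.L β γ k)) = M.L β γ k
      - γ k • (M.A22 * M.L β γ k) + β k • (M.G * M.U (M.L β γ k)) := fun k => by
    rw [Coeffs.L, Matrix.mul_assoc, Matrix.nonsing_inv_mul _
      ((Matrix.isUnit_iff_isUnit_det _).mp (hunit k)), Matrix.mul_one, Coeffs.G]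
  have h0 : 0 ≤ ‖M.A22‖ + ‖M.G‖ * u + u := by positivity
  refine ⟨hLk, fun k => ?_, fun k => (hUk k).trans ?_, fun k => ?_, hrec, hunit⟩
  · refine (norm_add_le _ _).trans ?_
    linarith [hLk k]
  · linarith [norm_nonneg M.G]
  · have hβγ : β k ≤ γ k := (hs.β_le k).trans (by nlinarith [hs.γ_pos k])
    have hγ := (hs.γ_pos k).le
    have hβ := (hs.β_pos k).le
    have e : M.L β γ (k + 1) - M.L β γ k = β k • (M.G * M.U (M.L β γ k))
        + β k • (M.L β γ (k + 1) * M.U (M.L β γ k)) - γ k • (M.A22 * M.L β γ k) := by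
      have := hrec k
      rw [Matrix.mul_sub, Matrix.mul_one, Matrix.mul_smul] at this
      linear_combination (norm := module) this
    have h1 : ‖M.G * M.U (M.L β γ k)‖ ≤ ‖M.G‖ * u := (Matrix.l2_opNorm_mul _ _).trans
      (mul_le_mul_of_nonneg_left (hUk k) (norm_nonneg _))
    have h2 : ‖M.L β γ (k + 1) * M.U (M.L β γ k)‖ ≤ 1 * u := (Matrix.l2_opNorm_mul _ _).trans
      (mul_le_mul ((hLk _).trans hε1) (hUk k) (norm_nonneg _) zero_le_one)
    have h3 : ‖M.A22 * M.L β γ k‖ ≤ ‖M.A22‖ * 1 := (Matrix.l2_opNorm_mul _ _).trans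
      (mul_le_mul_of_nonneg_left ((hLk k).trans hε1) (norm_nonneg _))
    rw [e]
    calc _ ≤ β k * (‖M.G‖ * u) + β k * (1 * u) + γ k * (‖M.A22‖ * 1) := by
          refine (norm_sub_le _ _).trans (add_le_add ((norm_add_le _ _).trans
            (add_le_add ?_ ?_)) ?_)
          · rw [norm_smul, Real.norm_of_nonneg hβ]
            exact mul_le_mul_of_nonneg_left h1 hβ
          · rw [norm_smul, Real.norm_of_nonneg hβ]
            exact mul_le_mul_of_nonneg_left h2 hβ
          · rw [norm_smul, Real.norm_of_nonneg hγ]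
            exact mul_le_mul_of_nonneg_left h3 hγ
      _ ≤ γ k * (‖M.G‖ * u) + γ k * (1 * u) + γ k * (‖M.A22‖ * 1) := by gcongr
      _ = (‖M.A22‖ + ‖M.G‖ * u + u) * γ k := by ring
      _ ≤ _ := mul_le_mul_of_nonneg_right (by linarith [norm_nonneg M.G]) hγ

/-! ### Size of the noise and the Poisson correction -/

section Noise

variable {m n d : ℕ}

lemma norm_noise_le {f : (Fin m ⊕ Fin n) × Option (Fin m ⊕ Fin n) → ℝ}
    {s : Option (Fin m ⊕ Fin n) → ℝ} {R : Fin m ⊕ Fin n → Vec d} {b σ r B : ℝ} (hb0 : 0 ≤ b)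
    (hr0 : 0 ≤ r) (hf : ∀ ij, |f ij| ≤ b) (hs : ∀ j, |s j| ≤ σ) (hR : ∀ i, ‖R i‖ ≤ r)
    (hB : Fintype.card ((Fin m ⊕ Fin n) × Option (Fin m ⊕ Fin n)) ≤ B) :
    ‖noise f s R‖ ≤ B * (b * (σ * r)) := by
  have hσ0 : 0 ≤ σ := (abs_nonneg _).trans (hs none)
  calc ‖noise f s R‖ ≤ ∑ ij : (Fin m ⊕ Fin n) × Option (Fin m ⊕ Fin n), b * (σ * r) := by
        refine norm_sum_le_of_le _ fun ij _ => ?_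
        rw [norm_smul, norm_smul]
        exact mul_le_mul (hf ij) (mul_le_mul (hs _) (hR _) (norm_nonneg _) hσ0)
          (by positivity) hb0
    _ = Fintype.card ((Fin m ⊕ Fin n) × Option (Fin m ⊕ Fin n)) * (b * (σ * r)) := by
        rw [Finset.sum_const, nsmul_eq_mul, Finset.card_univ]
    _ ≤ _ := by gcongr

lemma norm_noise_sub_noise_le {f : (Fin m ⊕ Fin n) × Option (Fin m ⊕ Fin n) → ℝ}
    {s s' : Option (Fin m ⊕ Fin n) → ℝ} {R R' : Fin m ⊕ Fin n → Vec d} {b σ σ' r r' B : ℝ}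
    (hb0 : 0 ≤ b) (hr0 : 0 ≤ r) (hr0' : 0 ≤ r') (hf : ∀ ij, |f ij| ≤ b) (hs : ∀ j, |s j| ≤ σ)
    (hs' : ∀ j, |s' j - s j| ≤ σ') (hR' : ∀ i, ‖R' i‖ ≤ r) (hRR : ∀ i, ‖R' i - R i‖ ≤ r')
    (hB : Fintype.card ((Fin m ⊕ Fin n) × Option (Fin m ⊕ Fin n)) ≤ B) :
    ‖noise f s' R' - noise f s R‖ ≤ B * (b * (σ' * r)) + B * (b * (σ * r')) := by
  have e : noise f s' R' - noise f s R
      = noise f (fun j => s' j - s j) R' + noise f s (fun i => R' i - R i) := by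
    simp only [noise, ← Finset.sum_sub_distrib, ← Finset.sum_add_distrib]
    refine Finset.sum_congr rfl fun ij _ => ?_
    module
  rw [e]
  exact (norm_add_le _ _).trans (add_le_add (norm_noise_le hb0 hr0 hf hs' hR' hB)
    (norm_noise_le hb0 hr0' hf hs hRR hB))

/-- Rewriting of a noisy linear step after the Poisson correction of the iterate. -/
lemma corrected_step {A : Matrix (Fin d) (Fin d) ℝ} {t : ℝ} {x x' e₀ : Vec d}
    {f fh h h' : (Fin m ⊕ Fin n) × Option (Fin m ⊕ Fin n) → ℝ}
    {s s' : Option (Fin m ⊕ Fin n) → ℝ} {R R' : Fin m ⊕ Fin n → Vec d}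
    (hx : x' = x - t • act A x + e₀ + noise f s R) (hf : ∀ ij, f ij = fh ij - h' ij) :
    x' + noise h' s' R' = (x + noise h s R) - t • act A (x + noise h s R)
      + noise (fun ij => fh ij - h ij) s R
      + (e₀ + t • act A (noise h s R) + (noise h' s' R' - noise h' s R)) := by
  obtain rfl : f = fun ij => fh ij - h' ij := funext hf
  rw [hx, noise_sub, noise_sub, act_add]
  module

end Noise

/-! ### Pathwise bounds on noise directions and state increments -/

/-- Standing assumptions for the pathwise estimates; `fh` and `h` are the solutions of the Poisson
equations of the noise coefficients and their images under the kernel. -/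
structure Setup {m n : ℕ} {S : Type*} (M : Coeffs m n) (F : S → Coeffs m n) (β γ : ℕ → ℝ)
    (θs : Vec m) (ws : Vec n) (B ε : ℝ)
    (fh h : (Fin m ⊕ Fin n) × Option (Fin m ⊕ Fin n) → S → ℝ) : Prop
    extends StepBounds M B ε β γ where
  one_le : 1 ≤ B
  isUnit_A22 : IsUnit M.A22
  sol : M.IsSolution θs ws
  step : StepCond 1 1 β γ
  norm_A12 : ‖M.A12‖ ≤ B
  norm_A22 : ‖M.A22‖ ≤ B
  norm_schur : ‖M.schur‖ ≤ B
  norm_H : ‖M.H‖ ≤ B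
  norm_θs : ‖θs‖ ≤ B
  norm_ws : ‖ws‖ ≤ B
  norm_F : ∀ y, (‖(F y).A11‖ ≤ B ∧ ‖(F y).A12‖ ≤ B ∧ ‖(F y).b1‖ ≤ B) ∧
    (‖(F y).A21‖ ≤ B ∧ ‖(F y).A22‖ ≤ B ∧ ‖(F y).b2‖ ≤ B)
  card_le : (Fintype.card ((Fin m ⊕ Fin n) × Option (Fin m ⊕ Fin n)) : ℝ) ≤ B
  fh_le : ∀ ij y, |fh ij y| ≤ B
  h_le : ∀ ij y, |h ij y| ≤ B
  poisson_eq : ∀ ij y, dev M F ij y = fh ij y - h ij y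

namespace Setup

variable {m n : ℕ} {S : Type*} {M : Coeffs m n} {F : S → Coeffs m n} {β γ : ℕ → ℝ}
  {θs : Vec m} {ws : Vec n} {B ε : ℝ}
  {fh h : (Fin m ⊕ Fin n) × Option (Fin m ⊕ Fin n) → S → ℝ}

lemma β_le_γ (hS : Setup M F β γ θs ws B ε fh h) (k : ℕ) : β k ≤ γ k := by
  simpa using hS.step.β_le k

lemma γ_le_one (hS : Setup M F β γ θs ws B ε fh h) (k : ℕ) : γ k ≤ 1 := by
  simpa using hS.step.γ_le k

lemma κ_nonneg (hS : Setup M F β γ θs ws B ε fh h) (k : ℕ) : 0 ≤ β k / γ k :=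
  div_nonneg (hS.step.β_pos k).le (hS.step.γ_pos k).le

lemma κ_le_one (hS : Setup M F β γ θs ws B ε fh h) (k : ℕ) : β k / γ k ≤ 1 :=
  (div_le_one (hS.step.γ_pos k)).mpr (hS.β_le_γ k)

lemma κ_mul (hS : Setup M F β γ θs ws B ε fh h) (k : ℕ) : β k / γ k * γ k = β k :=
  div_mul_cancel₀ _ (hS.step.γ_pos k).ne'

lemma norm_dirW_le (hS : Setup M F β γ θs ws B ε fh h) (k : ℕ) (i : Fin m ⊕ Fin n) :
    ‖dirW M β γ k i‖ ≤ 2 * B * γ k := by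
  have hγ := (hS.step.γ_pos k).le
  have hβ := (hS.step.β_pos k).le
  have hB := hS.one_le
  calc ‖dirW M β γ k i‖ ≤ γ k * 1 + β k * (B * 1) := by
        refine (norm_add_le _ _).trans (add_le_add ?_ ?_)
        · rw [norm_smul, Real.norm_of_nonneg hγ]
          exact mul_le_mul_of_nonneg_left (norm_basisW_le i) hγ
        · rw [norm_smul, Real.norm_of_nonneg hβ]
          exact mul_le_mul_of_nonneg_left
            (norm_act_le_of_le (hS.LG_le _) (norm_basisTheta_le i)) hβ
    _ ≤ B * γ k + γ k * (B * 1) := by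
        have := hS.β_le_γ k
        refine add_le_add (by nlinarith) (by gcongr)
    _ = _ := by ring

/-- The correction built on Pf̂(X_k) telescopes only up to the change of the directions. Slow
variation of β, γ and L makes that change second order. -/
lemma norm_dirW_sub_le (hS : Setup M F β γ θs ws B ε fh h) (k : ℕ) (i : Fin m ⊕ Fin n) :
    ‖dirW M β γ (k + 1) i - dirW M β γ k i‖ ≤ 3 * B * γ k ^ 2 := by
  have hγ := (hS.step.γ_pos k).le
  have hβ := (hS.step.β_pos k).le
  have hB := hS.one_le
  have hβγ := hS.β_le_γ k
  have e : dirW M β γ (k + 1) i - dirW M β γ k i = (γ (k + 1) - γ k) • basisW i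
      + (β (k + 1) - β k) • act (M.L β γ (k + 1 + 1) + M.G) (basisTheta i)
      + β k • act (M.L β γ (k + 1 + 1) - M.L β γ (k + 1)) (basisTheta i) := by
    simp only [dirW, act_add_left, act_sub_left]
    module
  have h1 : |γ (k + 1) - γ k| ≤ γ k ^ 2 := by
    rw [abs_sub_comm, abs_of_nonneg (by linarith [hS.step.γ_anti k])]
    simpa using hS.step.γ_diff k
  have h2 : |β (k + 1) - β k| ≤ β k ^ 2 := by
    rw [abs_sub_comm, abs_of_nonneg (by linarith [hS.step.β_anti k])]
    simpa using hS.step.β_diff k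
  have h3 : ‖M.L β γ (k + 1 + 1) - M.L β γ (k + 1)‖ ≤ B * γ k :=
    (hS.L_diff (k + 1)).trans (mul_le_mul_of_nonneg_left (hS.step.γ_anti k) (by linarith))
  rw [e]
  calc _ ≤ γ k ^ 2 * 1 + β k ^ 2 * (B * 1) + β k * (B * γ k * 1) := by
        refine (norm_add_le _ _).trans (add_le_add ((norm_add_le _ _).trans (add_le_add ?_ ?_)) ?_)
        · rw [norm_smul]
          exact mul_le_mul h1 (norm_basisW_le i) (norm_nonneg _) (sq_nonneg _)
        · rw [norm_smul]
          exact mul_le_mul h2 (norm_act_le_of_le (hS.LG_le _) (norm_basisTheta_le i))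
            (norm_nonneg _) (sq_nonneg _)
        · rw [norm_smul, Real.norm_of_nonneg hβ]
          exact mul_le_mul_of_nonneg_left (norm_act_le_of_le h3 (norm_basisTheta_le i)) hβ
    _ ≤ γ k ^ 2 * B + γ k ^ 2 * (B * 1) + γ k * (B * γ k * 1) := by gcongr
    _ = _ := by ring

/-- The correction z = θ̃ − κHw̃ imports the fast noise, of size γ_k, with the factor κ_{k+1} ≤ κ_k;
as κ_kγ_k = β_k, the slow noise keeps its order. -/
lemma norm_dirZ_le (hS : Setup M F β γ θs ws B ε fh h) (k : ℕ) (i : Fin m ⊕ Fin n) :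
    ‖dirZ M β γ k i‖ ≤ 3 * B ^ 2 * β k := by
  have hγ := (hS.step.γ_pos k).le
  have hβ := (hS.step.β_pos k).le
  have hB := hS.one_le
  have hκ := hS.κ_nonneg (k + 1)
  calc ‖dirZ M β γ k i‖ ≤ β k * 1 + β (k + 1) / γ (k + 1) * (B * (2 * B * γ k)) := by
        refine (norm_add_le _ _).trans (add_le_add ?_ ?_)
        · rw [norm_smul, Real.norm_of_nonneg hβ]
          exact mul_le_mul_of_nonneg_left (norm_basisTheta_le i) hβ
        · rw [norm_smul, norm_neg, Real.norm_of_nonneg hκ]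
          exact mul_le_mul_of_nonneg_left
            (norm_act_le_of_le hS.norm_H (hS.norm_dirW_le k i)) hκ
    _ ≤ β k * B ^ 2 + β k / γ k * (B * (2 * B * γ k)) := by
        have := hS.step.κ_anti k
        have : 1 ≤ B ^ 2 := by nlinarith
        gcongr
    _ = β k * B ^ 2 + 2 * B ^ 2 * (β k / γ k * γ k) := by ring
    _ = _ := by rw [hS.κ_mul]; ring

/-- Three changes contribute: that of β (order β²), that of the fast directions, κ·γ² = βγ, and that
of κ, κβ·γ = β². -/
lemma norm_dirZ_sub_le (hS : Setup M F β γ θs ws B ε fh h) (k : ℕ) (i : Fin m ⊕ Fin n) :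
    ‖dirZ M β γ (k + 1) i - dirZ M β γ k i‖ ≤ 6 * B ^ 2 * (β k * γ k) := by
  have hγ := (hS.step.γ_pos k).le
  have hβ := (hS.step.β_pos k).le
  have hβ' := (hS.step.β_pos (k + 1)).le
  have hB := hS.one_le
  have hβγ := hS.β_le_γ k
  have hκ := hS.κ_nonneg (k + 1)
  have hκ0 := hS.κ_nonneg k
  have hκ' := hS.κ_nonneg (k + 1 + 1)
  have e : dirZ M β γ (k + 1) i - dirZ M β γ k i = (β (k + 1) - β k) • basisTheta i
      - (β (k + 1 + 1) / γ (k + 1 + 1)) • act M.H (dirW M β γ (k + 1) i - dirW M β γ k i)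
      + (β (k + 1) / γ (k + 1) - β (k + 1 + 1) / γ (k + 1 + 1)) • act M.H (dirW M β γ k i) := by
    simp only [dirZ, act_sub]
    module
  have h2 : |β (k + 1) - β k| ≤ β k ^ 2 := by
    rw [abs_sub_comm, abs_of_nonneg (by linarith [hS.step.β_anti k])]
    simpa using hS.step.β_diff k
  have hanti := hS.step.κ_anti k
  have hanti' := hS.step.κ_anti (k + 1)
  have h3 : |β (k + 1) / γ (k + 1) - β (k + 1 + 1) / γ (k + 1 + 1)| ≤ β k / γ k * β k := by
    rw [abs_of_nonneg (by linarith)]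
    have h4 := hS.step.κ_diff (k + 1)
    rw [one_mul] at h4
    exact h4.trans (mul_le_mul hanti (hS.step.β_anti k) hβ' hκ0)
  rw [e]
  calc _ ≤ β k ^ 2 * 1 + β (k + 1 + 1) / γ (k + 1 + 1) * (B * (3 * B * γ k ^ 2))
          + β k / γ k * β k * (B * (2 * B * γ k)) := by
        refine (norm_add_le _ _).trans (add_le_add ((norm_sub_le _ _).trans (add_le_add ?_ ?_)) ?_)
        · rw [norm_smul]
          exact mul_le_mul h2 (norm_basisTheta_le i) (norm_nonneg _) (sq_nonneg _)
        · rw [norm_smul, Real.norm_of_nonneg hκ']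
          exact mul_le_mul_of_nonneg_left
            (norm_act_le_of_le hS.norm_H (hS.norm_dirW_sub_le k i)) hκ'
        · rw [norm_smul]
          exact mul_le_mul h3 (norm_act_le_of_le hS.norm_H (hS.norm_dirW_le k i))
            (norm_nonneg _) (mul_nonneg hκ0 hβ)
    _ ≤ β k * γ k * B ^ 2 + β k / γ k * (B * (3 * B * γ k ^ 2))
          + β k / γ k * β k * (B * (2 * B * γ k)) := by
        have h5 : 1 ≤ B ^ 2 := by nlinarith
        have h6 : β k ^ 2 ≤ β k * γ k := by rw [sq]; gcongr
        have h7 := hanti'.trans hanti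
        gcongr
    _ = β k * γ k * B ^ 2 + 3 * B ^ 2 * (β k / γ k * γ k * γ k)
          + 2 * B ^ 2 * (β k / γ k * γ k * β k) := by ring
    _ ≤ β k * γ k * B ^ 2 + 3 * B ^ 2 * (β k * γ k) + 2 * B ^ 2 * (β k * γ k) := by
        rw [hS.κ_mul]
        gcongr
    _ = _ := by ring

variable (M F β γ θs ws) in
/-- The size `1 + ‖θ̃_k‖ + ‖w̃_k‖` of the state. -/
noncomputable def _root_.TTSA.stateSize (θ₀ : Vec m) (w₀ : Vec n) (x : ℕ → S) (k : ℕ) : ℝ :=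
  1 + ‖errTheta F β γ θ₀ w₀ θs x k‖ + ‖errW M F β γ θ₀ w₀ θs ws x k‖

variable (θ₀ : Vec m) (w₀ : Vec n) (x : ℕ → S)

lemma norm_fst_le (hS : Setup M F β γ θs ws B ε fh h) (k : ℕ) :
    ‖(iter F β γ θ₀ w₀ x k).1‖ ≤ B * stateSize M F β γ θs ws θ₀ w₀ x k := by
  have hB := hS.one_le
  set g := errTheta F β γ θ₀ w₀ θs x k with hg
  have e : (iter F β γ θ₀ w₀ x k).1 = g + θs := by rw [hg, errTheta]; abel
  have h1 := norm_add_le g θs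
  rw [e, stateSize, ← hg]
  have h2 := hS.norm_θs
  have h3 := norm_nonneg g
  have h4 := norm_nonneg (errW M F β γ θ₀ w₀ θs ws x k)
  nlinarith

lemma norm_snd_le (hS : Setup M F β γ θs ws B ε fh h) (k : ℕ) :
    ‖(iter F β γ θ₀ w₀ x k).2‖ ≤ B * stateSize M F β γ θs ws θ₀ w₀ x k := by
  have hB := hS.one_le
  set g := errTheta F β γ θ₀ w₀ θs x k with hg
  set W := errW M F β γ θ₀ w₀ θs ws x k with hW
  have e : (iter F β γ θ₀ w₀ x k).2 = W + ws - act (M.L β γ k + M.G) g := by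
    rw [hW, errW, ← hg]; abel
  have h1 := norm_sub_le (W + ws) (act (M.L β γ k + M.G) g)
  have h1' := norm_add_le W ws
  have h2 := hS.norm_ws
  have h5 := norm_act_le_of_le (hS.LG_le k) (le_refl ‖g‖)
  rw [e, stateSize, ← hg, ← hW]
  have h3 := norm_nonneg g
  have h4 := norm_nonneg W
  nlinarith

lemma one_le_stateSize (k : ℕ) : 1 ≤ stateSize M F β γ θs ws θ₀ w₀ x k := by
  rw [stateSize]
  linarith [norm_nonneg (errTheta F β γ θ₀ w₀ θs x k),
    norm_nonneg (errW M F β γ θ₀ w₀ θs ws x k)]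

lemma abs_extState_le (hS : Setup M F β γ θs ws B ε fh h) (k : ℕ) (j) :
    |extState F β γ θ₀ w₀ x k j| ≤ B * stateSize M F β γ θs ws θ₀ w₀ x k := by
  have h1 := one_le_stateSize (M := M) (F := F) (β := β) (γ := γ) (θs := θs) (ws := ws) θ₀ w₀ x k
  rcases j with _ | j | j
  · simp only [extState, extend, abs_one]
    nlinarith [hS.one_le]
  · exact (PiLp.norm_apply_le _ j).trans (hS.norm_fst_le θ₀ w₀ x k)
  · exact (PiLp.norm_apply_le _ j).trans (hS.norm_snd_le θ₀ w₀ x k)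

lemma norm_increment_le {d : ℕ} {b : Vec d} {A : Matrix (Fin d) (Fin m) ℝ}
    {A' : Matrix (Fin d) (Fin n) ℝ} {θ : Vec m} {w : Vec n} {g : ℝ} (hB : 0 ≤ B) (hb : ‖b‖ ≤ B)
    (hA : ‖A‖ ≤ B) (hA' : ‖A'‖ ≤ B) (hg : 1 ≤ g) (hB1 : 1 ≤ B) (hθ : ‖θ‖ ≤ B * g)
    (hw : ‖w‖ ≤ B * g) : ‖b - act A θ - act A' w‖ ≤ 3 * B ^ 2 * g := by
  have h1 := norm_sub_le (b - act A θ) (act A' w)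
  have h2 := norm_sub_le b (act A θ)
  have h3 := norm_act_le_of_le hA hθ
  have h4 := norm_act_le_of_le hA' hw
  have h5 : B ≤ B ^ 2 * g := by
    have : B * 1 ≤ B * (B * g) := mul_le_mul_of_nonneg_left (by nlinarith) hB
    nlinarith
  nlinarith

lemma abs_extState_sub_le (hS : Setup M F β γ θs ws B ε fh h) (k : ℕ) (j) :
    |extState F β γ θ₀ w₀ x (k + 1) j - extState F β γ θ₀ w₀ x k j|
      ≤ 3 * B ^ 2 * γ k * stateSize M F β γ θs ws θ₀ w₀ x k := by
  have hg := one_le_stateSize (M := M) (F := F) (β := β) (γ := γ) (θs := θs) (ws := ws) θ₀ w₀ x k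
  have hB := hS.one_le
  have hγ := (hS.step.γ_pos k).le
  have hβ := (hS.step.β_pos k).le
  have hθ := hS.norm_fst_le θ₀ w₀ x k
  have hw := hS.norm_snd_le θ₀ w₀ x k
  obtain ⟨⟨a1, a2, a3⟩, ⟨a4, a5, a6⟩⟩ := hS.norm_F (x (k + 1))
  have hinc1 := norm_increment_le (by linarith) a3 a1 a2 hg hB hθ hw
  have hinc2 := norm_increment_le (by linarith) a6 a4 a5 hg hB hθ hw
  set g := stateSize M F β γ θs ws θ₀ w₀ x k
  rcases j with _ | j | j
  · simp only [extState, extend, sub_self, abs_zero]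
    positivity
  · have e : (iter F β γ θ₀ w₀ x (k + 1)).1 - (iter F β γ θ₀ w₀ x k).1
        = β k • ((F (x (k + 1))).b1 - act (F (x (k + 1))).A11 (iter F β γ θ₀ w₀ x k).1
          - act (F (x (k + 1))).A12 (iter F β γ θ₀ w₀ x k).2) := by
      rw [iter]; simp only [add_sub_cancel_left]
    have h1 := PiLp.norm_apply_le
      ((iter F β γ θ₀ w₀ x (k + 1)).1 - (iter F β γ θ₀ w₀ x k).1) j
    rw [e, norm_smul, Real.norm_of_nonneg hβ, ← e] at h1
    refine h1.trans ?_
    calc _ ≤ γ k * (3 * B ^ 2 * g) := by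
          gcongr
          exact hS.β_le_γ k
      _ = _ := by ring
  · have e : (iter F β γ θ₀ w₀ x (k + 1)).2 - (iter F β γ θ₀ w₀ x k).2
        = γ k • ((F (x (k + 1))).b2 - act (F (x (k + 1))).A21 (iter F β γ θ₀ w₀ x k).1
          - act (F (x (k + 1))).A22 (iter F β γ θ₀ w₀ x k).2) := by
      rw [iter]; simp only [add_sub_cancel_left]
    have h1 := PiLp.norm_apply_le
      ((iter F β γ θ₀ w₀ x (k + 1)).2 - (iter F β γ θ₀ w₀ x k).2) j
    rw [e, norm_smul, Real.norm_of_nonneg hγ, ← e] at h1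
    refine h1.trans ?_
    calc _ ≤ γ k * (3 * B ^ 2 * g) := by gcongr
      _ = _ := by ring

end Setup

/-! ### Poisson-corrected errors and their remainders -/

section Corrected

variable {m n : ℕ} {S : Type*} (M : Coeffs m n) (F : S → Coeffs m n) (β γ : ℕ → ℝ) (θs : Vec m)
  (ws : Vec n) (fh h : (Fin m ⊕ Fin n) × Option (Fin m ⊕ Fin n) → S → ℝ) (θ₀ : Vec m) (w₀ : Vec n)
  (x : ℕ → S)

/-- The Poisson-corrected fast error. -/
noncomputable def corrW (k : ℕ) : Vec n := errW M F β γ θ₀ w₀ θs ws x k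
  + noise (fun ij => h ij (x k)) (extState F β γ θ₀ w₀ x k) (dirW M β γ k)

/-- The Poisson-corrected slow error. -/
noncomputable def corrZ (k : ℕ) : Vec m := errZ M F β γ θ₀ w₀ θs ws x k
  + noise (fun ij => h ij (x k)) (extState F β γ θ₀ w₀ x k) (dirZ M β γ k)

/-- The martingale increments of `corrW`. -/
noncomputable def martW (k : ℕ) : Vec n :=
  noise (fun ij => fh ij (x (k + 1)) - h ij (x k)) (extState F β γ θ₀ w₀ x k) (dirW M β γ k)

/-- The martingale increments of `corrZ`. -/
noncomputable def martZ (k : ℕ) : Vec m :=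
  noise (fun ij => fh ij (x (k + 1)) - h ij (x k)) (extState F β γ θ₀ w₀ x k) (dirZ M β γ k)

/-- The remainder in the recursion of `corrW`. -/
noncomputable def remW (k : ℕ) : Vec n :=
  corrW M F β γ θs ws h θ₀ w₀ x (k + 1) - (corrW M F β γ θs ws h θ₀ w₀ x k
    - γ k • act M.A22 (corrW M F β γ θs ws h θ₀ w₀ x k) + martW M F β γ fh h θ₀ w₀ x k)

/-- The remainder in the recursion of `corrZ`. -/
noncomputable def remZ (k : ℕ) : Vec m :=
  corrZ M F β γ θs ws h θ₀ w₀ x (k + 1) - (corrZ M F β γ θs ws h θ₀ w₀ x k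
    - β k • act M.schur (corrZ M F β γ θs ws h θ₀ w₀ x k) + martZ M F β γ fh h θ₀ w₀ x k)

end Corrected

namespace Setup

variable {m n : ℕ} {S : Type*} {M : Coeffs m n} {F : S → Coeffs m n} {β γ : ℕ → ℝ}
  {θs : Vec m} {ws : Vec n} {B ε : ℝ}
  {fh h : (Fin m ⊕ Fin n) × Option (Fin m ⊕ Fin n) → S → ℝ}
  (θ₀ : Vec m) (w₀ : Vec n) (x : ℕ → S)

local notation "g" => stateSize M F β γ θs ws θ₀ w₀ x
local notation "W" => errW M F β γ θ₀ w₀ θs ws x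
local notation "Z" => errZ M F β γ θ₀ w₀ θs ws x
local notation "yW" => corrW M F β γ θs ws h θ₀ w₀ x
local notation "yZ" => corrZ M F β γ θs ws h θ₀ w₀ x

lemma norm_noiseW_le (hS : Setup M F β γ θs ws B ε fh h) (k : ℕ) :
    ‖noise (fun ij => h ij (x k)) (extState F β γ θ₀ w₀ x k) (dirW M β γ k)‖
      ≤ 2 * B ^ 4 * (γ k * g k) := by
  have hB := hS.one_le
  have hγ := (hS.step.γ_pos k).le
  calc _ ≤ B * (B * ((B * g k) * (2 * B * γ k))) :=
        norm_noise_le (by linarith) (by positivity) (fun ij => hS.h_le ij _)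
          (hS.abs_extState_le θ₀ w₀ x k) (hS.norm_dirW_le k) hS.card_le
    _ = _ := by ring

lemma norm_noiseZ_le (hS : Setup M F β γ θs ws B ε fh h) (k : ℕ) :
    ‖noise (fun ij => h ij (x k)) (extState F β γ θ₀ w₀ x k) (dirZ M β γ k)‖
      ≤ 3 * B ^ 5 * (β k * g k) := by
  have hB := hS.one_le
  have hβ := (hS.step.β_pos k).le
  calc _ ≤ B * (B * ((B * g k) * (3 * B ^ 2 * β k))) :=
        norm_noise_le (by linarith) (by positivity) (fun ij => hS.h_le ij _)
          (hS.abs_extState_le θ₀ w₀ x k) (hS.norm_dirZ_le k) hS.card_le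
    _ = _ := by ring

lemma abs_mart_le (hS : Setup M F β γ θs ws B ε fh h) (k : ℕ) (ij) :
    |fh ij (x (k + 1)) - h ij (x k)| ≤ 2 * B := by
  have := norm_sub_le (fh ij (x (k + 1))) (h ij (x k))
  simp only [Real.norm_eq_abs] at this
  linarith [hS.fh_le ij (x (k + 1)), hS.h_le ij (x k)]

lemma norm_martW_le (hS : Setup M F β γ θs ws B ε fh h) (k : ℕ) :
    ‖martW M F β γ fh h θ₀ w₀ x k‖ ≤ 4 * B ^ 4 * (γ k * g k) := by
  have hB := hS.one_le
  have hγ := (hS.step.γ_pos k).le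
  calc _ ≤ B * ((2 * B) * ((B * g k) * (2 * B * γ k))) :=
        norm_noise_le (by linarith) (by positivity) (hS.abs_mart_le x k)
          (hS.abs_extState_le θ₀ w₀ x k) (hS.norm_dirW_le k) hS.card_le
    _ = _ := by ring

lemma norm_martZ_le (hS : Setup M F β γ θs ws B ε fh h) (k : ℕ) :
    ‖martZ M F β γ fh h θ₀ w₀ x k‖ ≤ 6 * B ^ 5 * (β k * g k) := by
  have hB := hS.one_le
  have hβ := (hS.step.β_pos k).le
  calc _ ≤ B * ((2 * B) * ((B * g k) * (3 * B ^ 2 * β k))) :=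
        norm_noise_le (by linarith) (by positivity) (hS.abs_mart_le x k)
          (hS.abs_extState_le θ₀ w₀ x k) (hS.norm_dirZ_le k) hS.card_le
    _ = _ := by ring

/-- Three sources: the coupling of order β, the drift γA₂₂ acting on a correction of order γ, and
the change over one step of the state (order γ) and of the directions (order γ²) inside the
correction. -/
lemma norm_remW_le (hS : Setup M F β γ θs ws B ε fh h) (k : ℕ) :
    ‖remW M F β γ θs ws fh h θ₀ w₀ x k‖
      ≤ B ^ 2 * (β k * ‖W k‖) + 11 * B ^ 5 * (γ k ^ 2 * g k) := by
  have hB := hS.one_le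
  have hγ := (hS.step.γ_pos k).le
  have hβ := (hS.step.β_pos k).le
  have hg := one_le_stateSize (M := M) (F := F) (β := β) (γ := γ) (θs := θs) (ws := ws) θ₀ w₀ x k
  have hx : W (k + 1) = W k - γ k • act M.A22 (W k)
      + (-(β k • act (M.L β γ (k + 1) + M.G) (act M.A12 (W k))))
      + noise (fun ij => dev M F ij (x (k + 1))) (extState F β γ θ₀ w₀ x k) (dirW M β γ k) := by
    rw [errW_succ F θ₀ w₀ x hS.isUnit_A22 hS.sol (hS.L_rec k), sub_eq_add_neg _ (β k • _)]
  have hstep := corrected_step (h := fun ij => h ij (x k)) (s' := extState F β γ θ₀ w₀ x (k + 1))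
    (R' := dirW M β γ (k + 1)) hx (fun ij => hS.poisson_eq ij (x (k + 1)))
  have e : remW M F β γ θs ws fh h θ₀ w₀ x k
      = -(β k • act (M.L β γ (k + 1) + M.G) (act M.A12 (W k)))
        + γ k • act M.A22 (noise (fun ij => h ij (x k)) (extState F β γ θ₀ w₀ x k) (dirW M β γ k))
        + (noise (fun ij => h ij (x (k + 1))) (extState F β γ θ₀ w₀ x (k + 1)) (dirW M β γ (k + 1))
          - noise (fun ij => h ij (x (k + 1))) (extState F β γ θ₀ w₀ x k) (dirW M β γ k)) := by
    rw [remW, sub_eq_iff_eq_add', martW, corrW, corrW]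
    exact hstep
  have h1 : ‖-(β k • act (M.L β γ (k + 1) + M.G) (act M.A12 (W k)))‖
      ≤ β k * (B * (B * ‖W k‖)) := by
    rw [norm_neg, norm_smul, Real.norm_of_nonneg hβ]
    exact mul_le_mul_of_nonneg_left (norm_act_le_of_le (hS.LG_le _)
      (norm_act_le_of_le hS.norm_A12 le_rfl)) hβ
  have h2 : ‖γ k • act M.A22 (noise (fun ij => h ij (x k)) (extState F β γ θ₀ w₀ x k)
      (dirW M β γ k))‖ ≤ γ k * (B * (2 * B ^ 4 * (γ k * g k))) := by
    rw [norm_smul, Real.norm_of_nonneg hγ]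
    exact mul_le_mul_of_nonneg_left (norm_act_le_of_le hS.norm_A22
      (hS.norm_noiseW_le θ₀ w₀ x k)) hγ
  have h3 := norm_noise_sub_noise_le (f := fun ij => h ij (x (k + 1))) (b := B)
    (r := 2 * B * γ k) (by linarith) (by positivity) (by positivity) (fun ij => hS.h_le ij _)
    (hS.abs_extState_le θ₀ w₀ x k) (hS.abs_extState_sub_le θ₀ w₀ x k)
    (fun i => (hS.norm_dirW_le (k + 1) i).trans
      (mul_le_mul_of_nonneg_left (hS.step.γ_anti k) (by linarith)))
    (hS.norm_dirW_sub_le k) hS.card_le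
  rw [e]
  refine (norm_add_le_of_le (norm_add_le_of_le h1 h2) h3).trans ?_
  have h4 : B ^ 4 * (γ k ^ 2 * g k) ≤ B ^ 5 * (γ k ^ 2 * g k) :=
    mul_le_mul_of_nonneg_right (pow_le_pow_right₀ hB (by norm_num)) (by positivity)
  calc _ = B ^ 2 * (β k * ‖W k‖) + 8 * (B ^ 5 * (γ k ^ 2 * g k))
        + 3 * (B ^ 4 * (γ k ^ 2 * g k)) := by ring
    _ ≤ _ := by linarith

/-- After cancellation the slow drift keeps two perturbations: βA₁₂L_k, small because L_k is at most
ε, and w̃-terms of order βκ, where the decrement of κ is at most κβ. -/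
lemma norm_driftZ_le (hS : Setup M F β γ θs ws B ε fh h) (k : ℕ) :
    ‖β k • act M.A12 (act (M.L β γ k) (Z k))
      + ((β k / γ k - β (k + 1) / γ (k + 1)) • (act M.H (W k) - γ k • act M.A12 (W k))
        - (β k * (β k / γ k)) • act (M.U (M.L β γ k)) (act M.H (W k))
        + (β (k + 1) / γ (k + 1) * β k) • act M.H (act (M.L β γ (k + 1) + M.G)
          (act M.A12 (W k))))‖
      ≤ B * ε * (β k * ‖Z k‖) + 4 * B ^ 3 * (β k * (β k / γ k * ‖W k‖)) := by
  have hB := hS.one_le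
  have hγ := (hS.step.γ_pos k).le
  have hβ := (hS.step.β_pos k).le
  have hκ := hS.κ_nonneg k
  have hκ' := hS.κ_nonneg (k + 1)
  have hanti := hS.step.κ_anti k
  have h1 : ‖β k • act M.A12 (act (M.L β γ k) (Z k))‖ ≤ β k * (B * (ε * ‖Z k‖)) := by
    rw [norm_smul, Real.norm_of_nonneg hβ]
    exact mul_le_mul_of_nonneg_left (norm_act_le_of_le hS.norm_A12
      (norm_act_le_of_le (hS.L_le k) le_rfl)) hβ
  have hd : |β k / γ k - β (k + 1) / γ (k + 1)| ≤ β k / γ k * β k := by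
    rw [abs_of_nonneg (by linarith)]
    simpa using hS.step.κ_diff k
  have hHW : ‖act M.H (W k)‖ ≤ B * ‖W k‖ := norm_act_le_of_le hS.norm_H le_rfl
  have hAW : ‖act M.A12 (W k)‖ ≤ B * ‖W k‖ := norm_act_le_of_le hS.norm_A12 le_rfl
  have h2 : ‖(β k / γ k - β (k + 1) / γ (k + 1)) • (act M.H (W k) - γ k • act M.A12 (W k))‖
      ≤ β k / γ k * β k * (B * ‖W k‖ + 1 * (B * ‖W k‖)) := by
    rw [norm_smul]
    refine mul_le_mul hd (norm_sub_le_of_le hHW ?_) (norm_nonneg _) (by positivity)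
    rw [norm_smul, Real.norm_of_nonneg hγ]
    exact mul_le_mul (hS.γ_le_one k) hAW (norm_nonneg _) zero_le_one
  have h3 : ‖(β k * (β k / γ k)) • act (M.U (M.L β γ k)) (act M.H (W k))‖
      ≤ β k * (β k / γ k) * (B * (B * ‖W k‖)) := by
    rw [norm_smul, Real.norm_of_nonneg (by positivity)]
    exact mul_le_mul_of_nonneg_left (norm_act_le_of_le (hS.U_le k) hHW) (by positivity)
  have h4 : ‖(β (k + 1) / γ (k + 1) * β k) • act M.H (act (M.L β γ (k + 1) + M.G)
      (act M.A12 (W k)))‖ ≤ β k / γ k * β k * (B * (B * (B * ‖W k‖))) := by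
    rw [norm_smul, Real.norm_of_nonneg (by positivity)]
    exact mul_le_mul (mul_le_mul_of_nonneg_right hanti hβ) (norm_act_le_of_le hS.norm_H
      (norm_act_le_of_le (hS.LG_le _) hAW)) (norm_nonneg _) (by positivity)
  refine (norm_add_le_of_le h1 (norm_add_le_of_le (norm_sub_le_of_le h2 h3) h4)).trans ?_
  have h5 : B ≤ B ^ 3 := by
    calc B = B ^ 1 := (pow_one B).symm
      _ ≤ B ^ 3 := pow_le_pow_right₀ hB (by norm_num)
  have h6 : B ^ 2 ≤ B ^ 3 := pow_le_pow_right₀ hB (by norm_num)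
  have h7 : 0 ≤ β k * (β k / γ k * ‖W k‖) := by positivity
  calc _ = B * ε * (β k * ‖Z k‖) + (2 * B + B ^ 2 + B ^ 3) * (β k * (β k / γ k * ‖W k‖)) := by ring
    _ ≤ _ := by
      refine add_le_add le_rfl (mul_le_mul_of_nonneg_right (by linarith) h7)

lemma norm_remZ_le (hS : Setup M F β γ θs ws B ε fh h) (k : ℕ) :
    ‖remZ M F β γ θs ws fh h θ₀ w₀ x k‖
      ≤ B * ε * (β k * ‖Z k‖) + 4 * B ^ 3 * (β k * (β k / γ k * ‖W k‖))
        + 18 * B ^ 6 * (β k * γ k * g k) := by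
  have hB := hS.one_le
  have hγ := (hS.step.γ_pos k).le
  have hβ := (hS.step.β_pos k).le
  have hβγ := hS.β_le_γ k
  have hg := one_le_stateSize (M := M) (F := F) (β := β) (γ := γ) (θs := θs) (ws := ws) θ₀ w₀ x k
  have hstep := corrected_step (h := fun ij => h ij (x k)) (s' := extState F β γ θ₀ w₀ x (k + 1))
    (R' := dirZ M β γ (k + 1))
    (errZ_succ F θ₀ w₀ x hS.isUnit_A22 hS.sol (hS.step.γ_pos k).ne' (hS.L_rec k))
    (fun ij => hS.poisson_eq ij (x (k + 1)))
  have h1 := hS.norm_driftZ_le θ₀ w₀ x k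
  have h2 : ‖β k • act M.schur (noise (fun ij => h ij (x k)) (extState F β γ θ₀ w₀ x k)
      (dirZ M β γ k))‖ ≤ β k * (B * (3 * B ^ 5 * (β k * g k))) := by
    rw [norm_smul, Real.norm_of_nonneg hβ]
    exact mul_le_mul_of_nonneg_left (norm_act_le_of_le hS.norm_schur
      (hS.norm_noiseZ_le θ₀ w₀ x k)) hβ
  have h3 := norm_noise_sub_noise_le (f := fun ij => h ij (x (k + 1))) (b := B)
    (r := 3 * B ^ 2 * β k) (by linarith) (by positivity) (by positivity) (fun ij => hS.h_le ij _)
    (hS.abs_extState_le θ₀ w₀ x k) (hS.abs_extState_sub_le θ₀ w₀ x k)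
    (fun i => (hS.norm_dirZ_le (k + 1) i).trans
      (mul_le_mul_of_nonneg_left (hS.step.β_anti k) (by positivity)))
    (hS.norm_dirZ_sub_le k) hS.card_le
  have hall := norm_add_le_of_le (norm_add_le_of_le h1 h2) h3
  rw [remZ, martZ, corrZ, corrZ, hstep, add_sub_cancel_left]
  refine hall.trans ?_
  have h4 : B ^ 5 * (β k * γ k * g k) ≤ B ^ 6 * (β k * γ k * g k) :=
    mul_le_mul_of_nonneg_right (pow_le_pow_right₀ hB (by norm_num)) (by positivity)
  have h5 : 3 * B ^ 6 * (β k * β k * g k) ≤ 3 * B ^ 6 * (β k * γ k * g k) := by gcongr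
  calc _ = B * ε * (β k * ‖Z k‖) + 4 * B ^ 3 * (β k * (β k / γ k * ‖W k‖))
        + 3 * B ^ 6 * (β k * β k * g k) + 9 * (B ^ 6 * (β k * γ k * g k))
        + 6 * (B ^ 5 * (β k * γ k * g k)) := by ring
    _ ≤ _ := by linarith

section Norms

variable {J₁ J₁i : Matrix (Fin n) (Fin n) ℝ} {J₂ J₂i : Matrix (Fin m) (Fin m) ℝ}

lemma norm_errW_le (hS : Setup M F β γ θs ws B ε fh h) (hJ : J₁i * J₁ = 1) (hJi : ‖J₁i‖ ≤ B)
    (k : ℕ) : ‖W k‖ ≤ B * ‖act J₁ (yW k)‖ + 2 * B ^ 4 * (γ k * g k) := by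
  have e : W k = act J₁i (act J₁ (yW k))
      - noise (fun ij => h ij (x k)) (extState F β γ θ₀ w₀ x k) (dirW M β γ k) := by
    rw [← act_mul, hJ, act_one, corrW]; abel
  conv_lhs => rw [e]
  exact norm_sub_le_of_le (norm_act_le_of_le hJi le_rfl) (hS.norm_noiseW_le θ₀ w₀ x k)

lemma norm_errZ_le (hS : Setup M F β γ θs ws B ε fh h) (hJ : J₂i * J₂ = 1) (hJi : ‖J₂i‖ ≤ B)
    (k : ℕ) : ‖Z k‖ ≤ B * ‖act J₂ (yZ k)‖ + 3 * B ^ 5 * (β k * g k) := by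
  have e : Z k = act J₂i (act J₂ (yZ k))
      - noise (fun ij => h ij (x k)) (extState F β γ θ₀ w₀ x k) (dirZ M β γ k) := by
    rw [← act_mul, hJ, act_one, corrZ]; abel
  conv_lhs => rw [e]
  exact norm_sub_le_of_le (norm_act_le_of_le hJi le_rfl) (hS.norm_noiseZ_le θ₀ w₀ x k)

lemma norm_errTheta_le (hS : Setup M F β γ θs ws B ε fh h) (hJ₁ : J₁i * J₁ = 1)
    (hJ₁i : ‖J₁i‖ ≤ B) (hJ₂ : J₂i * J₂ = 1) (hJ₂i : ‖J₂i‖ ≤ B) (k : ℕ) :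
    ‖errTheta F β γ θ₀ w₀ θs x k‖ ≤ B * ‖act J₂ (yZ k)‖
      + B ^ 2 * (β k / γ k * ‖act J₁ (yW k)‖) + 5 * B ^ 5 * (β k * g k) := by
  have hκ := hS.κ_nonneg k
  have hB := hS.one_le
  have e : errTheta F β γ θ₀ w₀ θs x k = Z k + (β k / γ k) • act M.H (W k) := by
    rw [errZ]; abel
  rw [e]
  have h1 := hS.norm_errW_le θ₀ w₀ x hJ₁ hJ₁i k
  have h2 := hS.norm_errZ_le θ₀ w₀ x hJ₂ hJ₂i k
  have h3 : ‖(β k / γ k) • act M.H (W k)‖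
      ≤ β k / γ k * (B * (B * ‖act J₁ (yW k)‖ + 2 * B ^ 4 * (γ k * g k))) := by
    rw [norm_smul, Real.norm_of_nonneg hκ]
    exact mul_le_mul_of_nonneg_left (norm_act_le_of_le hS.norm_H h1) hκ
  refine (norm_add_le_of_le h2 h3).trans (le_of_eq ?_)
  calc _ = B * ‖act J₂ (yZ k)‖ + 3 * B ^ 5 * (β k * g k)
        + (B ^ 2 * (β k / γ k * ‖act J₁ (yW k)‖) + 2 * B ^ 5 * (β k / γ k * γ k * g k)) := by ring
    _ = _ := by rw [hS.κ_mul]; ring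

/-- The state size bounds the corrections and is itself recovered from the corrected errors, so it
occurs on both sides. Its coefficient on the right is at most (5 + 2)B⁵γ ≤ 1/2, and the term is
absorbed. -/
lemma stateSize_le (hS : Setup M F β γ θs ws B ε fh h) (hJ₁ : J₁i * J₁ = 1)
    (hJ₁i : ‖J₁i‖ ≤ B) (hJ₂ : J₂i * J₂ = 1) (hJ₂i : ‖J₂i‖ ≤ B) (k : ℕ)
    (hγ : 14 * B ^ 5 * γ k ≤ 1) :
    g k ≤ 4 * B ^ 2 * (1 + ‖act J₂ (yZ k)‖ + ‖act J₁ (yW k)‖) := by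
  have h1 := hS.norm_errW_le θ₀ w₀ x hJ₁ hJ₁i k
  have h2 := hS.norm_errTheta_le θ₀ w₀ x hJ₁ hJ₁i hJ₂ hJ₂i k
  have hB := hS.one_le
  have hκ1 := hS.κ_le_one k
  have hβγ := hS.β_le_γ k
  have hg := one_le_stateSize (M := M) (F := F) (β := β) (γ := γ) (θs := θs) (ws := ws) θ₀ w₀ x k
  have hγ0 := (hS.step.γ_pos k).le
  have e : g k = 1 + ‖errTheta F β γ θ₀ w₀ θs x k‖ + ‖W k‖ := rfl
  set G := g k
  set u := ‖act J₂ (yZ k)‖ with hu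
  set v := ‖act J₁ (yW k)‖ with hv
  have hu0 : 0 ≤ u := norm_nonneg _
  have hv0 : 0 ≤ v := norm_nonneg _
  have hBB : B ≤ B ^ 2 := by nlinarith
  have h3 : B ^ 2 * (β k / γ k * v) ≤ B ^ 2 * (1 * v) := by gcongr
  have h4 : 5 * B ^ 5 * (β k * G) ≤ 5 * B ^ 5 * (γ k * G) := by gcongr
  have h5 : 2 * B ^ 4 * (γ k * G) ≤ 2 * B ^ 5 * (γ k * G) := by
    have : B ^ 4 ≤ B ^ 5 := pow_le_pow_right₀ hB (by norm_num)
    gcongr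
  have h6 : 14 * B ^ 5 * γ k * G ≤ 1 * G := by gcongr
  have h7 : B * u ≤ B ^ 2 * u := by gcongr
  have h8 : B * v ≤ B ^ 2 * v := by gcongr
  have h9 : 1 ≤ B ^ 2 := by nlinarith
  have h10 : 0 ≤ B ^ 2 * u := by positivity
  linarith

lemma norm_act_remW_le (hS : Setup M F β γ θs ws B ε fh h) (hJ₁ : J₁i * J₁ = 1)
    (hJ₁n : ‖J₁‖ ≤ B) (hJ₁i : ‖J₁i‖ ≤ B) (k : ℕ) :
    ‖act J₁ (remW M F β γ θs ws fh h θ₀ w₀ x k)‖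
      ≤ B ^ 4 * (β k * ‖act J₁ (yW k)‖) + 13 * B ^ 7 * (γ k ^ 2 * g k) := by
  have hB := hS.one_le
  have hγ := (hS.step.γ_pos k).le
  have hβ := (hS.step.β_pos k).le
  have hβγ := hS.β_le_γ k
  have hg := one_le_stateSize (M := M) (F := F) (β := β) (γ := γ) (θs := θs) (ws := ws) θ₀ w₀ x k
  have h1 := hS.norm_errW_le θ₀ w₀ x hJ₁ hJ₁i k
  refine (norm_act_le_of_le hJ₁n (hS.norm_remW_le θ₀ w₀ x k)).trans ?_
  calc _ ≤ B * (B ^ 2 * (β k * (B * ‖act J₁ (yW k)‖ + 2 * B ^ 4 * (γ k * g k)))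
        + 11 * B ^ 5 * (γ k ^ 2 * g k)) := by gcongr
    _ = B ^ 4 * (β k * ‖act J₁ (yW k)‖) + 2 * B ^ 7 * (β k * γ k * g k)
        + 11 * B ^ 6 * (γ k ^ 2 * g k) := by ring
    _ ≤ B ^ 4 * (β k * ‖act J₁ (yW k)‖) + 2 * B ^ 7 * (γ k * γ k * g k)
        + 11 * B ^ 7 * (γ k ^ 2 * g k) := by
      have : B ^ 6 ≤ B ^ 7 := pow_le_pow_right₀ hB (by norm_num)
      gcongr
    _ = _ := by ring

lemma norm_act_remZ_le (hS : Setup M F β γ θs ws B ε fh h) (hε : 0 ≤ ε) (hε1 : ε ≤ 1)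
    (hJ₁ : J₁i * J₁ = 1) (hJ₁i : ‖J₁i‖ ≤ B) (hJ₂ : J₂i * J₂ = 1) (hJ₂n : ‖J₂‖ ≤ B)
    (hJ₂i : ‖J₂i‖ ≤ B) (k : ℕ) :
    ‖act J₂ (remZ M F β γ θs ws fh h θ₀ w₀ x k)‖
      ≤ B ^ 3 * ε * (β k * ‖act J₂ (yZ k)‖) + 4 * B ^ 5 * (β k * (β k / γ k * ‖act J₁ (yW k)‖))
        + 29 * B ^ 8 * (β k * γ k * g k) := by
  have hB := hS.one_le
  have hγ := (hS.step.γ_pos k).le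
  have hβ := (hS.step.β_pos k).le
  have hβγ := hS.β_le_γ k
  have hκ := hS.κ_nonneg k
  have hκ1 := hS.κ_le_one k
  have hg := one_le_stateSize (M := M) (F := F) (β := β) (γ := γ) (θs := θs) (ws := ws) θ₀ w₀ x k
  have h1 := hS.norm_errW_le θ₀ w₀ x hJ₁ hJ₁i k
  have h2 := hS.norm_errZ_le θ₀ w₀ x hJ₂ hJ₂i k
  refine (norm_act_le_of_le hJ₂n (hS.norm_remZ_le θ₀ w₀ x k)).trans ?_
  calc _ ≤ B * (B * ε * (β k * (B * ‖act J₂ (yZ k)‖ + 3 * B ^ 5 * (β k * g k)))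
        + 4 * B ^ 3 * (β k * (β k / γ k * (B * ‖act J₁ (yW k)‖ + 2 * B ^ 4 * (γ k * g k))))
        + 18 * B ^ 6 * (β k * γ k * g k)) := by gcongr
    _ = B ^ 3 * ε * (β k * ‖act J₂ (yZ k)‖) + 4 * B ^ 5 * (β k * (β k / γ k * ‖act J₁ (yW k)‖))
        + (3 * B ^ 7 * (ε * (β k * β k * g k)) + 8 * B ^ 8 * (β k * (β k / γ k * (γ k * g k)))
          + 18 * B ^ 7 * (β k * γ k * g k)) := by ring
    _ ≤ B ^ 3 * ε * (β k * ‖act J₂ (yZ k)‖) + 4 * B ^ 5 * (β k * (β k / γ k * ‖act J₁ (yW k)‖))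
        + (3 * B ^ 8 * (1 * (β k * γ k * g k)) + 8 * B ^ 8 * (β k * (1 * (γ k * g k)))
          + 18 * B ^ 8 * (β k * γ k * g k)) := by
      have : B ^ 7 ≤ B ^ 8 := pow_le_pow_right₀ hB (by norm_num)
      gcongr
    _ = _ := by ring

end Norms

end Setup

/-! ### Measurability along the chain -/

section Measurability

variable {m n : ℕ} {Ω : Type*}

lemma IsBddMeas.noise {d : ℕ} {ℱ : MeasurableSpace Ω}
    {f : (Fin m ⊕ Fin n) × Option (Fin m ⊕ Fin n) → Ω → ℝ} {s : Ω → Option (Fin m ⊕ Fin n) → ℝ}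
    (hf : ∀ ij, IsBddMeas ℱ (f ij)) (hs : ∀ j, IsBddMeas ℱ fun ω => s ω j)
    (R : Fin m ⊕ Fin n → Vec d) : IsBddMeas ℱ fun ω => noise (fun ij => f ij ω) (s ω) R :=
  IsBddMeas.sum Finset.univ fun ij => (hf ij).smul ((hs ij.2).smul (IsBddMeas.const (R ij.1)))

lemma IsBddMeas.extend {ℱ : MeasurableSpace Ω} {θ : Ω → Vec m} {w : Ω → Vec n}
    (hθ : IsBddMeas ℱ θ) (hw : IsBddMeas ℱ w) (j : Option (Fin m ⊕ Fin n)) :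
    IsBddMeas ℱ fun ω => extend (θ ω) (w ω) j := by
  rcases j with _ | j | j
  · exact IsBddMeas.const 1
  · exact hθ.clm (EuclideanSpace.proj (𝕜 := ℝ) j)
  · exact hw.clm (EuclideanSpace.proj (𝕜 := ℝ) j)

end Measurability

/-- The pathwise setup along a Markov chain with kernel `P`: `h` is the image of `fh` under `P`. -/
structure ChainSetup {m n : ℕ} {S : Type*} [MeasurableSpace S] (P : Kernel S S) (M : Coeffs m n)
    (F : S → Coeffs m n) (β γ : ℕ → ℝ) (θs : Vec m) (ws : Vec n) (B ε : ℝ)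
    (fh h : (Fin m ⊕ Fin n) × Option (Fin m ⊕ Fin n) → S → ℝ) : Prop
    extends Setup M F β γ θs ws B ε fh h where
  meas_fh : ∀ ij, Measurable (fh ij)
  h_eq : ∀ ij y, h ij y = ∫ z, fh ij z ∂(P y)

namespace ChainSetup

variable {m n : ℕ} {S : Type*} [MeasurableSpace S] {P : Kernel S S}
  {M : Coeffs m n} {F : S → Coeffs m n} {β γ : ℕ → ℝ} {θs : Vec m} {ws : Vec n} {B ε : ℝ}
  {fh h : (Fin m ⊕ Fin n) × Option (Fin m ⊕ Fin n) → S → ℝ}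
  (θ₀ : Vec m) (w₀ : Vec n) {Ω : Type*} (X : ℕ → Ω → S)

lemma meas_h (hS : ChainSetup P M F β γ θs ws B ε fh h) (ij) : Measurable (h ij) := by
  rw [funext (hS.h_eq ij)]
  exact (hS.meas_fh ij).stronglyMeasurable.integral_kernel.measurable

variable {X} in
lemma isBddMeas_fh (hS : ChainSetup P M F β γ θs ws B ε fh h) {ℱ : MeasurableSpace Ω} {j : ℕ}
    (hX : Measurable[ℱ] (X j)) (ij) : IsBddMeas ℱ fun ω => fh ij (X j ω) :=
  ⟨((hS.meas_fh ij).comp hX).stronglyMeasurable, B, fun _ => hS.fh_le ij _⟩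

variable {X} in
lemma isBddMeas_h (hS : ChainSetup P M F β γ θs ws B ε fh h) {ℱ : MeasurableSpace Ω} {j : ℕ}
    (hX : Measurable[ℱ] (X j)) (ij) : IsBddMeas ℱ fun ω => h ij (X j ω) :=
  ⟨((hS.meas_h ij).comp hX).stronglyMeasurable, B, fun _ => hS.h_le ij _⟩

/-- The bounds obtained here depend on k; they serve integrability only, while the uniform estimates
come from the moment recursions. -/
lemma isBddMeas_iter (hS : ChainSetup P M F β γ θs ws B ε fh h) (k : ℕ) :
    IsBddMeas (pastSigma X k) (fun ω => (iter F β γ θ₀ w₀ (fun j => X j ω) k).1) ∧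
    IsBddMeas (pastSigma X k) (fun ω => (iter F β γ θ₀ w₀ (fun j => X j ω) k).2) := by
  induction k with
  | zero => exact ⟨IsBddMeas.const θ₀, IsBddMeas.const w₀⟩
  | succ k ih =>
    have h1 := ih.1.mono (pastSigma_mono (X := X) k.le_succ)
    have h2 := ih.2.mono (pastSigma_mono (X := X) k.le_succ)
    have hX := measurable_pastSigma (X := X) (Nat.le_add_left 1 k) le_rfl
    have hdev : ∀ ij, IsBddMeas (pastSigma X (k + 1)) fun ω => dev M F ij (X (k + 1) ω) := by
      intro ij
      simp only [hS.poisson_eq]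
      exact (hS.isBddMeas_fh hX ij).sub (hS.isBddMeas_h hX ij)
    constructor
    · simp only [iter_succ_fst M F]
      exact h1.add ((((IsBddMeas.const M.b1).sub (h1.act M.A11)).sub (h2.act M.A12)).add
        (IsBddMeas.noise hdev (IsBddMeas.extend h1 h2) basisTheta) |>.const_smul (β k))
    · simp only [iter_succ_snd M F]
      exact h2.add ((((IsBddMeas.const M.b2).sub (h1.act M.A21)).sub (h2.act M.A22)).add
        (IsBddMeas.noise hdev (IsBddMeas.extend h1 h2) basisW) |>.const_smul (γ k))

lemma isBddMeas_extState (hS : ChainSetup P M F β γ θs ws B ε fh h) (k : ℕ) (j) :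
    IsBddMeas (pastSigma X k) fun ω => extState F β γ θ₀ w₀ (fun j => X j ω) k j :=
  IsBddMeas.extend (hS.isBddMeas_iter θ₀ w₀ X k).1 (hS.isBddMeas_iter θ₀ w₀ X k).2 j

lemma isBddMeas_errTheta (hS : ChainSetup P M F β γ θs ws B ε fh h) (k : ℕ) :
    IsBddMeas (pastSigma X k) fun ω => errTheta F β γ θ₀ w₀ θs (fun j => X j ω) k :=
  (hS.isBddMeas_iter θ₀ w₀ X k).1.sub (IsBddMeas.const θs)

lemma isBddMeas_errW (hS : ChainSetup P M F β γ θs ws B ε fh h) (k : ℕ) :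
    IsBddMeas (pastSigma X k) fun ω => errW M F β γ θ₀ w₀ θs ws (fun j => X j ω) k :=
  ((hS.isBddMeas_iter θ₀ w₀ X k).2.sub (IsBddMeas.const ws)).add
    ((hS.isBddMeas_errTheta θ₀ w₀ X k).act _)

/-- The correction evaluates Pf̂ at X_k, and the filtration starts with X_1; hence k ≥ 1 here and in
the moment recursions. -/
lemma isBddMeas_corrW (hS : ChainSetup P M F β γ θs ws B ε fh h) {k : ℕ} (hk : 1 ≤ k) :
    IsBddMeas (pastSigma X k) fun ω => corrW M F β γ θs ws h θ₀ w₀ (fun j => X j ω) k :=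
  (hS.isBddMeas_errW θ₀ w₀ X k).add (IsBddMeas.noise
    (hS.isBddMeas_h (measurable_pastSigma hk le_rfl)) (hS.isBddMeas_extState θ₀ w₀ X k) _)

lemma isBddMeas_corrZ (hS : ChainSetup P M F β γ θs ws B ε fh h) {k : ℕ} (hk : 1 ≤ k) :
    IsBddMeas (pastSigma X k) fun ω => corrZ M F β γ θs ws h θ₀ w₀ (fun j => X j ω) k :=
  ((hS.isBddMeas_errTheta θ₀ w₀ X k).sub
    (((hS.isBddMeas_errW θ₀ w₀ X k).act M.H).const_smul _)).add (IsBddMeas.noise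
    (hS.isBddMeas_h (measurable_pastSigma hk le_rfl)) (hS.isBddMeas_extState θ₀ w₀ X k) _)

variable {X} [mΩ : MeasurableSpace Ω] {μ : Measure Ω}

lemma isBddMeas_increment (hS : ChainSetup P M F β γ θs ws B ε fh h) (hX : IsMarkovChain μ P X)
    {d : ℕ} (R : Fin m ⊕ Fin n → Vec d) (k : ℕ) :
    IsBddMeas mΩ fun ω => noise (fun ij => fh ij (X (k + 1) ω) - h ij (X k ω))
      (extState F β γ θ₀ w₀ (fun j => X j ω) k) R :=
  IsBddMeas.noise
    (fun ij => (hS.isBddMeas_fh (hX.measurable _) ij).sub (hS.isBddMeas_h (hX.measurable _) ij))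
    (fun j => (hS.isBddMeas_extState θ₀ w₀ X k j).mono (pastSigma_le hX.measurable k)) R

variable [IsMarkovKernel P] [IsProbabilityMeasure μ]

lemma integral_increment_eq_zero (hS : ChainSetup P M F β γ θs ws B ε fh h)
    (hX : IsMarkovChain μ P X) {d : ℕ} (R : Fin m ⊕ Fin n → Vec d) {k : ℕ} (hk : 1 ≤ k)
    {J : Matrix (Fin d) (Fin d) ℝ} {Z : Ω → Vec d} (hZ : IsBddMeas (pastSigma X k) Z) {q : ℝ}
    (hq : 0 ≤ q) :
    ∫ ω, ‖Z ω‖ ^ q * inner ℝ (Z ω) (act J (noise (fun ij => fh ij (X (k + 1) ω) - h ij (X k ω))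
      (extState F β γ θ₀ w₀ (fun j => X j ω) k) R)) ∂μ = 0 := by
  simp only [hS.h_eq]
  exact hX.integral_rpow_inner_eq_zero hk hS.meas_fh hS.fh_le hZ
    (fun ij => (hS.isBddMeas_extState θ₀ w₀ X k ij.2).smul (IsBddMeas.const (R ij.1))) hq

end ChainSetup

/-! ### Recursions for the squared `L^p` norms -/

section Moments

variable {Ω : Type*} [mΩ : MeasurableSpace Ω] {μ : Measure Ω} [IsProbabilityMeasure μ]

lemma lpNorm_le_of_norm_le_one_add {E F₁ F₂ : Type*} [NormedAddCommGroup E]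
    [NormedAddCommGroup F₁] [NormedAddCommGroup F₂] {f : Ω → E} {g₁ : Ω → F₁} {g₂ : Ω → F₂}
    {c₁ c₂ c₃ : ℝ} (h₁ : 0 ≤ c₁) (h₂ : 0 ≤ c₂) (h₃ : 0 ≤ c₃)
    (hg₁ : IsBddMeas mΩ g₁) (hg₂ : IsBddMeas mΩ g₂) {p : ℝ≥0∞}
    (hp : 1 ≤ p) (h : ∀ ω, ‖f ω‖ ≤ c₁ * ‖g₁ ω‖ + c₂ * ‖g₂ ω‖ + c₃) :
    lpNorm f p μ ≤ c₁ * lpNorm g₁ p μ + c₂ * lpNorm g₂ p μ + c₃ := by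
  have h1 : lpNorm (fun _ : Ω => (1 : ℝ)) p μ = 1 := by
    rw [lpNorm_const (one_pos.trans_le hp).ne' (IsProbabilityMeasure.ne_zero μ)]
    simp
  have := lpNorm_le_of_norm_le (μ := μ) (g₃ := fun _ : Ω => (1 : ℝ)) h₁ h₂ h₃ hg₁ hg₂
    (IsBddMeas.const 1) hp (f := f) (by simpa using h)
  rwa [h1, mul_one] at this

end Moments

namespace ChainSetup

variable {m n : ℕ} {S : Type*} [MeasurableSpace S] {P : Kernel S S}
  {M : Coeffs m n} {F : S → Coeffs m n} {β γ : ℕ → ℝ} {θs : Vec m} {ws : Vec n} {B ε : ℝ}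
  {fh h : (Fin m ⊕ Fin n) × Option (Fin m ⊕ Fin n) → S → ℝ}

/-- The `L^p` norm of the corrected fast error, in the norm given by `J`. -/
noncomputable def _root_.TTSA.momentW (M : Coeffs m n) (F : S → Coeffs m n) (β γ : ℕ → ℝ)
    (θs : Vec m) (ws : Vec n) (h : (Fin m ⊕ Fin n) × Option (Fin m ⊕ Fin n) → S → ℝ)
    (θ₀ : Vec m) (w₀ : Vec n) {Ω : Type*} [MeasurableSpace Ω] (μ : Measure Ω) (X : ℕ → Ω → S)
    (p : ℝ) (J : Matrix (Fin n) (Fin n) ℝ) (k : ℕ) : ℝ :=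
  lpNorm (fun ω => act J (corrW M F β γ θs ws h θ₀ w₀ (fun j => X j ω) k)) (ENNReal.ofReal p) μ

/-- The `L^p` norm of the corrected slow error, in the norm given by `J`. -/
noncomputable def _root_.TTSA.momentZ (M : Coeffs m n) (F : S → Coeffs m n) (β γ : ℕ → ℝ)
    (θs : Vec m) (ws : Vec n) (h : (Fin m ⊕ Fin n) × Option (Fin m ⊕ Fin n) → S → ℝ)
    (θ₀ : Vec m) (w₀ : Vec n) {Ω : Type*} [MeasurableSpace Ω] (μ : Measure Ω) (X : ℕ → Ω → S)
    (p : ℝ) (J : Matrix (Fin m) (Fin m) ℝ) (k : ℕ) : ℝ :=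
  lpNorm (fun ω => act J (corrZ M F β γ θs ws h θ₀ w₀ (fun j => X j ω) k)) (ENNReal.ofReal p) μ

variable (θ₀ : Vec m) (w₀ : Vec n) {Ω : Type*} {X : ℕ → Ω → S} [mΩ : MeasurableSpace Ω]
  {μ : Measure Ω} [IsProbabilityMeasure μ] [IsMarkovKernel P]
  {J₁ J₁i : Matrix (Fin n) (Fin n) ℝ} {J₂ J₂i : Matrix (Fin m) (Fin m) ℝ}

local notation "V" => momentW M F β γ θs ws h θ₀ w₀ μ X
local notation "U" => momentZ M F β γ θs ws h θ₀ w₀ μ X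

/-- The centred part, of size γ, contributes p²γ². The remainder, of size γ², contributes γ⁴/γ = γ³
≤ p²γ². The coupling B⁴β is below aγ/8 and is paid for by the contraction. -/
lemma momentW_sq_succ_le (hS : ChainSetup P M F β γ θs ws B ε fh h) (hX : IsMarkovChain μ P X)
    (hJ₁ : J₁i * J₁ = 1) (hJ₁n : ‖J₁‖ ≤ B) (hJ₁i : ‖J₁i‖ ≤ B) (hJ₂ : J₂i * J₂ = 1)
    (hJ₂i : ‖J₂i‖ ≤ B) {p : ℝ} (hp : 2 ≤ p) {a : ℝ} (ha : 0 < a) {k : ℕ} (hk : 1 ≤ k)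
    (hγ : 14 * B ^ 5 * γ k ≤ 1) (haγ : a * γ k ≤ 1 / 2)
    (hcon : ∀ x, ‖act J₁ (x - γ k • act M.A22 x)‖ ≤ (1 - a * γ k) * ‖act J₁ x‖)
    (hβ : B ^ 4 * β k ≤ a / 8 * γ k) :
    V p J₁ (k + 1) ^ 2 ≤ (1 - a / 2 * γ k) * V p J₁ k ^ 2
      + (41472 * B ^ 14 + 40560 * B ^ 18 / a) * (p ^ 2 * γ k ^ 2)
        * (1 + V p J₁ k ^ 2 + U p J₂ k ^ 2) := by
  have hB := hS.one_le
  have hγ0 := hS.step.γ_pos k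
  have hp1 : 1 ≤ ENNReal.ofReal p := ENNReal.one_le_ofReal.mpr (by linarith)
  have hle := pastSigma_le hX.measurable k
  have iW := hS.isBddMeas_corrW θ₀ w₀ X hk
  have iZ := hS.isBddMeas_corrZ θ₀ w₀ X hk
  have iv : IsBddMeas mΩ fun ω => act J₁ (corrW M F β γ θs ws h θ₀ w₀ (fun j => X j ω) k) :=
    (iW.act J₁).mono hle
  have iu : IsBddMeas mΩ fun ω => act J₂ (corrZ M F β γ θs ws h θ₀ w₀ (fun j => X j ω) k) :=
    (iZ.act J₂).mono hle
  have iD := hS.isBddMeas_increment θ₀ w₀ hX (dirW M β γ k) k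
  have horth := hS.integral_increment_eq_zero θ₀ w₀ hX (dirW M β γ k) hk (J := J₁)
    ((iW.sub ((iW.act M.A22).const_smul (γ k))).act J₁) (sub_nonneg.mpr hp)
  have hrem : lpNorm (fun ω => act J₁ (remW M F β γ θs ws fh h θ₀ w₀ (fun j => X j ω) k))
      (ENNReal.ofReal p) μ ≤ (B ^ 4 * β k + 52 * B ^ 9 * γ k ^ 2) * V p J₁ k
        + 52 * B ^ 9 * γ k ^ 2 * U p J₂ k + 52 * B ^ 9 * γ k ^ 2 := by
    have hβ0 := hS.step.β_pos k
    refine lpNorm_le_of_norm_le_one_add (by positivity) (by positivity) (by positivity) iv iu hp1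
      fun ω => ?_
    have h1 := hS.norm_act_remW_le θ₀ w₀ (fun j => X j ω) hJ₁ hJ₁n hJ₁i k
    have h2 := hS.stateSize_le θ₀ w₀ (fun j => X j ω) hJ₁ hJ₁i hJ₂ hJ₂i k hγ
    have h3 := mul_le_mul_of_nonneg_left h2 (by positivity : 0 ≤ 13 * B ^ 7 * γ k ^ 2)
    linarith
  have hmart : lpNorm (fun ω => act J₁ (martW M F β γ fh h θ₀ w₀ (fun j => X j ω) k))
      (ENNReal.ofReal p) μ ≤ 16 * B ^ 7 * γ k * V p J₁ k
        + 16 * B ^ 7 * γ k * U p J₂ k + 16 * B ^ 7 * γ k := by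
    refine lpNorm_le_of_norm_le_one_add (by positivity) (by positivity) (by positivity) iv iu hp1
      fun ω => ?_
    have h1 := norm_act_le_of_le hJ₁n (hS.norm_martW_le θ₀ w₀ (fun j => X j ω) k)
    have h2 := hS.stateSize_le θ₀ w₀ (fun j => X j ω) hJ₁ hJ₁i hJ₂ hJ₂i k hγ
    have h3 := mul_le_mul_of_nonneg_left h2 (by positivity : 0 ≤ 4 * B ^ 5 * γ k)
    linarith
  have hV0 : 0 ≤ V p J₁ k := lpNorm_nonneg
  have hU0 : 0 ≤ U p J₂ k := lpNorm_nonneg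
  have hstep := lpNorm_step_sq_le (μ := μ) (mul_pos ha hγ0) haγ hcon hp (iW.mono hle) iD
    (Y' := fun ω => corrW M F β γ θs ws h θ₀ w₀ (fun j => X j ω) (k + 1))
    (e := fun ω => remW M F β γ θs ws fh h θ₀ w₀ (fun j => X j ω) k)
    (fun ω => by rw [remW, martW]; abel) horth
    (ε := 52 * B ^ 9 * γ k ^ 2 * (1 + V p J₁ k + U p J₂ k))
    (hrem.trans (by
      have : B ^ 4 * β k * V p J₁ k ≤ a / 8 * γ k * V p J₁ k := by gcongr
      rw [← momentW]
      linarith))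
  refine hstep.trans ?_
  have hsq : (1 + V p J₁ k + U p J₂ k) ^ 2 ≤ 3 * (1 + V p J₁ k ^ 2 + U p J₂ k ^ 2) := by
    nlinarith [sq_nonneg (V p J₁ k - 1), sq_nonneg (U p J₂ k - 1),
      sq_nonneg (V p J₁ k - U p J₂ k)]
  have hD2 : lpNorm (fun ω => act J₁ (martW M F β γ fh h θ₀ w₀ (fun j => X j ω) k))
      (ENNReal.ofReal p) μ ^ 2
      ≤ (16 * B ^ 7 * γ k) ^ 2 * (3 * (1 + V p J₁ k ^ 2 + U p J₂ k ^ 2)) := by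
    calc _ ≤ (16 * B ^ 7 * γ k * V p J₁ k
        + 16 * B ^ 7 * γ k * U p J₂ k + 16 * B ^ 7 * γ k) ^ 2 :=
          pow_le_pow_left₀ lpNorm_nonneg hmart 2
      _ = (16 * B ^ 7 * γ k) ^ 2 * (1 + V p J₁ k + U p J₂ k) ^ 2 := by ring
      _ ≤ _ := by gcongr
  have he2 : 5 / (a * γ k) * (52 * B ^ 9 * γ k ^ 2 * (1 + V p J₁ k + U p J₂ k)) ^ 2
      ≤ 40560 * B ^ 18 / a * (p ^ 2 * γ k ^ 2) * (1 + V p J₁ k ^ 2 + U p J₂ k ^ 2) := by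
    calc _ = 13520 * B ^ 18 / a * (γ k * γ k ^ 2) * (1 + V p J₁ k + U p J₂ k) ^ 2 := by
          field_simp; ring
      _ ≤ 13520 * B ^ 18 / a * (p ^ 2 * γ k ^ 2) * (3 * (1 + V p J₁ k ^ 2 + U p J₂ k ^ 2)) := by
        have : γ k ≤ p ^ 2 := (hS.γ_le_one k).trans (by nlinarith)
        gcongr
      _ = _ := by ring
  have hD3 := mul_le_mul_of_nonneg_left hD2 (by positivity : 0 ≤ 2 * (27 * p ^ 2))
  have e : (fun ω => act J₁ (noise (fun ij => fh ij (X (k + 1) ω) - h ij (X k ω))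
      (extState F β γ θ₀ w₀ (fun j => X j ω) k) (dirW M β γ k)))
      = fun ω => act J₁ (martW M F β γ fh h θ₀ w₀ (fun j => X j ω) k) := rfl
  rw [e, ← momentW]
  linarith

/-- The drift βκw̃ contributes (βκ)²/β = βκ² to the square, the centred part p²β², and the remainder
(βγ)²/β = βγ². The perturbation of size B³εβ is absorbed by the contraction. -/
lemma momentZ_sq_succ_le (hS : ChainSetup P M F β γ θs ws B ε fh h) (hX : IsMarkovChain μ P X)
    (hε : 0 ≤ ε) (hε1 : ε ≤ 1)
    (hJ₁ : J₁i * J₁ = 1) (hJ₁i : ‖J₁i‖ ≤ B) (hJ₂ : J₂i * J₂ = 1) (hJ₂n : ‖J₂‖ ≤ B)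
    (hJ₂i : ‖J₂i‖ ≤ B) {p : ℝ} (hp : 2 ≤ p) {a : ℝ} (ha : 0 < a) {k : ℕ} (hk : 1 ≤ k)
    (hγ : 14 * B ^ 5 * γ k ≤ 1) (haβ : a * β k ≤ 1 / 2)
    (hcon : ∀ x, ‖act J₂ (x - β k • act M.schur x)‖ ≤ (1 - a * β k) * ‖act J₂ x‖)
    (hBε : B ^ 3 * ε ≤ a / 8) :
    U p J₂ (k + 1) ^ 2 ≤ (1 - a / 2 * β k) * U p J₂ k ^ 2
      + 160 * B ^ 10 / a * (β k * (β k / γ k) ^ 2) * V p J₁ k ^ 2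
      + (93312 * B ^ 16 + 403680 * B ^ 20 / a) * (p ^ 2 * β k ^ 2)
        * (1 + V p J₁ k ^ 2 + U p J₂ k ^ 2) := by
  have hB := hS.one_le
  have hγ0 := hS.step.γ_pos k
  have hβ0 := hS.step.β_pos k
  have hκ := hS.κ_nonneg k
  have hp1 : 1 ≤ ENNReal.ofReal p := ENNReal.one_le_ofReal.mpr (by linarith)
  have hle := pastSigma_le hX.measurable k
  have iW := hS.isBddMeas_corrW θ₀ w₀ X hk
  have iZ := hS.isBddMeas_corrZ θ₀ w₀ X hk
  have iv : IsBddMeas mΩ fun ω => act J₁ (corrW M F β γ θs ws h θ₀ w₀ (fun j => X j ω) k) :=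
    (iW.act J₁).mono hle
  have iu : IsBddMeas mΩ fun ω => act J₂ (corrZ M F β γ θs ws h θ₀ w₀ (fun j => X j ω) k) :=
    (iZ.act J₂).mono hle
  have iD := hS.isBddMeas_increment θ₀ w₀ hX (dirZ M β γ k) k
  have horth := hS.integral_increment_eq_zero θ₀ w₀ hX (dirZ M β γ k) hk (J := J₂)
    ((iZ.sub ((iZ.act M.schur).const_smul (β k))).act J₂) (sub_nonneg.mpr hp)
  have hrem : lpNorm (fun ω => act J₂ (remZ M F β γ θs ws fh h θ₀ w₀ (fun j => X j ω) k))
      (ENNReal.ofReal p) μ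
      ≤ (4 * B ^ 5 * (β k * (β k / γ k)) + 116 * B ^ 10 * (β k * γ k)) * V p J₁ k
        + (B ^ 3 * ε * β k + 116 * B ^ 10 * (β k * γ k)) * U p J₂ k
        + 116 * B ^ 10 * (β k * γ k) := by
    refine lpNorm_le_of_norm_le_one_add (by positivity) (by positivity) (by positivity) iv iu hp1
      fun ω => ?_
    have h1 := hS.norm_act_remZ_le θ₀ w₀ (fun j => X j ω) hε hε1 hJ₁ hJ₁i hJ₂ hJ₂n hJ₂i k
    have h2 := hS.stateSize_le θ₀ w₀ (fun j => X j ω) hJ₁ hJ₁i hJ₂ hJ₂i k hγ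
    have h3 := mul_le_mul_of_nonneg_left h2 (by positivity : 0 ≤ 29 * B ^ 8 * (β k * γ k))
    linarith
  have hmart : lpNorm (fun ω => act J₂ (martZ M F β γ fh h θ₀ w₀ (fun j => X j ω) k))
      (ENNReal.ofReal p) μ ≤ 24 * B ^ 8 * β k * V p J₁ k
        + 24 * B ^ 8 * β k * U p J₂ k + 24 * B ^ 8 * β k := by
    refine lpNorm_le_of_norm_le_one_add (by positivity) (by positivity) (by positivity) iv iu hp1
      fun ω => ?_
    have h1 := norm_act_le_of_le hJ₂n (hS.norm_martZ_le θ₀ w₀ (fun j => X j ω) k)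
    have h2 := hS.stateSize_le θ₀ w₀ (fun j => X j ω) hJ₁ hJ₁i hJ₂ hJ₂i k hγ
    have h3 := mul_le_mul_of_nonneg_left h2 (by positivity : 0 ≤ 6 * B ^ 6 * β k)
    linarith
  have hV0 : 0 ≤ V p J₁ k := lpNorm_nonneg
  have hU0 : 0 ≤ U p J₂ k := lpNorm_nonneg
  have hstep := lpNorm_step_sq_le (μ := μ) (mul_pos ha hβ0) haβ hcon hp (iZ.mono hle) iD
    (Y' := fun ω => corrZ M F β γ θs ws h θ₀ w₀ (fun j => X j ω) (k + 1))
    (e := fun ω => remZ M F β γ θs ws fh h θ₀ w₀ (fun j => X j ω) k)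
    (fun ω => by rw [remZ, martZ]; abel) horth
    (ε := 4 * B ^ 5 * (β k * (β k / γ k)) * V p J₁ k
      + 116 * B ^ 10 * (β k * γ k) * (1 + V p J₁ k + U p J₂ k))
    (hrem.trans (by
      have : B ^ 3 * ε * β k * U p J₂ k ≤ a / 8 * β k * U p J₂ k := by gcongr
      rw [← momentZ]
      linarith))
  refine hstep.trans ?_
  have hsq : (1 + V p J₁ k + U p J₂ k) ^ 2 ≤ 3 * (1 + V p J₁ k ^ 2 + U p J₂ k ^ 2) := by
    nlinarith [sq_nonneg (V p J₁ k - 1), sq_nonneg (U p J₂ k - 1),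
      sq_nonneg (V p J₁ k - U p J₂ k)]
  have hD2 : lpNorm (fun ω => act J₂ (martZ M F β γ fh h θ₀ w₀ (fun j => X j ω) k))
      (ENNReal.ofReal p) μ ^ 2
      ≤ (24 * B ^ 8 * β k) ^ 2 * (3 * (1 + V p J₁ k ^ 2 + U p J₂ k ^ 2)) := by
    calc _ ≤ (24 * B ^ 8 * β k * V p J₁ k
        + 24 * B ^ 8 * β k * U p J₂ k + 24 * B ^ 8 * β k) ^ 2 :=
          pow_le_pow_left₀ lpNorm_nonneg hmart 2
      _ = (24 * B ^ 8 * β k) ^ 2 * (1 + V p J₁ k + U p J₂ k) ^ 2 := by ring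
      _ ≤ _ := by gcongr
  have he2 : 5 / (a * β k) * (4 * B ^ 5 * (β k * (β k / γ k)) * V p J₁ k
      + 116 * B ^ 10 * (β k * γ k) * (1 + V p J₁ k + U p J₂ k)) ^ 2
      ≤ 160 * B ^ 10 / a * (β k * (β k / γ k) ^ 2) * V p J₁ k ^ 2
        + 403680 * B ^ 20 / a * (p ^ 2 * β k ^ 2) * (1 + V p J₁ k ^ 2 + U p J₂ k ^ 2) := by
    calc _ ≤ 5 / (a * β k) * (2 * ((4 * B ^ 5 * (β k * (β k / γ k)) * V p J₁ k) ^ 2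
          + (116 * B ^ 10 * (β k * γ k) * (1 + V p J₁ k + U p J₂ k)) ^ 2)) := by
          gcongr
          exact add_sq_le
      _ = 160 * B ^ 10 / a * (β k * (β k / γ k) ^ 2) * V p J₁ k ^ 2
          + 134560 * B ^ 20 / a * (1 * (β k * γ k ^ 2)) * (1 + V p J₁ k + U p J₂ k) ^ 2 := by
        field_simp; ring
      _ ≤ 160 * B ^ 10 / a * (β k * (β k / γ k) ^ 2) * V p J₁ k ^ 2
          + 134560 * B ^ 20 / a * (p ^ 2 * (β k * β k))
            * (3 * (1 + V p J₁ k ^ 2 + U p J₂ k ^ 2)) := by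
        -- This comparison turns βγ² into β², keeping the Poisson remainder at the order of the slow
        -- noise.
        have h1 : γ k ^ 2 ≤ β k := by simpa using hS.step.γ_sq_le k
        have h2 : 1 ≤ p ^ 2 := by nlinarith
        gcongr
      _ = _ := by ring
  have hD3 := mul_le_mul_of_nonneg_left hD2 (by positivity : 0 ≤ 2 * (27 * p ^ 2))
  have e : (fun ω => act J₂ (noise (fun ij => fh ij (X (k + 1) ω) - h ij (X k ω))
      (extState F β γ θ₀ w₀ (fun j => X j ω) k) (dirZ M β γ k)))
      = fun ω => act J₂ (martZ M F β γ fh h θ₀ w₀ (fun j => X j ω) k) := rfl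
  rw [e, ← momentZ]
  linarith

end ChainSetup

/-! ### From recursions to rates -/

lemma StepCond.shift {δ p : ℝ} {β γ : ℕ → ℝ} (h : StepCond δ p β γ) :
    StepCond δ p (fun k => β (k + 1)) (fun k => γ (k + 1)) where
  β_pos _ := h.β_pos _
  γ_pos _ := h.γ_pos _
  β_le _ := h.β_le _
  γ_le _ := h.γ_le _
  γ_sq_le _ := h.γ_sq_le _
  β_anti _ := h.β_anti _
  γ_anti _ := h.γ_anti _
  κ_anti _ := h.κ_anti _
  β_diff _ := h.β_diff _
  γ_diff _ := h.γ_diff _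
  κ_diff _ := h.κ_diff _

/-- Taking the root uses 1 − xc/2 ≤ (1 − xc/8)². The product in the hypothesis starts at index 1;
the missing factor at 0 is at least 1/2 and accounts for the 2. -/
lemma le_sqrt_mul_of_sq_le {v C p x : ℝ} {c : ℕ → ℝ} (hp : 0 ≤ p) (hC : 0 ≤ C)
    (hx : 0 ≤ x) (hc0 : ∀ j, 0 ≤ c j) (hc1 : ∀ j, x * c j ≤ 1 / 2)
    {k : ℕ} (h : v ^ 2 ≤ C * (∏ j ∈ Finset.range k, (1 - x / 2 * c (j + 1)) + p ^ 2 * c (k + 1))) :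
    v ≤ √C * (2 * ∏ j ∈ Finset.range (k + 1), (1 - x * c j / 8) + p * √(c (k + 1))) := by
  have hpos : ∀ j, 0 ≤ 1 - x * c j / 8 := fun j => by linarith [hc1 j]
  set q := ∏ j ∈ Finset.range k, (1 - x * c (j + 1) / 8) with hq
  have hq0 : 0 ≤ q := Finset.prod_nonneg fun j _ => hpos _
  have h1 : ∏ j ∈ Finset.range k, (1 - x / 2 * c (j + 1)) ≤ q ^ 2 := by
    rw [hq, ← Finset.prod_pow]
    refine Finset.prod_le_prod (fun j _ => by linarith [hc1 (j + 1)]) fun j _ => ?_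
    nlinarith [mul_nonneg hx (hc0 (j + 1)), sq_nonneg (x * c (j + 1))]
  have h2 : q ≤ 2 * ∏ j ∈ Finset.range (k + 1), (1 - x * c j / 8) := by
    rw [Finset.prod_range_succ']
    nlinarith [hc1 0]
  have h3 : v ^ 2 ≤ (√C * (q + p * √(c (k + 1)))) ^ 2 := by
    refine h.trans ?_
    rw [mul_pow, Real.sq_sqrt hC]
    refine mul_le_mul_of_nonneg_left ?_ hC
    have h4 : (p * √(c (k + 1))) ^ 2 = p ^ 2 * c (k + 1) := by
      rw [mul_pow, Real.sq_sqrt (hc0 _)]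
    have h5 : 0 ≤ q * (p * √(c (k + 1))) := by positivity
    nlinarith
  have h6 : v ≤ √C * (q + p * √(c (k + 1))) :=
    le_of_abs_le (abs_le_of_sq_le_sq h3 (by positivity))
  exact h6.trans (mul_le_mul_of_nonneg_left (by linarith) (Real.sqrt_nonneg _))

/-! ### From the assumptions on the chain to the pathwise setup -/

section Data

variable {m n : ℕ} {S : Type*} [MeasurableSpace S] {M : Coeffs m n} {F : S → Coeffs m n}
  {π : Measure S} {CA Cb : ℝ}

lemma abs_entry_le (A : Matrix (Fin m) (Fin n) ℝ) (i : Fin m) (j : Fin n) : |A i j| ≤ ‖A‖ := by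
  have h1 := PiLp.norm_apply_le (act A (EuclideanSpace.single j 1)) i
  have h2 := norm_act_le A (EuclideanSpace.single j 1)
  rw [act_apply] at h1
  simp only [PiLp.single_apply, mul_ite, mul_one, mul_zero, Finset.sum_ite_eq', Finset.mem_univ,
    if_true, Real.norm_eq_abs] at h1
  simp only [PiLp.norm_single, norm_one, mul_one] at h2
  exact h1.trans h2

lemma IsBoundedNoise.measurable_coef (hF : IsBoundedNoise M F π CA Cb)
    (ij : (Fin m ⊕ Fin n) × Option (Fin m ⊕ Fin n)) :
    Measurable fun x => coef (F x) ij.1 ij.2 := by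
  rcases ij with ⟨i | i, _ | j | j⟩
  · exact (EuclideanSpace.proj (𝕜 := ℝ) i).continuous.measurable.comp hF.meas_b1
  · exact (hF.meas_A11 i j).neg
  · exact (hF.meas_A12 i j).neg
  · exact (EuclideanSpace.proj (𝕜 := ℝ) i).continuous.measurable.comp hF.meas_b2
  · exact (hF.meas_A21 i j).neg
  · exact (hF.meas_A22 i j).neg

lemma IsBoundedNoise.abs_dev_le (hF : IsBoundedNoise M F π CA Cb) (hCA : 0 ≤ CA) (hCb : 0 ≤ Cb)
    (ij : (Fin m ⊕ Fin n) × Option (Fin m ⊕ Fin n)) (x : S) : |dev M F ij x| ≤ CA + Cb := by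
  have key : ∀ {d d' : ℕ} {A A' : Matrix (Fin d) (Fin d') ℝ} (i j), ‖A - A'‖ ≤ CA →
      |-A i j - -A' i j| ≤ CA + Cb := fun {d d' A A'} i j h => by
    rw [neg_sub_neg, abs_sub_comm]
    have := abs_entry_le (A - A') i j
    rw [Matrix.sub_apply] at this
    linarith
  have key' : ∀ {d : ℕ} {b b' : Vec d} (i), ‖b - b'‖ ≤ Cb → |b i - b' i| ≤ CA + Cb :=
    fun {d b b'} i h => by
    have := PiLp.norm_apply_le (b - b') i
    rw [PiLp.sub_apply, Real.norm_eq_abs] at this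
    linarith
  rcases ij with ⟨i | i, _ | j | j⟩
  · exact key' i (hF.bound_b1 x).2
  · exact key i j (hF.bound_A11 x).2
  · exact key i j (hF.bound_A12 x).2
  · exact key' i (hF.bound_b2 x).2
  · exact key i j (hF.bound_A21 x).2
  · exact key i j (hF.bound_A22 x).2

lemma IsBoundedNoise.integral_dev [IsProbabilityMeasure π] (hF : IsBoundedNoise M F π CA Cb)
    (hCA : 0 ≤ CA) (hCb : 0 ≤ Cb) (ij : (Fin m ⊕ Fin n) × Option (Fin m ⊕ Fin n)) :
    ∫ x, dev M F ij x ∂π = 0 := by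
  have hint : Integrable (fun x => coef (F x) ij.1 ij.2) π := by
    have h := (integrable_of_abs_le (ν := π) ((hF.measurable_coef ij).sub_const _)
      (hF.abs_dev_le hCA hCb ij)).add (integrable_const (coef M ij.1 ij.2))
    refine h.congr (Filter.Eventually.of_forall fun x => ?_)
    simp
  have h : ∫ x, dev M F ij x ∂π = ∫ x, coef (F x) ij.1 ij.2 ∂π - coef M ij.1 ij.2 := by
    simp only [dev]
    rw [integral_sub hint (integrable_const _)]
    simp
  rw [h, sub_eq_zero]
  rcases ij with ⟨i | i, _ | j | j⟩
  · exact hF.mean_b1 i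
  · simp only [coef, integral_neg, hF.mean_A11]
  · simp only [coef, integral_neg, hF.mean_A12]
  · exact hF.mean_b2 i
  · simp only [coef, integral_neg, hF.mean_A21]
  · simp only [coef, integral_neg, hF.mean_A22]

/-- The data which the constant `B` of `Setup` has to bound. -/
structure BoundData {m n : ℕ} (M : Coeffs m n) (θs : Vec m) (ws : Vec n) (CA Cb : ℝ) (t : ℕ)
    (B : ℝ) : Prop where
  one_le : 1 ≤ B
  isUnit_A22 : IsUnit M.A22
  sol : M.IsSolution θs ws
  norm_A12 : ‖M.A12‖ ≤ B
  norm_A22 : ‖M.A22‖ ≤ B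
  norm_schur : ‖M.schur‖ ≤ B
  norm_H : ‖M.H‖ ≤ B
  norm_θs : ‖θs‖ ≤ B
  norm_ws : ‖ws‖ ≤ B
  card_le : (Fintype.card ((Fin m ⊕ Fin n) × Option (Fin m ⊕ Fin n)) : ℝ) ≤ B
  CA_le : CA ≤ B
  Cb_le : Cb ≤ B
  mix_le : mixConst t * (CA + Cb) ≤ B

lemma BoundData.chainSetup {P : Kernel S S} [IsMarkovKernel P] [IsProbabilityMeasure π]
    {θs : Vec m} {ws : Vec n} {t : ℕ} {B ε p : ℝ} {β γ : ℕ → ℝ}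
    (hB : BoundData M θs ws CA Cb t B) (ht : 1 ≤ t) (hCA : 0 < CA) (hCb : 0 < Cb) (hp : 2 ≤ p)
    (hstep : StepCond 1 p β γ) (hbd : StepBounds M B ε β γ) (hP : IsUGE P π t)
    (hF : IsBoundedNoise M F π CA Cb) :
    ChainSetup P M F β γ θs ws B ε (fun ij => poisson P (dev M F ij))
      (fun ij y => ∫ z, poisson P (dev M F ij) z ∂(P y)) := by
  have hm : ∀ ij, Measurable (dev M F ij) := fun ij => (hF.measurable_coef ij).sub_const _
  have hd := hF.abs_dev_le hCA.le hCb.le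
  have hi := hF.integral_dev hCA.le hCb.le
  have hc : 0 < CA + Cb := by linarith
  have hfh : ∀ ij y, |poisson P (dev M F ij) y| ≤ B := fun ij y =>
    (abs_poisson_le ht hP (hm ij) hc (hd ij) (hi ij) y).trans hB.mix_le
  have hγ0 := hstep.γ_pos
  -- The pathwise estimates involve no moment order, so their step conditions are those with p = 1;
  -- only the bound on γ needs to be converted.
  refine ⟨⟨hbd, hB.one_le, hB.isUnit_A22, hB.sol, ⟨hstep.β_pos, hγ0, hstep.β_le, fun k => ?_,
    hstep.γ_sq_le, hstep.β_anti, hstep.γ_anti, hstep.κ_anti, hstep.β_diff, hstep.γ_diff,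
    hstep.κ_diff⟩, hB.norm_A12, hB.norm_A22, hB.norm_schur, hB.norm_H, hB.norm_θs, hB.norm_ws,
    fun y => ⟨⟨?_, ?_, ?_⟩, ?_, ?_, ?_⟩, hB.card_le, hfh,
    fun ij y => abs_integral_kernel_le (hfh ij) y,
    fun ij y => poisson_sub_integral_poisson ht hP (hm ij) hc (hd ij) (hi ij) y⟩,
    fun ij => measurable_poisson ht hP (hm ij) hc (hd ij) (hi ij), fun ij y => rfl⟩
  · simpa using hstep.γ_le' hp k
  · exact (hF.bound_A11 y).1.trans hB.CA_le
  · exact (hF.bound_A12 y).1.trans hB.CA_le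
  · exact (hF.bound_b1 y).1.trans hB.Cb_le
  · exact (hF.bound_A21 y).1.trans hB.CA_le
  · exact (hF.bound_A22 y).1.trans hB.CA_le
  · exact (hF.bound_b2 y).1.trans hB.Cb_le

end Data

/-! ### Deterministic bounds at time one -/

namespace Setup

variable {m n : ℕ} {S : Type*} {M : Coeffs m n} {F : S → Coeffs m n} {β γ : ℕ → ℝ}
  {θs : Vec m} {ws : Vec n} {B ε : ℝ}
  {fh h : (Fin m ⊕ Fin n) × Option (Fin m ⊕ Fin n) → S → ℝ}
  (θ₀ : Vec m) (w₀ : Vec n) (x : ℕ → S)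

lemma norm_first_step_le {d : ℕ} {v s b : Vec d} {t : ℝ} {A : Matrix (Fin d) (Fin m) ℝ}
    {A' : Matrix (Fin d) (Fin n) ℝ} (hB : 1 ≤ B) (ht0 : 0 ≤ t) (ht : t ≤ 1) (hs : ‖s‖ ≤ B)
    (hb : ‖b‖ ≤ B) (hA : ‖A‖ ≤ B) (hA' : ‖A'‖ ≤ B) (hv : ‖v‖ ≤ 1 + ‖θ₀‖ + ‖w₀‖) :
    ‖v + t • (b - act A θ₀ - act A' w₀) - s‖ ≤ 3 * B * (1 + ‖θ₀‖ + ‖w₀‖) := by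
  have h1 : ‖t • (b - act A θ₀ - act A' w₀)‖ ≤ 1 * (B + B * ‖θ₀‖ + B * ‖w₀‖) := by
    rw [norm_smul, Real.norm_of_nonneg ht0]
    exact mul_le_mul ht (norm_sub_le_of_le (norm_sub_le_of_le hb (norm_act_le_of_le hA le_rfl))
      (norm_act_le_of_le hA' le_rfl)) (norm_nonneg _) zero_le_one
  have h2 := norm_sub_le_of_le (norm_add_le_of_le hv h1) hs
  have h3 := norm_nonneg θ₀
  have h4 := norm_nonneg w₀
  nlinarith

lemma stateSize_one_le (hS : Setup M F β γ θs ws B ε fh h) :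
    stateSize M F β γ θs ws θ₀ w₀ x 1 ≤ 10 * B ^ 2 * (1 + ‖θ₀‖ + ‖w₀‖) := by
  have hB := hS.one_le
  have hγ1 := hS.γ_le_one 0
  have hβ1 := (hS.β_le_γ 0).trans hγ1
  obtain ⟨⟨a1, a2, a3⟩, ⟨a4, a5, a6⟩⟩ := hS.norm_F (x 1)
  have n1 := norm_nonneg θ₀
  have n2 := norm_nonneg w₀
  have h1 : ‖errTheta F β γ θ₀ w₀ θs x 1‖ ≤ 3 * B * (1 + ‖θ₀‖ + ‖w₀‖) :=
    norm_first_step_le θ₀ w₀ hB (hS.step.β_pos 0).le hβ1 hS.norm_θs a3 a1 a2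
      (by simp only [iter]; linarith)
  have h2 : ‖(iter F β γ θ₀ w₀ x 1).2 - ws‖ ≤ 3 * B * (1 + ‖θ₀‖ + ‖w₀‖) :=
    norm_first_step_le θ₀ w₀ hB (hS.step.γ_pos 0).le hγ1 hS.norm_ws a6 a4 a5
      (by simp only [iter]; linarith)
  have h3 : ‖errW M F β γ θ₀ w₀ θs ws x 1‖ ≤ _ :=
    norm_add_le_of_le h2 (norm_act_le_of_le (hS.LG_le 1) h1)
  rw [stateSize]
  set R := 1 + ‖θ₀‖ + ‖w₀‖ with hR
  have hR1 : 1 ≤ R := by linarith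
  have h4 : B * R ≤ B ^ 2 * R := mul_le_mul_of_nonneg_right (by nlinarith) (by linarith)
  have h5 : 1 ≤ B * R := by nlinarith
  nlinarith

/-- The moment recursions start at k = 1. One step from a deterministic state with bounded
coefficients is bounded pathwise, by a constant not involving p or the step sizes. -/
lemma norm_corr_one_le (hS : Setup M F β γ θs ws B ε fh h) {J₁ : Matrix (Fin n) (Fin n) ℝ}
    {J₂ : Matrix (Fin m) (Fin m) ℝ} (hJ₁ : ‖J₁‖ ≤ B) (hJ₂ : ‖J₂‖ ≤ B) :
    ‖act J₁ (corrW M F β γ θs ws h θ₀ w₀ x 1)‖ ≤ 40 * B ^ 8 * (1 + ‖θ₀‖ + ‖w₀‖) ∧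
    ‖act J₂ (corrZ M F β γ θs ws h θ₀ w₀ x 1)‖ ≤ 40 * B ^ 8 * (1 + ‖θ₀‖ + ‖w₀‖) := by
  have hB := hS.one_le
  have hγ1 := hS.γ_le_one 1
  have hβ1 := (hS.β_le_γ 1).trans hγ1
  have hκ := hS.κ_nonneg 1
  have hκ1 := hS.κ_le_one 1
  have hg := hS.stateSize_one_le θ₀ w₀ x
  have hg1 := one_le_stateSize (M := M) (F := F) (β := β) (γ := γ) (θs := θs) (ws := ws) θ₀ w₀ x 1
  have hW : ‖errW M F β γ θ₀ w₀ θs ws x 1‖ ≤ stateSize M F β γ θs ws θ₀ w₀ x 1 := by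
    rw [stateSize]
    linarith [norm_nonneg (errTheta F β γ θ₀ w₀ θs x 1)]
  have hΘW : ‖errTheta F β γ θ₀ w₀ θs x 1‖ + ‖errW M F β γ θ₀ w₀ θs ws x 1‖
      ≤ stateSize M F β γ θs ws θ₀ w₀ x 1 := by
    rw [stateSize]
    linarith
  have h1 := norm_act_le_of_le hJ₁ (norm_add_le_of_le hW (hS.norm_noiseW_le θ₀ w₀ x 1))
  have hκW : ‖(β 1 / γ 1) • act M.H (errW M F β γ θ₀ w₀ θs ws x 1)‖
      ≤ 1 * (B * ‖errW M F β γ θ₀ w₀ θs ws x 1‖) := by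
    rw [norm_smul, Real.norm_of_nonneg hκ]
    exact mul_le_mul hκ1 (norm_act_le_of_le hS.norm_H le_rfl) (norm_nonneg _) zero_le_one
  have hZ : ‖errZ M F β γ θ₀ w₀ θs ws x 1‖ ≤ _ := norm_sub_le_of_le le_rfl hκW
  have h2 := norm_act_le_of_le hJ₂ (norm_add_le_of_le hZ (hS.norm_noiseZ_le θ₀ w₀ x 1))
  have hΘ0 := norm_nonneg (errTheta F β γ θ₀ w₀ θs x 1)
  set G := stateSize M F β γ θs ws θ₀ w₀ x 1
  have hfin : 4 * B ^ 6 * G ≤ 40 * B ^ 8 * (1 + ‖θ₀‖ + ‖w₀‖) := by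
    have := mul_le_mul_of_nonneg_left hg (by positivity : 0 ≤ 4 * B ^ 6)
    calc _ ≤ _ := this
      _ = _ := by ring
  have p1 : B * G ≤ B ^ 6 * G :=
    mul_le_mul_of_nonneg_right (by simpa using pow_le_pow_right₀ hB (by norm_num : 1 ≤ 6))
      (by linarith)
  have p2 : B ^ 5 * G ≤ B ^ 6 * G :=
    mul_le_mul_of_nonneg_right (pow_le_pow_right₀ hB (by norm_num)) (by linarith)
  have p3 : B ^ 2 * G ≤ B ^ 6 * G :=
    mul_le_mul_of_nonneg_right (pow_le_pow_right₀ hB (by norm_num)) (by linarith)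
  constructor
  · refine h1.trans (le_trans ?_ hfin)
    calc _ ≤ B * (G + 2 * B ^ 4 * (1 * G)) := by gcongr
      _ = B * G + 2 * (B ^ 5 * G) := by ring
      _ ≤ _ := by nlinarith
  · refine h2.trans (le_trans ?_ hfin)
    have h3 : ‖errTheta F β γ θ₀ w₀ θs x 1‖ + 1 * (B * ‖errW M F β γ θ₀ w₀ θs ws x 1‖)
        ≤ B * G := by nlinarith
    calc _ ≤ B * (B * G + 3 * B ^ 5 * (1 * G)) := by gcongr
      _ = B ^ 2 * G + 3 * (B ^ 6 * G) := by ring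
      _ ≤ _ := by nlinarith

end Setup

namespace ChainSetup

variable {m n : ℕ} {S : Type*} [MeasurableSpace S] {P : Kernel S S}
  {M : Coeffs m n} {F : S → Coeffs m n} {β γ : ℕ → ℝ} {θs : Vec m} {ws : Vec n} {B ε : ℝ}
  {fh h : (Fin m ⊕ Fin n) × Option (Fin m ⊕ Fin n) → S → ℝ}
  (θ₀ : Vec m) (w₀ : Vec n) {Ω : Type*} {X : ℕ → Ω → S} [mΩ : MeasurableSpace Ω]
  {μ : Measure Ω} [IsProbabilityMeasure μ]
  {J₁ J₁i : Matrix (Fin n) (Fin n) ℝ} {J₂ J₂i : Matrix (Fin m) (Fin m) ℝ}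

local notation "V" => momentW M F β γ θs ws h θ₀ w₀ μ X
local notation "U" => momentZ M F β γ θs ws h θ₀ w₀ μ X

lemma lpNorm_errW_le (hS : ChainSetup P M F β γ θs ws B ε fh h) (hX : IsMarkovChain μ P X)
    (hJ₁ : J₁i * J₁ = 1) (hJ₁i : ‖J₁i‖ ≤ B) (hJ₂ : J₂i * J₂ = 1) (hJ₂i : ‖J₂i‖ ≤ B) {p : ℝ}
    (hp : 2 ≤ p) {k : ℕ} (hk : 1 ≤ k) (hγ : 14 * B ^ 5 * γ k ≤ 1) :
    lpNorm (fun ω => errW M F β γ θ₀ w₀ θs ws (fun j => X j ω) k) (ENNReal.ofReal p) μ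
      ≤ B * V p J₁ k + 8 * B ^ 6 * γ k * (1 + U p J₂ k + V p J₁ k) := by
  have hB := hS.one_le
  have hγ0 := hS.step.γ_pos k
  have hle := pastSigma_le hX.measurable k
  refine (lpNorm_le_of_norm_le_one_add (c₁ := B + 8 * B ^ 6 * γ k) (c₂ := 8 * B ^ 6 * γ k)
    (c₃ := 8 * B ^ 6 * γ k) (by positivity) (by positivity) (by positivity)
    (((hS.isBddMeas_corrW θ₀ w₀ X hk).act J₁).mono hle)
    (((hS.isBddMeas_corrZ θ₀ w₀ X hk).act J₂).mono hle)
    (ENNReal.one_le_ofReal.mpr (by linarith)) fun ω => ?_).trans (le_of_eq ?_)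
  · have h1 := hS.norm_errW_le θ₀ w₀ (fun j => X j ω) hJ₁ hJ₁i k
    have h2 := hS.stateSize_le θ₀ w₀ (fun j => X j ω) hJ₁ hJ₁i hJ₂ hJ₂i k hγ
    have h3 := mul_le_mul_of_nonneg_left h2 (by positivity : 0 ≤ 2 * B ^ 4 * γ k)
    linarith
  · rw [momentW, momentZ]
    ring

lemma lpNorm_errTheta_le (hS : ChainSetup P M F β γ θs ws B ε fh h) (hX : IsMarkovChain μ P X)
    (hJ₁ : J₁i * J₁ = 1) (hJ₁i : ‖J₁i‖ ≤ B) (hJ₂ : J₂i * J₂ = 1) (hJ₂i : ‖J₂i‖ ≤ B) {p : ℝ}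
    (hp : 2 ≤ p) {k : ℕ} (hk : 1 ≤ k) (hγ : 14 * B ^ 5 * γ k ≤ 1) :
    lpNorm (fun ω => errTheta F β γ θ₀ w₀ θs (fun j => X j ω) k) (ENNReal.ofReal p) μ
      ≤ B * U p J₂ k + B ^ 2 * (β k / γ k * V p J₁ k)
        + 20 * B ^ 7 * β k * (1 + U p J₂ k + V p J₁ k) := by
  have hB := hS.one_le
  have hβ0 := hS.step.β_pos k
  have hκ := hS.κ_nonneg k
  have hle := pastSigma_le hX.measurable k
  refine (lpNorm_le_of_norm_le_one_add (c₁ := B ^ 2 * (β k / γ k) + 20 * B ^ 7 * β k)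
    (c₂ := B + 20 * B ^ 7 * β k) (c₃ := 20 * B ^ 7 * β k) (by positivity) (by positivity)
    (by positivity) (((hS.isBddMeas_corrW θ₀ w₀ X hk).act J₁).mono hle)
    (((hS.isBddMeas_corrZ θ₀ w₀ X hk).act J₂).mono hle)
    (ENNReal.one_le_ofReal.mpr (by linarith)) fun ω => ?_).trans (le_of_eq ?_)
  · have h1 := hS.norm_errTheta_le θ₀ w₀ (fun j => X j ω) hJ₁ hJ₁i hJ₂ hJ₂i k
    have h2 := hS.stateSize_le θ₀ w₀ (fun j => X j ω) hJ₁ hJ₁i hJ₂ hJ₂i k hγ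
    have h3 := mul_le_mul_of_nonneg_left h2 (by positivity : 0 ≤ 5 * B ^ 5 * β k)
    linarith
  · rw [momentW, momentZ]
    ring

lemma moment_one_le (hS : ChainSetup P M F β γ θs ws B ε fh h) (hJ₁ : ‖J₁‖ ≤ B) (hJ₂ : ‖J₂‖ ≤ B)
    {p : ℝ} (hp : 2 ≤ p) :
    V p J₁ 1 ≤ 40 * B ^ 8 * (1 + ‖θ₀‖ + ‖w₀‖) ∧ U p J₂ 1 ≤ 40 * B ^ 8 * (1 + ‖θ₀‖ + ‖w₀‖) := by
  have hB := hS.one_le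
  have hp1 : 1 ≤ ENNReal.ofReal p := ENNReal.one_le_ofReal.mpr (by linarith)
  have i0 : IsBddMeas mΩ fun _ : Ω => (0 : ℝ) := IsBddMeas.const 0
  have hc : 0 ≤ 40 * B ^ 8 * (1 + ‖θ₀‖ + ‖w₀‖) := by positivity
  constructor
  · have := lpNorm_le_of_norm_le_one_add (μ := μ) le_rfl le_rfl hc i0 i0 hp1 fun ω => by
      simpa using (hS.norm_corr_one_le θ₀ w₀ (fun j => X j ω) hJ₁ hJ₂).1
    simpa [momentW] using this
  · have := lpNorm_le_of_norm_le_one_add (μ := μ) le_rfl le_rfl hc i0 i0 hp1 fun ω => by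
      simpa using (hS.norm_corr_one_le θ₀ w₀ (fun j => X j ω) hJ₁ hJ₂).2
    simpa [momentZ] using this

end ChainSetup

/-! ### Choice of constants and final inequalities -/

lemma exists_pos_le_of_list (l : List ℝ) (hl : ∀ x ∈ l, 0 < x) :
    ∃ δ : ℝ, 0 < δ ∧ ∀ x ∈ l, δ ≤ x := by
  induction l with
  | nil => exact ⟨1, one_pos, by simp⟩
  | cons a l ih =>
    obtain ⟨δ, hδ, h⟩ := ih fun x hx => hl x (List.mem_cons_of_mem _ hx)
    refine ⟨min a δ, lt_min (hl a List.mem_cons_self) hδ, fun x hx => ?_⟩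
    rcases List.mem_cons.mp hx with rfl | hx
    · exact min_le_left _ _
    · exact (min_le_right _ _).trans (h x hx)

lemma exists_le_of_list (l : List ℝ) : ∃ B : ℝ, ∀ x ∈ l, x ≤ B := by
  induction l with
  | nil => exact ⟨1, by simp⟩
  | cons a l ih =>
    obtain ⟨B, h⟩ := ih
    refine ⟨max a B, fun x hx => ?_⟩
    rcases List.mem_cons.mp hx with rfl | hx
    · exact le_max_left _ _
    · exact (h x hx).trans (le_max_right _ _)

lemma le_mul_sqrt_of_le_one {x y p : ℝ} (hx0 : 0 ≤ x) (hx1 : x ≤ 1) (hxy : x ≤ y) (hp : 1 ≤ p) :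
    x ≤ p * √y := by
  have h1 : x ≤ √x := Real.le_sqrt_of_sq_le (by nlinarith)
  have h2 : √x ≤ √y := Real.sqrt_le_sqrt hxy
  nlinarith [Real.sqrt_nonneg y]

/-- Undoing the Poisson correction costs a term of order γ', which is at most p√γ since γ' ≤ 1 and p
≥ 1. -/
lemma fast_final_le {B C S p v u γ γ' q Θ : ℝ} (hB : 1 ≤ B) (hC : 0 ≤ C) (hS : 1 ≤ S) (hp : 2 ≤ p)
    (hγ0 : 0 ≤ γ') (hγ1 : γ' ≤ 1) (hγγ : γ' ≤ γ) (hq : 0 ≤ q) (hvS : v ≤ S)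
    (huS : u ≤ S) (hv : v ≤ C * (2 * q + p * √γ'))
    (hΘ : Θ ≤ B * v + 8 * B ^ 6 * γ' * (1 + u + v)) :
    Θ ≤ (4 * B ^ 2 * C + 60 * B ^ 7 * S) * (q + p * √γ) := by
  have h1 := le_mul_sqrt_of_le_one hγ0 hγ1 hγγ (by linarith : 1 ≤ p)
  have h2 : √γ' ≤ √γ := Real.sqrt_le_sqrt hγγ
  set r := p * √γ with hr
  have hr0 : 0 ≤ r := by positivity
  have h3 : p * √γ' ≤ r := by rw [hr]; gcongr
  have h4 : B * v ≤ B * (C * (2 * q + r)) := by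
    have : C * (2 * q + p * √γ') ≤ C * (2 * q + r) := by gcongr
    have := hv.trans this
    gcongr
  have h5 : 8 * B ^ 6 * γ' * (1 + u + v) ≤ 8 * B ^ 6 * r * (3 * S) := by
    calc _ ≤ 8 * B ^ 6 * γ' * (3 * S) := by gcongr; linarith
      _ ≤ _ := by gcongr
  have h6 : B ^ 6 ≤ B ^ 7 := pow_le_pow_right₀ hB (by norm_num)
  have h7 : B ≤ B ^ 2 := by nlinarith
  calc Θ ≤ B * (C * (2 * q + r)) + 8 * B ^ 6 * r * (3 * S) := hΘ.trans (add_le_add h4 h5)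
    _ ≤ B ^ 2 * (C * (4 * q + 4 * r)) + 20 * B ^ 7 * (q + r) * (3 * S) := by
      gcongr <;> linarith
    _ = _ := by ring

/-- Undoing z = θ̃ − κHw̃ adds κ‖w̃‖. Its stationary part is harmless because κ√γ' ≤ √β', and its
transient because the fast product is below the slow one. -/
lemma slow_final_le {B C S p v u β β' γ' q₁ q Θ : ℝ} (hB : 1 ≤ B) (hC : 0 ≤ C) (hS : 1 ≤ S)
    (hp : 2 ≤ p) (hβ0 : 0 < β') (hβ1 : β' ≤ 1) (hββ : β' ≤ β) (hβγ : β' ≤ γ')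
    (hq₁ : 0 ≤ q₁) (hqq : q₁ ≤ q) (hvS : v ≤ S) (huS : u ≤ S) (hv : v ≤ C * (2 * q₁ + p * √γ'))
    (hu : u ≤ C * (2 * q + p * √β'))
    (hΘ : Θ ≤ B * u + B ^ 2 * (β' / γ' * v) + 20 * B ^ 7 * β' * (1 + u + v)) :
    Θ ≤ (4 * B ^ 2 * C + 60 * B ^ 7 * S) * (q + p * √β) := by
  have hγ0 : 0 < γ' := hβ0.trans_le hβγ
  have h1 := le_mul_sqrt_of_le_one hβ0.le hβ1 hββ (by linarith : 1 ≤ p)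
  have h2 : √β' ≤ √β := Real.sqrt_le_sqrt hββ
  set r := p * √β with hr
  have hr0 : 0 ≤ r := by positivity
  have h3 : p * √β' ≤ r := by rw [hr]; gcongr
  have hκ1 : β' / γ' ≤ 1 := (div_le_one hγ0).mpr hβγ
  have hκ0 : 0 ≤ β' / γ' := by positivity
  have hκ : β' / γ' * √γ' ≤ √β' := by
    refine Real.le_sqrt_of_sq_le ?_
    rw [mul_pow, Real.sq_sqrt hγ0.le]
    calc (β' / γ') ^ 2 * γ' = β' / γ' * β' := by field_simp
      _ ≤ 1 * β' := by gcongr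
      _ = β' := one_mul _
  have h4 : B * u ≤ B * (C * (2 * q + r)) := by
    have : C * (2 * q + p * √β') ≤ C * (2 * q + r) := by gcongr
    have := hu.trans this
    gcongr
  have h5 : β' / γ' * v ≤ C * (2 * q + r) := by
    calc β' / γ' * v ≤ β' / γ' * (C * (2 * q₁ + p * √γ')) := by gcongr
      _ = C * (2 * (β' / γ' * q₁) + p * (β' / γ' * √γ')) := by ring
      _ ≤ C * (2 * (1 * q) + p * √β') := by gcongr
      _ ≤ C * (2 * q + r) := by rw [one_mul]; gcongr
  have h6 : 20 * B ^ 7 * β' * (1 + u + v) ≤ 20 * B ^ 7 * r * (3 * S) := by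
    calc _ ≤ 20 * B ^ 7 * β' * (3 * S) := by gcongr; linarith
      _ ≤ _ := by gcongr
  have h7 : B ≤ B ^ 2 := by nlinarith
  have hq : 0 ≤ q := hq₁.trans hqq
  calc Θ ≤ B * (C * (2 * q + r)) + B ^ 2 * (C * (2 * q + r)) + 20 * B ^ 7 * r * (3 * S) :=
        hΘ.trans (add_le_add (add_le_add h4 (by gcongr)) h6)
    _ ≤ B ^ 2 * (C * (2 * q + 2 * r)) + B ^ 2 * (C * (2 * q + 2 * r))
        + 20 * B ^ 7 * (q + r) * (3 * S) := by
      gcongr <;> linarith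
    _ = _ := by ring

lemma pMoment_eq_ofReal_lpNorm {Ω E : Type*} [mΩ : MeasurableSpace Ω] [NormedAddCommGroup E]
    {μ : Measure Ω} [IsProbabilityMeasure μ] {p : ℝ} (hp : 2 ≤ p) {Y : Ω → E}
    (hY : IsBddMeas mΩ Y) : pMoment μ p Y = ENNReal.ofReal (lpNorm Y (ENNReal.ofReal p) μ) := by
  have hp0 : 0 < p := by linarith
  rw [ofReal_lpNorm (hY.memLp _), pMoment,
    eLpNorm_eq_lintegral_rpow_enorm_toReal (by simpa using hp0) ENNReal.ofReal_ne_top,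
    ENNReal.toReal_ofReal hp0.le]

/-! ### Moment bounds under abstract step conditions -/

section Main

universe u v

lemma exists_boundData {m n : ℕ} {M : Coeffs m n} (hM : IsUnit M.A22) {θs : Vec m} {ws : Vec n}
    (hsol : M.IsSolution θs ws) (CA Cb : ℝ) (t : ℕ) (l : List ℝ) :
    ∃ B : ℝ, BoundData M θs ws CA Cb t B ∧ ∀ x ∈ l, x ≤ B := by
  obtain ⟨B, hB⟩ := exists_le_of_list ([1, ‖M.A12‖, ‖M.A22‖, ‖M.schur‖, ‖M.H‖, ‖θs‖, ‖ws‖,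
    (Fintype.card ((Fin m ⊕ Fin n) × Option (Fin m ⊕ Fin n)) : ℝ), CA, Cb,
    mixConst t * (CA + Cb)] ++ l)
  simp only [List.cons_append, List.nil_append, List.forall_mem_cons] at hB
  obtain ⟨h1, h2, h3, h4, h5, h6, h7, h8, h9, h10, h11, hl⟩ := hB
  exact ⟨B, ⟨h1, hM, hsol, h2, h3, h4, h5, h6, h7, h8, h9, h10, h11⟩, hl⟩

/-- Moment bounds for the decoupled errors under smallness conditions on the step sizes. -/
theorem exists_moment_bound {m n : ℕ} [NeZero m] [NeZero n] (M : Coeffs m n)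
    {Q22 : Matrix (Fin n) (Fin n) ℝ} {QΔ : Matrix (Fin m) (Fin m) ℝ} (hQ22 : IsLyapunov M.A22 Q22)
    (hQΔ : IsLyapunov M.schur QΔ) (hM : IsUnit M.A22) {θs : Vec m} {ws : Vec n}
    (hsol : M.IsSolution θs ws) {CA Cb : ℝ} (hCA : 0 < CA) (hCb : 0 < Cb) {t : ℕ} (ht : 1 ≤ t)
    (θ₀ : Vec m) (w₀ : Vec n) :
    ∃ δ C : ℝ, 0 < δ ∧ 0 < C ∧ ∀ (p : ℝ) (β γ : ℕ → ℝ), 2 ≤ p → StepCond δ p β γ →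
      (∀ k, IsUnit (1 - β k • M.U (M.L β γ k))) ∧
      ∀ (S : Type u) [MeasurableSpace S] (P : Kernel S S) [IsMarkovKernel P] (π : Measure S)
        [IsProbabilityMeasure π] (F : S → Coeffs m n), IsUGE P π t → IsBoundedNoise M F π CA Cb →
      ∀ (Ω : Type v) [MeasurableSpace Ω] (μ : Measure Ω) [IsProbabilityMeasure μ] (X : ℕ → Ω → S),
        IsMarkovChain μ P X → ∀ k,
        pMoment μ p (fun ω => errTheta F β γ θ₀ w₀ θs (fun j => X j ω) (k + 1)) ≤ ENNReal.ofReal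
          (C * (∏ j ∈ Finset.range (k + 1), (1 - rate QΔ * β j / 8) + p * √(β k))) ∧
        pMoment μ p (fun ω => errW M F β γ θ₀ w₀ θs ws (fun j => X j ω) (k + 1)) ≤ ENNReal.ofReal
          (C * (∏ j ∈ Finset.range (k + 1), (1 - rate Q22 * γ j / 8) + p * √(γ k))) := by
  obtain ⟨J₁, J₁i, hJ₁, t₁, ht₁, hcon₁⟩ := hQ22.exists_contraction
  obtain ⟨J₂, J₂i, hJ₂, t₂, ht₂, hcon₂⟩ := hQΔ.exists_contraction
  have ha₁ := hQ22.rate_pos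
  have ha₂ := hQΔ.rate_pos
  set a₁ := rate Q22
  set a₂ := rate QΔ
  obtain ⟨B₀, -, hstep₀⟩ := exists_stepBounds M hQ22
  obtain ⟨B, hBd, hl⟩ := exists_boundData hM hsol CA Cb t [B₀, ‖J₁‖, ‖J₁i‖, ‖J₂‖, ‖J₂i‖]
  simp only [List.forall_mem_cons] at hl
  obtain ⟨hB₀, hJ₁n, hJ₁i, hJ₂n, hJ₂i, -⟩ := hl
  have hB := hBd.one_le
  -- With B fixed, ε is chosen so that B³ε ≤ a₂/8, the perturbation allowed in the slow contraction;
  -- the threshold δ₁ depends on this ε.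
  obtain ⟨ε, hε0, hε⟩ := exists_pos_le_of_list [1, a₂ / 8 / B ^ 3] (by
    simp only [List.forall_mem_cons]
    exact ⟨one_pos, by positivity, by simp⟩)
  simp only [List.forall_mem_cons] at hε
  obtain ⟨hε1, hεB, -⟩ := hε
  rw [le_div_iff₀ (by positivity)] at hεB
  obtain ⟨δ₁, hδ₁, -, hbounds⟩ := hstep₀ ε hε0 hε1
  set K := 41472 * B ^ 14 + 40560 * B ^ 18 / a₁ + 160 * B ^ 10 / a₂
    + (93312 * B ^ 16 + 403680 * B ^ 20 / a₂) with hK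
  obtain ⟨δ₂, hδ₂, htwo⟩ := exists_two_timescale_bound (half_pos ha₁) (half_pos ha₂)
    (by positivity : 0 < K)
  -- The entry a₁/8/B⁴ absorbs the fast coupling, 1/(14B⁵) absorbs the state size, and a₁/a₂ ensures
  -- a₂β ≤ a₁γ, which orders the two transient products.
  obtain ⟨δ, hδ0, hδ⟩ := exists_pos_le_of_list
    [1, δ₁, δ₂, t₁, t₂, a₁ / 8 / B ^ 4, 1 / (14 * B ^ 5), a₁ / a₂] (by
    simp only [List.forall_mem_cons]
    exact ⟨one_pos, hδ₁, hδ₂, ht₁, ht₂, by positivity, by positivity, by positivity, by simp⟩)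
  simp only [List.forall_mem_cons] at hδ
  obtain ⟨hδ1, hδδ₁, hδδ₂, hδt₁, hδt₂, hδB₁, hδB₂, hδa, -⟩ := hδ
  rw [le_div_iff₀ (by positivity)] at hδB₁ hδB₂ hδa
  set s := 40 * B ^ 8 * (1 + ‖θ₀‖ + ‖w₀‖) with hs
  have hs1 : 1 ≤ s := by
    have h1 := one_le_pow₀ (n := 8) hB
    have h2 : 1 ≤ 1 + ‖θ₀‖ + ‖w₀‖ := by linarith [norm_nonneg θ₀, norm_nonneg w₀]
    nlinarith
  obtain ⟨C, hC, hfin⟩ := htwo (s ^ 2) (one_le_pow₀ hs1)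
  refine ⟨δ, 4 * B ^ 2 * √C + 60 * B ^ 7 * s, hδ0, by positivity, fun p β γ hp hst => ?_⟩
  have hsb := hbounds p β γ hp (hst.mono hδδ₁)
  refine ⟨hsb.isUnit, ?_⟩
  intro S _ P _ π _ F hP hF Ω _ μ _ X hX k
  have hS := hBd.chainSetup ht hCA hCb hp (hst.mono hδ1)
    (hsb.mono hB₀ fun k => (hst.γ_pos k).le) hP hF
  have hγ0 := fun k => (hst.γ_pos k).le
  have hβ0 := fun k => (hst.β_pos k).le
  have hγδ := hst.γ_le' hp
  have hβγ := hS.β_le_γ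
  have hγB : ∀ k, 14 * B ^ 5 * γ k ≤ 1 := fun k => by
    have := mul_le_mul_of_nonneg_left (hγδ k) (by positivity : 0 ≤ 14 * B ^ 5)
    linarith
  have hc₁ := fun k => hcon₁ (γ k) (hγ0 k) ((hγδ k).trans hδt₁)
  have hc₂ := fun k => hcon₂ (β k) (hβ0 k) ((hβγ k).trans ((hγδ k).trans hδt₂))
  set v : ℕ → ℝ := fun k => momentW M F β γ θs ws
    (fun ij y => ∫ z, poisson P (dev M F ij) z ∂(P y)) θ₀ w₀ μ X p J₁ k with hv
  set u : ℕ → ℝ := fun k => momentZ M F β γ θs ws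
    (fun ij y => ∫ z, poisson P (dev M F ij) z ∂(P y)) θ₀ w₀ μ X p J₂ k with hu
  have hv0 : ∀ k, 0 ≤ v k := fun k => lpNorm_nonneg
  have hu0 : ∀ k, 0 ≤ u k := fun k => lpNorm_nonneg
  have hrecW : ∀ k, v (k + 1 + 1) ^ 2 ≤ (1 - a₁ / 2 * γ (k + 1)) * v (k + 1) ^ 2
      + (41472 * B ^ 14 + 40560 * B ^ 18 / a₁) * (p ^ 2 * γ (k + 1) ^ 2)
        * (1 + v (k + 1) ^ 2 + u (k + 1) ^ 2) := fun k => by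
    refine hS.momentW_sq_succ_le θ₀ w₀ hX hJ₁ hJ₁n hJ₁i hJ₂ hJ₂i hp ha₁ (Nat.le_add_left 1 k)
      (hγB _) (hc₁ _).1 (hc₁ _).2 ?_
    calc B ^ 4 * β (k + 1) ≤ B ^ 4 * (δ * γ (k + 1)) := by gcongr; exact hst.β_le _
      _ = δ * B ^ 4 * γ (k + 1) := by ring
      _ ≤ _ := mul_le_mul_of_nonneg_right hδB₁ (hγ0 _)
  have hrecZ : ∀ k, u (k + 1 + 1) ^ 2 ≤ (1 - a₂ / 2 * β (k + 1)) * u (k + 1) ^ 2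
      + 160 * B ^ 10 / a₂ * (β (k + 1) * (β (k + 1) / γ (k + 1)) ^ 2) * v (k + 1) ^ 2
      + (93312 * B ^ 16 + 403680 * B ^ 20 / a₂) * (p ^ 2 * β (k + 1) ^ 2)
        * (1 + v (k + 1) ^ 2 + u (k + 1) ^ 2) := fun k =>
    hS.momentZ_sq_succ_le θ₀ w₀ hX hε0.le hε1 hJ₁ hJ₁i hJ₂ hJ₂n hJ₂i hp ha₂
      (Nat.le_add_left 1 k) (hγB _) (hc₂ _).1 (hc₂ _).2 (by linarith)
  have h1 := hS.moment_one_le θ₀ w₀ (μ := μ) (X := X) hJ₁n hJ₂n hp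
  -- The scalar system is run from time 1, so every sequence is shifted by one and the initial bound
  -- is s², with s from the estimate at time one.
  have hmain := hfin p (fun k => β (k + 1)) (fun k => γ (k + 1)) (fun k => v (k + 1) ^ 2)
    (fun k => u (k + 1) ^ 2) hp (hst.mono hδδ₂).shift (fun k => sq_nonneg _) (fun k => sq_nonneg _)
    (pow_le_pow_left₀ (hv0 _) h1.1 2) (pow_le_pow_left₀ (hu0 _) h1.2 2)
    (fun k => (hrecW k).trans (by
      have : 41472 * B ^ 14 + 40560 * B ^ 18 / a₁ ≤ K := by
        have : 0 ≤ 160 * B ^ 10 / a₂ + (93312 * B ^ 16 + 403680 * B ^ 20 / a₂) := by positivity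
        linarith
      gcongr))
    (fun k => (hrecZ k).trans (by
      have e1 : 160 * B ^ 10 / a₂ ≤ K := by
        have : 0 ≤ 41472 * B ^ 14 + 40560 * B ^ 18 / a₁
          + (93312 * B ^ 16 + 403680 * B ^ 20 / a₂) := by positivity
        linarith
      have e2 : 93312 * B ^ 16 + 403680 * B ^ 20 / a₂ ≤ K := by
        have : 0 ≤ 41472 * B ^ 14 + 40560 * B ^ 18 / a₁ + 160 * B ^ 10 / a₂ := by positivity
        linarith
      have := hβ0 (k + 1)
      gcongr)) k
  obtain ⟨⟨hvs, hus⟩, hvC, huC⟩ := hmain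
  have hvs' : v (k + 1) ≤ s := le_of_abs_le (abs_le_of_sq_le_sq hvs (by linarith))
  have hus' : u (k + 1) ≤ s := le_of_abs_le (abs_le_of_sq_le_sq hus (by linarith))
  have hp0 : 0 ≤ p := by linarith
  have hv' := le_sqrt_mul_of_sq_le hp0 hC.le ha₁.le hγ0 (fun k => (hc₁ k).1) hvC
  have hu' := le_sqrt_mul_of_sq_le hp0 hC.le ha₂.le hβ0 (fun k => (hc₂ k).1) huC
  have hγ1 := hS.γ_le_one (k + 1)
  have hq₁ : 0 ≤ ∏ j ∈ Finset.range (k + 1), (1 - a₁ * γ j / 8) :=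
    Finset.prod_nonneg fun j _ => by linarith [(hc₁ j).1]
  have hqq : ∏ j ∈ Finset.range (k + 1), (1 - a₁ * γ j / 8)
      ≤ ∏ j ∈ Finset.range (k + 1), (1 - a₂ * β j / 8) := by
    refine Finset.prod_le_prod (fun j _ => by linarith [(hc₁ j).1]) fun j _ => ?_
    have h2 := mul_le_mul_of_nonneg_left (hst.β_le j) ha₂.le
    have h3 := mul_le_mul_of_nonneg_right hδa (hγ0 j)
    linarith
  have hle := pastSigma_le hX.measurable (k + 1)
  rw [pMoment_eq_ofReal_lpNorm hp ((hS.isBddMeas_errTheta θ₀ w₀ X (k + 1)).mono hle),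
    pMoment_eq_ofReal_lpNorm hp ((hS.isBddMeas_errW θ₀ w₀ X (k + 1)).mono hle)]
  exact ⟨ENNReal.ofReal_le_ofReal <| slow_final_le hB (Real.sqrt_nonneg C) hs1 hp (hst.β_pos _)
      ((hβγ _).trans hγ1)
      (hst.β_anti k) (hβγ _) hq₁ hqq hvs' hus' hv' hu'
      (hS.lpNorm_errTheta_le θ₀ w₀ hX hJ₁ hJ₁i hJ₂ hJ₂i hp (Nat.le_add_left 1 k) (hγB _)),
    ENNReal.ofReal_le_ofReal <| fast_final_le hB (Real.sqrt_nonneg C) hs1 hp (hγ0 _) hγ1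
      (hst.γ_anti k) hq₁ hvs' hus' hv'
      (hS.lpNorm_errW_le θ₀ w₀ hX hJ₁ hJ₁i hJ₂ hJ₂i hp (Nat.le_add_left 1 k) (hγB _))⟩

end Main

/-! ### Polynomial step sizes satisfy the conditions -/

section StepSizes

/-- For e ≤ 1, (1 + 1/y)^{−e} ≥ (1 + 1/y)^{−1} ≥ 1 − 1/y, so the relative decrement is at most 1/y.
-/
lemma rpow_neg_sub_le {y e : ℝ} (hy : 0 < y) (he1 : e ≤ 1) :
    y ^ (-e) - (y + 1) ^ (-e) ≤ y ^ (-e) * y ^ (-1 : ℝ) := by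
  have h1 : (y + 1) ^ (-e) = y ^ (-e) * (1 + 1 / y) ^ (-e) := by
    rw [← Real.mul_rpow hy.le (by positivity)]
    congr 1
    field_simp
  have h2 : (1 + 1 / y) ^ (-1 : ℝ) ≤ (1 + 1 / y) ^ (-e) := by
    refine Real.rpow_le_rpow_of_exponent_le ?_ (by linarith)
    have : 0 ≤ 1 / y := by positivity
    linarith
  have h3 : 1 - y ^ (-1 : ℝ) ≤ (1 + 1 / y) ^ (-1 : ℝ) := by
    rw [Real.rpow_neg_one, Real.rpow_neg_one, sub_le_iff_le_add]
    have e1 : (1 + 1 / y)⁻¹ + y⁻¹ = 1 + 1 / (y * (y + 1)) := by field_simp; ring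
    rw [e1]
    have : 0 ≤ 1 / (y * (y + 1)) := by positivity
    linarith
  have h4 := mul_le_mul_of_nonneg_left (h3.trans h2) (Real.rpow_nonneg hy.le (-e))
  rw [h1]
  linarith

lemma rpow_neg_le_mul {y c d δ e f : ℝ} (hy : 0 < y) (h : y ^ (-(f - e)) ≤ δ * d / c) (hc : 0 < c) :
    c * y ^ (-f) ≤ δ * (d * y ^ (-e)) := by
  rw [le_div_iff₀ hc] at h
  have e1 : y ^ (-f) = y ^ (-(f - e)) * y ^ (-e) := by rw [← Real.rpow_add hy]; congr 1; ring
  rw [e1]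
  have := mul_le_mul_of_nonneg_right h (Real.rpow_nonneg hy.le (-e))
  linarith

/-- Each condition says that a negative power of y = k + k₀ is small, so it holds beyond some T. The
exponents are positive because a < b < 1 and 2a > 1 > b. In particular β/γ is small because it
decays like y^{−(b−a)}. Only the condition on p²γ needs k₀ to grow with p. -/
lemma exists_stepCond {a b cβ cγ δ : ℝ} (ha : 1 / 2 < a) (hab : a < b) (hb : b < 1) (hcβ : 0 < cβ)
    (hcγ : 0 < cγ) (hδ : 0 < δ) : ∃ T : ℝ, 0 < T ∧ ∀ p : ℝ, 2 ≤ p → ∀ k₀ : ℝ, T * p ^ (4 / b) ≤ k₀ →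
      StepCond δ p (stepSize cβ k₀ b) (stepSize cγ k₀ a) := by
  have key : ∀ {e η : ℝ}, 0 < e → 0 < η → ∀ᶠ y : ℝ in Filter.atTop, y ^ (-e) ≤ η := fun he hη =>
    (tendsto_rpow_neg_atTop he).eventually (eventually_le_nhds hη)
  obtain ⟨T, hT⟩ := Filter.eventually_atTop.mp ((Filter.eventually_ge_atTop (1 : ℝ)).and
    (((key (sub_pos.mpr hab) (by positivity : 0 < δ * cγ / cβ)).and
    ((key (by linarith : 0 < a) (by positivity : 0 < δ / cγ)).and
    (key (by linarith : 0 < 2 * a - b) (by positivity : 0 < δ * cβ / cγ ^ 2)))).and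
    ((key (sub_pos.mpr hb) (by positivity : 0 < δ * cβ)).and
    (key (sub_pos.mpr (hab.trans hb)) (by positivity : 0 < δ * cγ)))))
  have hT1 := (hT T le_rfl).1
  refine ⟨T, by linarith, fun p hp k₀ hk₀ => ?_⟩
  have hpb : 1 ≤ p ^ (4 / b) := Real.one_le_rpow (by linarith)
    (div_nonneg (by norm_num) (by linarith))
  have hyk : ∀ k : ℕ, T * p ^ (4 / b) ≤ (k : ℝ) + k₀ := fun k => by
    have : (0 : ℝ) ≤ k := Nat.cast_nonneg k
    linarith
  have hyT : ∀ k : ℕ, T ≤ (k : ℝ) + k₀ := fun k => le_trans (by nlinarith) (hyk k)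
  have hy0 : ∀ k : ℕ, 0 < (k : ℝ) + k₀ := fun k => by linarith [hyT k]
  have hsucc : ∀ (c e : ℝ) (k : ℕ), stepSize c k₀ e (k + 1) = c * ((k : ℝ) + k₀ + 1) ^ (-e) :=
    fun c e k => by
    rw [stepSize]
    congr 2
    push_cast
    ring
  have hanti : ∀ {c e : ℝ}, 0 < c → 0 < e → ∀ k, stepSize c k₀ e (k + 1) ≤ stepSize c k₀ e k :=
    fun hc he k => by
    rw [hsucc, stepSize]
    exact mul_le_mul_of_nonneg_left (Real.rpow_le_rpow_of_nonpos (hy0 k) (by linarith)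
      (by linarith)) hc.le
  have hpos : ∀ {c : ℝ} (e : ℝ), 0 < c → ∀ k, 0 < stepSize c k₀ e k := fun e hc k =>
    mul_pos hc (Real.rpow_pos_of_pos (hy0 k) _)
  -- One statement for the three difference conditions: the decrement is at most y^{−1} times the
  -- value, and y^{−1} ≤ δ d y^{−f} as y^{−(1−f)} is small. For κ = β/γ the exponent is b − a and
  -- the comparison sequence is β.
  have hdiff : ∀ {c e d f : ℝ}, 0 < c → e ≤ 1 → 0 < d →
      (∀ k : ℕ, ((k : ℝ) + k₀) ^ (-(1 - f)) ≤ δ * d) → ∀ k : ℕ,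
      stepSize c k₀ e k - stepSize c k₀ e (k + 1) ≤ δ * (stepSize c k₀ e k * stepSize d k₀ f k) :=
    fun {c e d f} hc he hd h k => by
    have h1 := mul_le_mul_of_nonneg_left (rpow_neg_sub_le (hy0 k) he) hc.le
    have h2 := rpow_neg_le_mul (c := 1) (d := d) (δ := δ) (e := f) (f := 1) (hy0 k)
      (by simpa using h k) one_pos
    have h3 := mul_le_mul_of_nonneg_left h2 (hpos e hc k).le
    rw [hsucc]
    simp only [stepSize] at h3 ⊢
    linarith
  have hκ : ∀ k, stepSize cβ k₀ b k / stepSize cγ k₀ a k = stepSize (cβ / cγ) k₀ (b - a) k :=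
    fun k => by
    simp only [stepSize]
    rw [mul_div_mul_comm, ← Real.rpow_sub (hy0 k)]
    congr 2
    ring
  refine ⟨hpos b hcβ, hpos a hcγ, fun k => ?_, fun k => ?_, fun k => ?_, hanti hcβ (by linarith),
    hanti hcγ (by linarith), fun k => ?_, fun k => ?_, fun k => ?_, fun k => ?_⟩
  · exact rpow_neg_le_mul (hy0 k) (hT _ (hyT k)).2.1.1 hcβ
  -- The asymptotic bound is applied at y/p^{4/b} ≥ T. Scaling back produces p^{−4a/b}, which beats
  -- p² because 4a > 2 > 2b.
  · set y := (k : ℝ) + k₀ with hy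
    have hp0 : 0 < p := by linarith
    have hz : T ≤ y / p ^ (4 / b) := (le_div_iff₀ (by positivity)).mpr (hyk k)
    have hz0 : 0 < y / p ^ (4 / b) := by linarith
    have h1 := (hT _ hz).2.1.2.1
    rw [le_div_iff₀ hcγ] at h1
    have h2 : y ^ (-a) = (y / p ^ (4 / b)) ^ (-a) * p ^ (-(4 / b * a)) := by
      rw [mul_comm (4 / b), neg_mul_eq_neg_mul, mul_comm (-a), Real.rpow_mul hp0.le,
        ← Real.mul_rpow hz0.le (by positivity), div_mul_cancel₀ _ (by positivity)]
    have h3 : p ^ 2 * p ^ (-(4 / b * a)) ≤ 1 := by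
      rw [← Real.rpow_natCast, ← Real.rpow_add hp0]
      refine Real.rpow_le_one_of_one_le_of_nonpos (by linarith) ?_
      have : 2 ≤ 4 / b * a := by
        rw [div_mul_eq_mul_div, le_div_iff₀ (by linarith)]
        linarith
      push_cast
      linarith
    calc p ^ 2 * (cγ * y ^ (-a))
        = (p ^ 2 * p ^ (-(4 / b * a))) * ((y / p ^ (4 / b)) ^ (-a) * cγ) := by rw [h2]; ring
      _ ≤ 1 * δ := mul_le_mul h3 h1 (by positivity) zero_le_one
      _ = δ := one_mul δ
  · have h1 := rpow_neg_le_mul (e := b) (f := 2 * a) (hy0 k) (hT _ (hyT k)).2.1.2.2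
      (by positivity)
    refine le_of_eq_of_le ?_ h1
    rw [stepSize, mul_pow, ← Real.rpow_natCast (_ ^ (-a)), ← Real.rpow_mul (hy0 k).le]
    congr 2
    push_cast
    ring
  · rw [hκ, hκ]
    exact hanti (by positivity) (by linarith) k
  · rw [sq]
    exact hdiff hcβ hb.le hcβ (fun k => (hT _ (hyT k)).2.2.1) k
  · rw [sq]
    exact hdiff hcγ (by linarith) hcγ (fun k => (hT _ (hyT k)).2.2.2) k
  · rw [hκ, hκ]
    exact hdiff (by positivity) (by linarith) hcβ (fun k => (hT _ (hyT k)).2.2.1) k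

end StepSizes

end TTSA

theorem proposition4 {m n : ℕ} [NeZero m] [NeZero n] (M : TTSA.Coeffs m n)
    (h22 : TTSA.IsHurwitz (-M.A22)) (hΔ : TTSA.IsHurwitz (-M.schur))
    (θs : TTSA.Vec m) (ws : TTSA.Vec n) (hsol : M.IsSolution θs ws) :
    ∃ (Q22 : Matrix (Fin n) (Fin n) ℝ) (QΔ : Matrix (Fin m) (Fin m) ℝ),
      TTSA.IsLyapunov M.A22 Q22 ∧ TTSA.IsLyapunov M.schur QΔ ∧
      ∃ r : ℝ, 0 < r ∧
        ∀ a b cβ cγ : ℝ, 1 / 2 < a → a < b → b < 1 → 0 < cβ → 0 < cγ → cβ / cγ ≤ r →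
        ∀ CA Cb : ℝ, 0 < CA → 0 < Cb →
        ∀ tmix : ℕ, 1 ≤ tmix →
        ∀ (θ₀ : TTSA.Vec m) (w₀ : TTSA.Vec n),
        ∃ Cstep C : ℝ, 0 < Cstep ∧ 0 < C ∧
          ∀ p : ℝ, 2 ≤ p → ∀ k₀ : ℝ, Cstep * p ^ (4 / b) ≤ k₀ →
          ∀ β γ : ℕ → ℝ, β = TTSA.stepSize cβ k₀ b → γ = TTSA.stepSize cγ k₀ a →
            (∀ k : ℕ, IsUnit (1 - β k • M.U (M.L β γ k))) ∧
            ∀ (S : Type*) [TopologicalSpace S] [PolishSpace S] [MeasurableSpace S] [BorelSpace S]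
              (P : Kernel S S) [IsMarkovKernel P] (π : Measure S) [IsProbabilityMeasure π]
              (F : S → TTSA.Coeffs m n),
              TTSA.IsUGE P π tmix → TTSA.IsBoundedNoise M F π CA Cb →
            ∀ (Ω : Type*) [MeasurableSpace Ω] (μ : Measure Ω) [IsProbabilityMeasure μ]
              (X : ℕ → Ω → S), TTSA.IsMarkovChain μ P X →
            ∀ k : ℕ,
              TTSA.pMoment μ p (TTSA.tildeTheta F β γ θ₀ w₀ θs X (k + 1)) ≤
                  ENNReal.ofReal (C * (∏ j ∈ Finset.range (k + 1), (1 - TTSA.rate QΔ * β j / 8)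
                    + p ^ 2 * √(β k))) ∧
              TTSA.pMoment μ p (TTSA.tildeWSucc M F β γ θ₀ w₀ θs ws X k) ≤
                  ENNReal.ofReal (C * (∏ j ∈ Finset.range (k + 1), (1 - TTSA.rate Q22 * γ j / 8)
                    + p ^ 3 * √(γ k))) := by
  obtain ⟨Q22, hQ22⟩ := TTSA.exists_isLyapunov h22
  obtain ⟨QΔ, hQΔ⟩ := TTSA.exists_isLyapunov hΔ
  have hM : IsUnit M.A22 := by simpa using TTSA.isUnit_one_add_of_isHurwitz h22 0 le_rfl
  refine ⟨Q22, QΔ, hQ22, hQΔ, 1, one_pos, ?_⟩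
  intro a b cβ cγ ha hab hb hcβ hcγ _ CA Cb hCA hCb tmix ht θ₀ w₀
  obtain ⟨δ, C, hδ, hC, hmain⟩ :=
    TTSA.exists_moment_bound M hQ22 hQΔ hM hsol hCA hCb ht θ₀ w₀
  obtain ⟨T, hT, hstep⟩ := TTSA.exists_stepCond ha hab hb hcβ hcγ hδ
  refine ⟨T, C, hT, hC, fun p hp k₀ hk₀ β γ hβ hγ => ?_⟩
  subst hβ hγ
  have hst := hstep p hp k₀ hk₀
  obtain ⟨hunit, hbound⟩ := hmain p _ _ hp hst
  refine ⟨hunit, ?_⟩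
  intro S _ _ _ _ P _ π _ F hP hF Ω _ μ _ X hX k
  -- D_k contains L_{k+1}, so `tildeWSucc` at k unfolds to `errW` at k + 1, and the two bounds
  -- concern the same random vectors.
  obtain ⟨h1, h2⟩ := hbound S P π F hP hF Ω μ X hX k
  -- The bounds obtained are linear in p; they are weakened to the powers p² and p³ of the
  -- statement.
  have hp2 : p ≤ p ^ 2 := by nlinarith
  have hp3 : p ≤ p ^ 3 := by nlinarith
  exact ⟨h1.trans (ENNReal.ofReal_le_ofReal (by gcongr)),
    h2.trans (ENNReal.ofReal_le_ofReal (by gcongr))⟩
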